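/- **Setting.** Let $\mathbb G$ be a Carnot group of step two: its Lie algebra is $\mathfrak g=V_1\oplus V_2$ with $[V_1,V_1]=V_2\neq\{0\}$ and $[V_1,V_2]=\{0\}$, it carries an inner product with $V_1\perp V_2$, and $\mathbb G$ is identified with $\mathfrak g$ through the exponential map, so that $g\circ g'=g+g'+\tfrac12[g,g']$. The Haar measure $dg$ is the Lebesgue measure of $\mathfrak g$, and $\mathbb G$ carries the left-invariant Riemannian metric $\langle\cdot,\cdot\rangle$ that extends the inner product. Let $X_1,\dots,X_m$ be the left-invariant vector fields generated by an orthonormal basis of $V_1$, and put $$|\nabla_H u|^2=\sum_i (X_iu)^2,\qquad \nabla_H^2u=\Big[\tfrac12(X_iX_ju+X_jX_iu)\Big]_{i,j=1}^m .$$ The function $u$ is *$H_2$-convex in $\Omega$* if in $\Omega$ the first and second elementary symmetric functions of the eigenvalues of $\nabla^2_Hu$ are nonnegative, i.e. $\Delta_Hu=\operatorname{tr}\nabla_H^2u\ge 0$ and $(\Delta_H u)^2-\|\nabla_H^2u\|^2\ge0$. $\Gamma^3(\overline\Omega)$ is the class of functions whose horizontal derivatives $X_{j_1}\cdots X_{j_s}u$,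 $s\le 3$, exist in $\Omega$ and extend continuously to $\overline\Omega$. For a bounded open set $\Omega\subset\mathbb G$ of class $C^2$ let $\boldsymbol\nu$ be the outer Riemannian unit normal, $\sigma$ the Riemannian surface measure on $\partial\Omega$, $\boldsymbol N^H=\sum_j\langle\boldsymbol\nu,X_j\rangle X_j$, $W=|\boldsymbol N^H|$, $d\sigma_H=W\,d\sigma$ (the $H$-perimeter measure), $\Sigma=\{g\in\partial\Omega: W(g)=0\}$, and $\boldsymbol\nu^H=\boldsymbol N^H/W$ on $\partial\Omega\setminus\Sigma$. The horizontal mean curvature of $\partial\Omega$ at a point of $\partial\Omega\setminus\Sigma$ is $$\mathcal H=-\sum_{i=1}^{m-1}\langle\nabla^H_{\boldsymbol e_i}\boldsymbol e_i,\boldsymbol\nu^H\rangle ,$$ where $\boldsymbol e_1,\dots,\boldsymbol e_{m-1}$ is a local orthonormal $C^1$ frame of $T\partial\Omega\cap\operatorname{span}(X_1,\dots,X_m)$ and $\nabla^H_XY=\sum_j X(Y_j)X_j$ for horizontal $X$ and $Y=\sum_jY_jX_j$ (the horizontal part of the Levi-Civita connection); thus $\mathcal H\geq 0$ for convex sets.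 The values of $\mathcal H$ on $\Sigma$ do not matter, since $\sigma_H(\Sigma)=0$. **Theorem.** Let $\mathbb G$ be a Carnot group of step two and $\Omega\subset\mathbb G$ a bounded open set of class $C^2$. Let $u\in\Gamma^3(\overline\Omega)\cap C^2(\overline\Omega)$ be $H_2$-convex in $\Omega$ with $u=0$ on $\partial\Omega$. Then the integrals below are finite, and $$\sum_{i,j=1}^m\int_\Omega([X_i,X_j]u)^2\,dg\ \le\ \frac43\int_{\partial\Omega}\mathcal H\,|\nabla_Hu|^2\,d\sigma_H .$$ In particular, if $\mathbb G=\mathbb H^n$, $n\ge1$, is the Heisenberg group with the group law $(x,y,t)\circ(x',y',t')=(x+x',y+y',t+t'+\tfrac12(x\cdot y'-x'\cdot y))$ and the Euclidean inner product on $\mathbb R^{2n+1}$, and $T=\partial/\partial t$, then $$\int_\Omega(Tu)^2\,dg\ \le\ \frac{2}{3n}\int_{\partial\Omega}\mathcal H\,|\nabla_Hu|^2\,d\sigma_H .$$ -/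

import Mathlib

open MeasureTheory Filter Topology Set

noncomputable section

/-- A Carnot group of step two, given by its stratified Lie algebra `E = V₁ ⊕ V₂` and read in
exponential coordinates (`exp : E → G` is a global diffeomorphism, so `G` is identified with `E`).
The inner product of `E` is the one for which the two layers are orthogonal. -/
structure StepTwoCarnot (E : Type*) [NormedAddCommGroup E] [InnerProductSpace ℝ E] where
  /-- the Lie bracket of the Lie algebra -/
  bracket : E →ₗ[ℝ] E →ₗ[ℝ] E
  bracket_self : ∀ x, bracket x x = 0
  jacobi : ∀ x y z,
    bracket x (bracket y z) = bracket (bracket x y) z + bracket y (bracket x z)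
  /-- the horizontal layer -/
  V₁ : Submodule ℝ E
  /-- the vertical layer -/
  V₂ : Submodule ℝ E
  ortho : V₁ ⟂ V₂
  sup_eq_top : V₁ ⊔ V₂ = ⊤
  span_bracket : Submodule.span ℝ {z | ∃ x ∈ V₁, ∃ y ∈ V₁, bracket x y = z} = V₂
  bracket_V₂ : ∀ x ∈ V₁, ∀ z ∈ V₂, bracket x z = 0
  /-- the step is two and not one -/
  V₂_ne_bot : V₂ ≠ ⊥

namespace StepTwoCarnot

variable {E : Type*} [NormedAddCommGroup E] [InnerProductSpace ℝ E]

/-- The group law: the Baker-Campbell-Hausdorff product, which stops at order two. -/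
def mul (𝔾 : StepTwoCarnot E) (x y : E) : E := x + y + (1 / 2 : ℝ) • 𝔾.bracket x y

/-- The inverse of `x = exp x` is `exp (-x)`. -/
def inv (_𝔾 : StepTwoCarnot E) (x : E) : E := -x

theorem bracket_swap (𝔾 : StepTwoCarnot E) (x y : E) : 𝔾.bracket x y = -𝔾.bracket y x := by
  have h := 𝔾.bracket_self (x + y)
  simp only [map_add, LinearMap.add_apply, 𝔾.bracket_self, zero_add, add_zero] at h
  rw [add_comm] at h
  exact eq_neg_of_add_eq_zero_left h

theorem bracket_central (𝔾 : StepTwoCarnot E) (x z : E) (hz : z ∈ 𝔾.V₂) :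
    𝔾.bracket x z = 0 := by
  have hx : x ∈ 𝔾.V₁ ⊔ 𝔾.V₂ := by rw [𝔾.sup_eq_top]; trivial
  obtain ⟨a, ha, b, hb, rfl⟩ := Submodule.mem_sup.1 hx
  rw [map_add, LinearMap.add_apply, 𝔾.bracket_V₂ a ha z hz, zero_add, 𝔾.bracket_swap]
  rw [← 𝔾.span_bracket] at hb
  refine neg_eq_zero.2 ?_
  clear hx
  induction hb using Submodule.span_induction with
  | mem w hw =>
    obtain ⟨p, hp, q, hq, rfl⟩ := hw
    rw [𝔾.bracket_swap, neg_eq_zero]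
    have h := 𝔾.jacobi p q z
    rw [𝔾.bracket_V₂ q hq z hz, 𝔾.bracket_V₂ p hp z hz] at h
    simpa using h.symm
  | zero => simp
  | add u v _ _ hu hv => rw [map_add, hu, hv, add_zero]
  | smul c u _ hu => rw [map_smul, hu, smul_zero]

theorem bracket_mem (𝔾 : StepTwoCarnot E) (x y : E) : 𝔾.bracket x y ∈ 𝔾.V₂ := by
  have hx : x ∈ 𝔾.V₁ ⊔ 𝔾.V₂ := by rw [𝔾.sup_eq_top]; trivial
  have hy : y ∈ 𝔾.V₁ ⊔ 𝔾.V₂ := by rw [𝔾.sup_eq_top]; trivial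
  obtain ⟨a, ha, b, hb, rfl⟩ := Submodule.mem_sup.1 hx
  obtain ⟨c, hc, d, hd, rfl⟩ := Submodule.mem_sup.1 hy
  rw [map_add (𝔾.bracket (a + b)), 𝔾.bracket_central (a + b) d hd, add_zero, map_add,
    LinearMap.add_apply, 𝔾.bracket_swap b c, 𝔾.bracket_central c b hb, neg_zero, add_zero,
    ← 𝔾.span_bracket]
  exact Submodule.subset_span ⟨a, ha, c, hc, rfl⟩

/-- With this law `E` is a group. -/
@[reducible]
def group (𝔾 : StepTwoCarnot E) : Group E where
  mul := 𝔾.mul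
  one := (0 : E)
  inv := 𝔾.inv
  mul_assoc x y z := by
    change 𝔾.mul (𝔾.mul x y) z = 𝔾.mul x (𝔾.mul y z)
    have h1 : 𝔾.bracket (𝔾.bracket x y) z = 0 := by
      rw [𝔾.bracket_swap, 𝔾.bracket_central z _ (𝔾.bracket_mem x y), neg_zero]
    have h2 : 𝔾.bracket x (𝔾.bracket y z) = 0 := 𝔾.bracket_central x _ (𝔾.bracket_mem y z)
    simp only [mul, map_add, map_smul, LinearMap.add_apply, LinearMap.smul_apply, h1, h2,
      smul_zero, add_zero, smul_add]
    abel
  one_mul x := by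
    change 𝔾.mul 0 x = x
    simp [mul]
  mul_one x := by
    change 𝔾.mul x 0 = x
    simp [mul]
  inv_mul_cancel x := by
    change 𝔾.mul (𝔾.inv x) x = 0
    simp [mul, inv, 𝔾.bracket_self]

/-- The left-invariant vector field `g ↦ (L_g)_* v`. -/
def leftInv (𝔾 : StepTwoCarnot E) (v g : E) : E := fderiv ℝ (fun h => 𝔾.mul g h) 0 v

/-- The derivative of `f` along the left-invariant vector field generated by `v`, taken along its
integral curve `s ↦ g exp(s v)`. -/
def lieD (𝔾 : StepTwoCarnot E) (v : E) (f : E → ℝ) (g : E) : ℝ :=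
  deriv (fun s : ℝ => f (𝔾.mul g (s • v))) 0

/-- The left-invariant Riemannian metric that agrees with the inner product at the identity. -/
def metric (𝔾 : StepTwoCarnot E) (g v w : E) : ℝ :=
  inner ℝ (fderiv ℝ (fun h => 𝔾.mul (𝔾.inv g) h) g v)
    (fderiv ℝ (fun h => 𝔾.mul (𝔾.inv g) h) g w)

end StepTwoCarnot

/-! ### Open sets of class `C²` -/

section Domain

variable {E : Type*} [NormedAddCommGroup E] [InnerProductSpace ℝ E]

/-- `φ` is a `C²` defining function of `Ω` near the boundary point `g`. -/
def IsLocalDefining (Ω : Set E) (φ : E → ℝ) (g : E) : Prop :=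
  ContDiffAt ℝ 2 φ g ∧ φ g = 0 ∧ fderiv ℝ φ g ≠ 0 ∧ ∀ᶠ p in 𝓝 g, (p ∈ Ω ↔ φ p < 0)

/-- A bounded open set of class `C²`. -/
def IsC2BoundedOpen (Ω : Set E) : Prop :=
  IsOpen Ω ∧ Bornology.IsBounded Ω ∧ ∀ g ∈ frontier Ω, ∃ φ, IsLocalDefining Ω φ g

end Domain

namespace StepTwoCarnot

variable {E : Type*} [NormedAddCommGroup E] [InnerProductSpace ℝ E]

/-! ### Horizontal calculus

`b` is an orthonormal basis `e₁, …, e_m` of the horizontal layer. -/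

section Calculus

variable {m : ℕ} (𝔾 : StepTwoCarnot E) (b : OrthonormalBasis (Fin m) ℝ 𝔾.V₁)

/-- `X_i f`. -/
def X (i : Fin m) (f : E → ℝ) : E → ℝ := 𝔾.lieD (b i : E) f

/-- `[X_i, X_j] f`. -/
def comm (i j : Fin m) (f : E → ℝ) (g : E) : ℝ :=
  𝔾.X b i (𝔾.X b j f) g - 𝔾.X b j (𝔾.X b i f) g

/-- The symmetrized horizontal Hessian. -/
def symHess (f : E → ℝ) (g : E) : Matrix (Fin m) (Fin m) ℝ :=
  Matrix.of fun i j => (𝔾.X b i (𝔾.X b j f) g + 𝔾.X b j (𝔾.X b i f) g) / 2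

theorem symHess_isHermitian (f : E → ℝ) (g : E) : (𝔾.symHess b f g).IsHermitian := by
  ext i j
  simp [symHess, add_comm]

/-- The `k`-th elementary symmetric function of the eigenvalues of the symmetrized Hessian. -/
def symF (k : ℕ) (f : E → ℝ) (g : E) : ℝ :=
  ∑ t ∈ Finset.powersetCard k Finset.univ,
    ∏ i ∈ t, (𝔾.symHess_isHermitian b f g).eigenvalues i

/-- `f` is `H_r`-convex in `Ω`. -/
def HConvexOn (r : ℕ) (Ω : Set E) (f : E → ℝ) : Prop :=
  ∀ k, 1 ≤ k → k ≤ r → ∀ g ∈ Ω, 0 ≤ 𝔾.symF b k f g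

/-- The class `Γ^k` up to the boundary: the iterated horizontal derivatives of order at most `k`
exist in `Ω` and extend continuously to the closure of `Ω`. -/
def GammaClosure (Ω : Set E) : ℕ → (E → ℝ) → Prop
  | 0, f => ∃ F : E → ℝ, ContinuousOn F (closure Ω) ∧ EqOn f F Ω
  | k + 1, f => (∃ F : E → ℝ, ContinuousOn F (closure Ω) ∧ EqOn f F Ω) ∧
      ∀ i, (∀ g ∈ Ω, DifferentiableAt ℝ (fun s : ℝ => f (𝔾.mul g (s • (b i : E)))) 0) ∧
        GammaClosure Ω k (𝔾.X b i f)

/-- The square length of the horizontal gradient of `f` at a point of the closure of `Ω`, for `f`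
of class `C¹` up to the boundary. -/
def hGradSq (Ω : Set E) (f : E → ℝ) (g : E) : ℝ :=
  ∑ i, (fderivWithin ℝ f (closure Ω) g (𝔾.leftInv (b i : E) g)) ^ 2

end Calculus

/-! ### The boundary -/

section Boundary

/-- `ν` is the outer Riemannian unit normal of `Ω` at `g`: a positive multiple of it is the
Riemannian gradient of a local defining function. -/
def IsOuterNormal (𝔾 : StepTwoCarnot E) (Ω : Set E) (g ν : E) : Prop :=
  𝔾.metric g ν ν = 1 ∧ ∃ φ, IsLocalDefining Ω φ g ∧
    ∃ c : ℝ, 0 < c ∧ ∀ v, fderiv ℝ φ g v = c * 𝔾.metric g ν v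

open Classical in
/-- The outer Riemannian unit normal (zero where there is none). -/
def outerNormal (𝔾 : StepTwoCarnot E) (Ω : Set E) (g : E) : E :=
  if h : ∃ ν, 𝔾.IsOuterNormal Ω g ν then h.choose else 0

/-- The Riemannian area element of a parametrization `ψ` at `y`, the square root of the Gram
determinant of its partial derivatives in the left-invariant metric. -/
def areaElement (𝔾 : StepTwoCarnot E) {d : ℕ} (ψ : EuclideanSpace ℝ (Fin d) → E)
    (y : EuclideanSpace ℝ (Fin d)) : ℝ :=
  Real.sqrt (Matrix.det (Matrix.of fun i j : Fin d =>
    𝔾.metric (ψ y) (fderiv ℝ ψ y (EuclideanSpace.single i 1))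
      (fderiv ℝ ψ y (EuclideanSpace.single j 1))))

/-- `ψ` is an injective `C¹` immersion of the open set `U` into the set `S`. -/
def IsLocalParam (S : Set E) {d : ℕ} (U : Set (EuclideanSpace ℝ (Fin d)))
    (ψ : EuclideanSpace ℝ (Fin d) → E) : Prop :=
  IsOpen U ∧ ContDiffOn ℝ 1 ψ U ∧ InjOn ψ U ∧ (∀ y ∈ U, Function.Injective (fderiv ℝ ψ y)) ∧
    MapsTo ψ U S

/-- The Riemannian surface measure `σ` of the boundary of `Ω`, the measure which on the image of
each local parametrization is the image of the area element. It is obtained from these image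
measures, which agree on overlaps, as their least upper bound. -/
def surfaceMeasure [MeasurableSpace E] [BorelSpace E] (𝔾 : StepTwoCarnot E) (Ω : Set E) :
    Measure E :=
  sSup {μ | ∃ (U : Set (EuclideanSpace ℝ (Fin (Module.finrank ℝ E - 1))))
    (ψ : EuclideanSpace ℝ (Fin (Module.finrank ℝ E - 1)) → E),
    IsLocalParam (frontier Ω) U ψ ∧
    μ = Measure.map ψ
      ((volume.restrict U).withDensity fun y => ENNReal.ofReal (𝔾.areaElement ψ y))}

variable {m : ℕ} (𝔾 : StepTwoCarnot E) (b : OrthonormalBasis (Fin m) ℝ 𝔾.V₁)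

/-- The outer horizontal normal `N^H = ∑ ⟨ν, X_j⟩ X_j`, by its components in the frame
`X₁, …, X_m`. -/
def hNormal (Ω : Set E) (g : E) : EuclideanSpace ℝ (Fin m) :=
  WithLp.toLp 2 fun j => 𝔾.metric g (𝔾.outerNormal Ω g) (𝔾.leftInv (b j : E) g)

/-- The angle function `W = |N^H|`. -/
def angle (Ω : Set E) (g : E) : ℝ := ‖𝔾.hNormal b Ω g‖

/-- The characteristic set. -/
def charSet (Ω : Set E) : Set E := {g ∈ frontier Ω | 𝔾.angle b Ω g = 0}

/-- The horizontal Gauss map `ν^H = N^H / |N^H|`. -/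
def hGauss (Ω : Set E) (g : E) : EuclideanSpace ℝ (Fin m) :=
  (𝔾.angle b Ω g)⁻¹ • 𝔾.hNormal b Ω g

/-- The horizontal Levi-Civita connection `∇^H_v Y` at `g`, for a horizontal vector
`v = ∑ v_k X_k` and a horizontal field `Y = ∑ Y_j X_j`, in components: it differentiates the
components of `Y`, as brackets of horizontal left-invariant fields are vertical and hence
the horizontal part of `∇_{X_k} X_j` is zero. -/
def hConn (v : EuclideanSpace ℝ (Fin m)) (Y : E → EuclideanSpace ℝ (Fin m)) (g : E) :
    EuclideanSpace ℝ (Fin m) :=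
  fderiv ℝ Y g (∑ k, v k • 𝔾.leftInv (b k : E) g)

/-- `h` is the horizontal mean curvature of the boundary at the noncharacteristic point `g`,
computed in an orthonormal `C¹` frame `e₁, …, e_{m-1}` of the horizontal tangent bundle of the
boundary near `g`. The sign is the one for which convex sets have nonnegative curvature with
respect to the outer normal. -/
def IsHMeanCurvature (Ω : Set E) (g : E) (h : ℝ) : Prop :=
  ∃ e : Fin (m - 1) → E → EuclideanSpace ℝ (Fin m),
    (∀ i, ContDiffAt ℝ 1 (e i) g) ∧
    (∀ᶠ p in 𝓝[frontier Ω] g, Orthonormal ℝ (fun i => e i p) ∧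
      ∀ i, inner ℝ (e i p) (𝔾.hNormal b Ω p) = 0) ∧
    h = -∑ i, inner ℝ (𝔾.hConn b (e i g) (e i) g) (𝔾.hGauss b Ω g)

open Classical in
/-- The horizontal mean curvature off the characteristic set. -/
def hMeanCurvatureAux (Ω : Set E) (g : E) : ℝ :=
  if h : ∃ x, 𝔾.IsHMeanCurvature b Ω g x then h.choose else 0

open Classical in
/-- The horizontal mean curvature of the boundary; at a characteristic point it is the limit of
the values at noncharacteristic points (arbitrary if there is no limit). -/
def hMeanCurvature (Ω : Set E) (g : E) : ℝ :=
  if g ∈ 𝔾.charSet b Ω then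
    limUnder (𝓝[frontier Ω \ 𝔾.charSet b Ω] g) (𝔾.hMeanCurvatureAux b Ω)
  else 𝔾.hMeanCurvatureAux b Ω g

/-- The `H`-perimeter measure `dσ_H = W dσ`. -/
def perimeterMeasure [MeasurableSpace E] [BorelSpace E] (Ω : Set E) : Measure E :=
  (𝔾.surfaceMeasure Ω).withDensity fun g => ENNReal.ofReal (𝔾.angle b Ω g)

end Boundary

end StepTwoCarnot

/-! ### The Heisenberg group -/

/-- The underlying space of the Heisenberg group: points `(x, y, t)`. -/
abbrev HeisSpace (n : ℕ) : Type := EuclideanSpace ℝ (Fin n ⊕ Fin n ⊕ Unit)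

/-- The vector `∂/∂t` at the origin. -/
def heisT (n : ℕ) : HeisSpace n := EuclideanSpace.single (Sum.inr (Sum.inr ())) 1

/-- The symplectic form `x · y' - x' · y`. -/
def heisForm (n : ℕ) : HeisSpace n →ₗ[ℝ] HeisSpace n →ₗ[ℝ] ℝ :=
  LinearMap.mk₂ ℝ
    (fun p q => ∑ j : Fin n,
      (p (Sum.inl j) * q (Sum.inr (Sum.inl j)) - q (Sum.inl j) * p (Sum.inr (Sum.inl j))))
    (fun p p' q => by
      simp only [PiLp.add_apply, ← Finset.sum_add_distrib]
      exact Finset.sum_congr rfl fun j _ => by ring)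
    (fun c p q => by
      simp only [PiLp.smul_apply, smul_eq_mul, Finset.mul_sum]
      exact Finset.sum_congr rfl fun j _ => by ring)
    (fun p q q' => by
      simp only [PiLp.add_apply, ← Finset.sum_add_distrib]
      exact Finset.sum_congr rfl fun j _ => by ring)
    (fun c p q => by
      simp only [PiLp.smul_apply, smul_eq_mul, Finset.mul_sum]
      exact Finset.sum_congr rfl fun j _ => by ring)

/-- The bracket `[(x, y, t), (x', y', t')] = (0, 0, x · y' - x' · y)`. -/
def heisBracket (n : ℕ) : HeisSpace n →ₗ[ℝ] HeisSpace n →ₗ[ℝ] HeisSpace n :=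
  (heisForm n).compr₂ (LinearMap.toSpanSingleton ℝ (HeisSpace n) (heisT n))

theorem heisBracket_apply (n : ℕ) (p q : HeisSpace n) :
    heisBracket n p q = heisForm n p q • heisT n := rfl

theorem heisForm_apply (n : ℕ) (p q : HeisSpace n) :
    heisForm n p q = ∑ j : Fin n,
      (p (Sum.inl j) * q (Sum.inr (Sum.inl j)) - q (Sum.inl j) * p (Sum.inr (Sum.inl j))) := rfl

theorem heisForm_heisT (n : ℕ) (p : HeisSpace n) : heisForm n p (heisT n) = 0 := by
  simp [heisForm_apply, heisT]

theorem heisForm_heisT_left (n : ℕ) (p : HeisSpace n) : heisForm n (heisT n) p = 0 := by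
  simp [heisForm_apply, heisT]

/-- The Heisenberg group `ℍⁿ`, `n ≥ 1`, with the group law
`(x, y, t) ∘ (x', y', t') = (x + x', y + y', t + t' + (x · y' - x' · y) / 2)`. -/
def heisenberg (n : ℕ) (hn : 1 ≤ n) : StepTwoCarnot (HeisSpace n) where
  bracket := heisBracket n
  bracket_self p := by
    simp [heisBracket_apply, heisForm_apply]
  jacobi p q r := by
    simp [heisBracket_apply, heisForm_heisT, heisForm_heisT_left]
  V₁ := (ℝ ∙ heisT n)ᗮ
  V₂ := ℝ ∙ heisT n
  ortho := (Submodule.isOrtho_orthogonal_right _).symm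
  sup_eq_top := by
    rw [sup_comm]
    exact Submodule.sup_orthogonal_of_hasOrthogonalProjection
  span_bracket := by
    refine le_antisymm (Submodule.span_le.2 ?_) ?_
    · rintro z ⟨p, -, q, -, rfl⟩
      exact Submodule.smul_mem _ _ (Submodule.mem_span_singleton_self _)
    · rw [Submodule.span_singleton_le_iff_mem]
      refine Submodule.subset_span ⟨EuclideanSpace.single (Sum.inl ⟨0, hn⟩) 1, ?_,
        EuclideanSpace.single (Sum.inr (Sum.inl ⟨0, hn⟩)) 1, ?_, ?_⟩
      · rw [Submodule.mem_orthogonal_singleton_iff_inner_right]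
        simp [heisT, EuclideanSpace.inner_single_left]
      · rw [Submodule.mem_orthogonal_singleton_iff_inner_right]
        simp [heisT, EuclideanSpace.inner_single_left]
      · simp [heisBracket_apply, heisForm_apply]
  bracket_V₂ p _ z hz := by
    obtain ⟨c, rfl⟩ := Submodule.mem_span_singleton.1 hz
    simp [heisBracket_apply, heisForm_heisT]
  V₂_ne_bot := by
    simp [heisT]

end

/-! Write `f i = X_i u` and `a i j = X_i X_j u`. The proof integrates the divergence of the
horizontal field `V i = ∑ j, (f i * a j j + (a i j - 2 * a j i) * f j)` over `Ω`. After a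
relabelling, the third order terms of `div V` are `f j` times `(X_j X_i X_i - 2 X_i X_j X_i + X_i
X_i X_j) u`, which is the double commutator `[[X_j, X_i], X_i] u`. It vanishes because brackets are
central in step two. What remains is the quadratic form `hessQuad a`. Splitting `a` into its
symmetric and antisymmetric parts gives `hessQuad a = 2 F₂ + (3/4) ∑ ([X_i, X_j] u)²`, with `F₂` the
second symmetric function of the eigenvalues of the symmetrized Hessian (`hessQuad_eq`,
`hessQuad_X`). Convexity makes `F₂` nonnegative, and `3/4` becomes the constant `4/3`.

On the boundary `u = 0` forces `f = μ N^H`. The flux of `V` is then `μ (W² tr a - a(N, N))`, which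
is `μ W²` times the trace of `a` over the horizontal tangent space. Differentiating `∑ j, e_j X_j u
= 0` along a horizontal tangent field `e` turns each term of this trace into `-⟨∇_e e, ∇_H u⟩`
(`sum_hess_frame`). The flux density is therefore `𝓗 |∇_H u|² W` (`sum_fluxCoeff_mul_hNormal`). At
characteristic points both sides vanish.

Two points need care. The computation is done with only two derivatives of `u`, so the divergence of
`V` is taken in the sense of distributions; `integral_hessian_pair` is the heart of this. The
divergence theorem must then hold for a merely continuous field with a weak divergence, on a `C²`
domain and with a surface measure defined as a supremum (`setIntegral_eq_of_isWeakDiv`). It is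
obtained by testing with cutoffs which tend to the indicator of `Ω` and by identifying their
gradients, in graph charts, with the Riemannian area element times the normal.

For the Heisenberg group `[X_i, X_j] = ω(e_i, e_j) T`, and the squares of the coefficients sum to
`2n`. -/

noncomputable section

set_option linter.unusedSectionVars false

namespace StepTwoCarnot

/-! ### Left translations and the left-invariant metric in exponential coordinates -/

section Algebra

variable {E : Type*} [NormedAddCommGroup E] [InnerProductSpace ℝ E]

theorem bracket_bracket (𝔾 : StepTwoCarnot E) (x y z : E) :
    𝔾.bracket x (𝔾.bracket y z) = 0 :=
  𝔾.bracket_central x _ (𝔾.bracket_mem y z)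

theorem bracket_bracket_left (𝔾 : StepTwoCarnot E) (x y z : E) :
    𝔾.bracket (𝔾.bracket x y) z = 0 := by
  rw [𝔾.bracket_swap, 𝔾.bracket_bracket, neg_zero]

variable [FiniteDimensional ℝ E]

/-- The Lie bracket as a continuous bilinear map. -/
def bracketCLM (𝔾 : StepTwoCarnot E) : E →L[ℝ] E →L[ℝ] E :=
  LinearMap.toContinuousLinearMap
    ((LinearMap.toContinuousLinearMap (𝕜 := ℝ) (E := E) (F' := E)).toLinearMap ∘ₗ 𝔾.bracket)

@[simp]
theorem bracketCLM_apply (𝔾 : StepTwoCarnot E) (x y : E) :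
    𝔾.bracketCLM x y = 𝔾.bracket x y := rfl

theorem hasFDerivAt_mul (𝔾 : StepTwoCarnot E) (g h : E) :
    HasFDerivAt (fun h => 𝔾.mul g h)
      (ContinuousLinearMap.id ℝ E + (1 / 2 : ℝ) • 𝔾.bracketCLM g) h := by
  unfold mul
  exact (((hasFDerivAt_id h).const_add g)).add ((𝔾.bracketCLM g).hasFDerivAt.const_smul (1 / 2 : ℝ))

theorem leftInv_eq (𝔾 : StepTwoCarnot E) (v g : E) :
    𝔾.leftInv v g = v + (1 / 2 : ℝ) • 𝔾.bracket g v := by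
  rw [leftInv, (𝔾.hasFDerivAt_mul g 0).fderiv]
  simp

theorem leftInv_bracket (𝔾 : StepTwoCarnot E) (v w g : E) :
    𝔾.leftInv (𝔾.bracket v w) g = 𝔾.bracket v w := by
  rw [leftInv_eq, bracket_bracket, smul_zero, add_zero]

/-- The differential at `g` of the left translation by the inverse of `g`. -/
def leftInvSymm (𝔾 : StepTwoCarnot E) (g v : E) : E := v - (1 / 2 : ℝ) • 𝔾.bracket g v

theorem metric_eq (𝔾 : StepTwoCarnot E) (g v w : E) :
    𝔾.metric g v w = inner ℝ (𝔾.leftInvSymm g v) (𝔾.leftInvSymm g w) := by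
  have h (v : E) : fderiv ℝ (fun h => 𝔾.mul (𝔾.inv g) h) g v = 𝔾.leftInvSymm g v := by
    rw [(𝔾.hasFDerivAt_mul _ g).fderiv]
    simp [leftInvSymm, inv, sub_eq_add_neg]
  rw [metric, h, h]

theorem leftInvSymm_leftInv (𝔾 : StepTwoCarnot E) (v g : E) :
    𝔾.leftInvSymm g (𝔾.leftInv v g) = v := by
  simp [leftInvSymm, leftInv_eq, bracket_bracket]

theorem leftInv_leftInvSymm (𝔾 : StepTwoCarnot E) (v g : E) :
    𝔾.leftInv (𝔾.leftInvSymm g v) g = v := by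
  simp [leftInvSymm, leftInv_eq, bracket_bracket]

theorem metric_leftInv (𝔾 : StepTwoCarnot E) (g v w : E) :
    𝔾.metric g (𝔾.leftInv v g) (𝔾.leftInv w g) = inner ℝ v w := by
  rw [metric_eq, leftInvSymm_leftInv, leftInvSymm_leftInv]

theorem leftInvSymm_add (𝔾 : StepTwoCarnot E) (g v w : E) :
    𝔾.leftInvSymm g (v + w) = 𝔾.leftInvSymm g v + 𝔾.leftInvSymm g w := by
  simp [leftInvSymm]; abel

theorem leftInvSymm_smul (𝔾 : StepTwoCarnot E) (g : E) (c : ℝ) (v : E) :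
    𝔾.leftInvSymm g (c • v) = c • 𝔾.leftInvSymm g v := by
  simp [leftInvSymm, smul_sub, smul_comm c]

/-- `leftInvSymm` as a linear map. -/
def leftInvSymmL (𝔾 : StepTwoCarnot E) (g : E) : E →ₗ[ℝ] E where
  toFun := 𝔾.leftInvSymm g
  map_add' := 𝔾.leftInvSymm_add g
  map_smul' := 𝔾.leftInvSymm_smul g

/-- The value at `g` of the left-invariant field generated by a vector, as a continuous linear
function of the vector. -/
def leftInvCLM (𝔾 : StepTwoCarnot E) (g : E) : E →L[ℝ] E :=
  ContinuousLinearMap.id ℝ E + (1 / 2 : ℝ) • 𝔾.bracketCLM g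

theorem leftInvCLM_apply (𝔾 : StepTwoCarnot E) (g v : E) :
    𝔾.leftInvCLM g v = 𝔾.leftInv v g := by
  rw [leftInv_eq]; simp [leftInvCLM]

theorem contDiff_leftInvCLM (𝔾 : StepTwoCarnot E) {n : ℕ∞} : ContDiff ℝ n 𝔾.leftInvCLM := by
  unfold leftInvCLM
  exact contDiff_const.add (𝔾.bracketCLM.contDiff.const_smul _)

theorem contDiff_leftInv (𝔾 : StepTwoCarnot E) (v : E) {n : ℕ∞} :
    ContDiff ℝ n (𝔾.leftInv v) := by
  have : 𝔾.leftInv v = fun g => 𝔾.leftInvCLM g v := by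
    ext1 g; rw [leftInvCLM_apply]
  rw [this]
  exact 𝔾.contDiff_leftInvCLM.clm_apply contDiff_const

theorem continuous_leftInv (𝔾 : StepTwoCarnot E) (v : E) : Continuous (𝔾.leftInv v) :=
  (𝔾.contDiff_leftInv v (n := 0)).continuous

theorem hasFDerivAt_leftInv (𝔾 : StepTwoCarnot E) (v g : E) :
    HasFDerivAt (𝔾.leftInv v) ((1 / 2 : ℝ) • 𝔾.bracketCLM.flip v) g := by
  have : 𝔾.leftInv v = fun g => v + (1 / 2 : ℝ) • 𝔾.bracketCLM.flip v g := by
    ext1 g; rw [leftInv_eq]; simp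
  rw [this]
  exact ((𝔾.bracketCLM.flip v).hasFDerivAt.const_smul _).const_add _

/-- The trace of the map `g ↦ [g, v]` is zero. -/
theorem trace_bracket_flip (𝔾 : StepTwoCarnot E) (v : E) :
    LinearMap.trace ℝ E (𝔾.bracket.flip v) = 0 := by
  -- Brackets are central, so `g ↦ [g, v]` has square zero.
  refine (LinearMap.isNilpotent_trace_of_isNilpotent ⟨2, ?_⟩).eq_zero
  ext x
  simp [pow_two, bracket_bracket_left]

/-- The differential of a left translation has determinant `±1`. -/
theorem det_leftInvSymmL_sq (𝔾 : StepTwoCarnot E) (g : E) :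
    LinearMap.det (𝔾.leftInvSymmL g) ^ 2 = 1 := by
  set S : E →ₗ[ℝ] E := (𝔾.V₂.starProjection : E →ₗ[ℝ] E) with hS
  have hS1 (z : E) (hz : z ∈ 𝔾.V₂) : S z = z := by
    simpa [hS] using (Submodule.starProjection_eq_self_iff).2 hz
  have hS2 (z : E) : S z ∈ 𝔾.V₂ := by simp [hS]
  have hb : ∀ z, 𝔾.bracket g (S z) = 0 := fun z => 𝔾.bracket_central g _ (hS2 z)
  -- `R` is the reflection which is `1` on the central layer and `-1` on its orthogonal complement.
  -- Conjugation by `R` replaces `g` by `-g`, hence the map by its inverse. The square of the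
  -- determinant suffices because only Gram determinants occur later.
  set R : E →ₗ[ℝ] E := (2 : ℝ) • S - LinearMap.id with hR
  have hRR : R * R = 1 := by
    ext z
    simp [hR, hS1 _ (hS2 z), two_smul]
  have hconj : R * 𝔾.leftInvSymmL g * R = 𝔾.leftInvSymmL (-g) := by
    ext z
    have h1 : 𝔾.bracket g (R z) = -𝔾.bracket g z := by
      rw [hR, LinearMap.sub_apply, LinearMap.smul_apply, map_sub, map_smul, hb, smul_zero, zero_sub,
        LinearMap.id_apply]
    have h2 : R (𝔾.bracket g z) = 𝔾.bracket g z := by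
      rw [hR, LinearMap.sub_apply, LinearMap.smul_apply, hS1 _ (𝔾.bracket_mem g z),
        LinearMap.id_apply]
      module
    have h3 : R (R z) = z := LinearMap.congr_fun hRR z
    change R (R z - (1 / 2 : ℝ) • 𝔾.bracket g (R z)) = z - (1 / 2 : ℝ) • 𝔾.bracket (-g) z
    rw [h1, map_sub, map_smul, map_neg, h2, h3, map_neg, LinearMap.neg_apply]
  have hprod : 𝔾.leftInvSymmL g * 𝔾.leftInvSymmL (-g) = 1 := by
    ext z
    simp [leftInvSymmL, leftInvSymm, bracket_bracket]
  have h1 := congrArg LinearMap.det hprod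
  have h2 := congrArg LinearMap.det hconj
  have h3 := congrArg LinearMap.det hRR
  simp only [map_mul, map_one] at h1 h2 h3
  rw [← h2] at h1
  calc LinearMap.det (𝔾.leftInvSymmL g) ^ 2
      = LinearMap.det (𝔾.leftInvSymmL g) * (LinearMap.det R * LinearMap.det (𝔾.leftInvSymmL g) *
        LinearMap.det R) := by
        linear_combination (-(LinearMap.det (𝔾.leftInvSymmL g)) ^ 2) * h3
    _ = 1 := h1

end Algebra

/-! ### Left-invariant derivatives and their commutators -/

section Derivative

variable {E : Type*} [NormedAddCommGroup E] [InnerProductSpace ℝ E] [FiniteDimensional ℝ E]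
  (𝔾 : StepTwoCarnot E)

/-- The derivative of `f` along the left-invariant field generated by `v`, computed with the
differential of `f`. -/
def dirD (v : E) (f : E → ℝ) (g : E) : ℝ := fderiv ℝ f g (𝔾.leftInv v g)

theorem lieD_eq_dirD {v : E} {f : E → ℝ} {g : E} (hf : DifferentiableAt ℝ f g) :
    𝔾.lieD v f g = 𝔾.dirD v f g := by
  have h1 : HasDerivAt (fun s : ℝ => s • v) v 0 := by
    simpa using (hasDerivAt_id (0 : ℝ)).smul_const v
  have h2 : HasDerivAt (fun s : ℝ => 𝔾.mul g (s • v)) (𝔾.leftInv v g) 0 := by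
    have := (𝔾.hasFDerivAt_mul g ((0 : ℝ) • v)).comp_hasDerivAt (0 : ℝ) h1
    rw [← leftInvCLM_apply]
    exact this
  have hg : 𝔾.mul g ((0 : ℝ) • v) = g := by simp [mul]
  have h3 : HasFDerivAt f (fderiv ℝ f g) (𝔾.mul g ((0 : ℝ) • v)) := by
    rw [hg]; exact hf.hasFDerivAt
  exact (h3.comp_hasDerivAt (0 : ℝ) h2).deriv

theorem dirD_congr {v : E} {f f' : E → ℝ} {g : E} (h : f =ᶠ[𝓝 g] f') :
    𝔾.dirD v f =ᶠ[𝓝 g] 𝔾.dirD v f' := by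
  filter_upwards [h.fderiv (𝕜 := ℝ)] with p hp
  simp [dirD, hp]

theorem lieD_congr {v : E} {f f' : E → ℝ} {g : E} (h : f =ᶠ[𝓝 g] f') :
    𝔾.lieD v f g = 𝔾.lieD v f' g := by
  have hc : ContinuousAt (fun s : ℝ => 𝔾.mul g (s • v)) 0 := by
    have : Continuous (fun h => 𝔾.mul g h) :=
      continuous_iff_continuousAt.2 fun h => (𝔾.hasFDerivAt_mul g h).continuousAt
    exact (this.comp (continuous_id.smul continuous_const)).continuousAt
  have hg : 𝔾.mul g ((0 : ℝ) • v) = g := by simp [mul]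
  refine Filter.EventuallyEq.deriv_eq ?_
  have h' : f =ᶠ[𝓝 (𝔾.mul g ((0 : ℝ) • v))] f' := by rwa [hg]
  exact hc.eventually h'

theorem contDiffAt_dirD {v : E} {f : E → ℝ} {g : E} {n : ℕ}
    (hf : ContDiffAt ℝ ((n + 1 : ℕ) : ℕ∞) f g) : ContDiffAt ℝ (n : ℕ∞) (𝔾.dirD v f) g := by
  refine ContDiffAt.clm_apply (hf.fderiv_right ?_) (𝔾.contDiff_leftInv v).contDiffAt
  norm_cast

theorem contDiff_dirD {v : E} {f : E → ℝ} {n : ℕ}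
    (hf : ContDiff ℝ ((n + 1 : ℕ) : ℕ∞) f) : ContDiff ℝ (n : ℕ∞) (𝔾.dirD v f) :=
  contDiff_iff_contDiffAt.2 fun _ => 𝔾.contDiffAt_dirD hf.contDiffAt

theorem continuous_dirD {v : E} {f : E → ℝ} (hf : ContDiff ℝ 1 f) : Continuous (𝔾.dirD v f) :=
  (𝔾.contDiff_dirD (n := 0) hf).continuous

theorem dirD_mul {v : E} {f h : E → ℝ} {g : E} (hf : DifferentiableAt ℝ f g)
    (hh : DifferentiableAt ℝ h g) :
    𝔾.dirD v (fun p => f p * h p) g = f g * 𝔾.dirD v h g + h g * 𝔾.dirD v f g := by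
  simp [dirD, fderiv_fun_mul hf hh]

theorem dirD_eq_zero_of_notMem_tsupport {v : E} {f : E → ℝ} {g : E} (hg : g ∉ tsupport f) :
    𝔾.dirD v f g = 0 := by
  rw [dirD, fderiv_of_notMem_tsupport ℝ hg, zero_apply]

theorem hasCompactSupport_dirD {v : E} {f : E → ℝ} (hf : HasCompactSupport f) :
    HasCompactSupport (𝔾.dirD v f) :=
  HasCompactSupport.intro' hf (isClosed_tsupport f)
    fun _ hx => 𝔾.dirD_eq_zero_of_notMem_tsupport hx

/-- The commutator of two left-invariant derivatives is the derivative along the bracket. -/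
theorem dirD_comm {v w : E} {f : E → ℝ} {g : E} (hf : ContDiffAt ℝ 2 f g) :
    𝔾.dirD v (𝔾.dirD w f) g - 𝔾.dirD w (𝔾.dirD v f) g = fderiv ℝ f g (𝔾.bracket v w) := by
  have hd : DifferentiableAt ℝ (fderiv ℝ f) g :=
    (hf.fderiv_right (m := 1) (by norm_num)).differentiableAt (by norm_num)
  -- The field generated by `w` is affine in `g`, and its derivative along the field of `v` is `[v,
  -- w] / 2`, since `[[g, v], w] = 0`. The second derivative of `f` is symmetric, so only these
  -- halves survive in the commutator.
  have key (v w : E) : 𝔾.dirD v (𝔾.dirD w f) g =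
      fderiv ℝ (fderiv ℝ f) g (𝔾.leftInv v g) (𝔾.leftInv w g) +
        fderiv ℝ f g ((1 / 2 : ℝ) • 𝔾.bracket v w) := by
    have h := hd.hasFDerivAt.clm_apply (𝔾.hasFDerivAt_leftInv w g)
    have h' : fderiv ℝ (𝔾.dirD w f) g = _ := h.fderiv
    rw [dirD, h']
    simp only [add_apply, ContinuousLinearMap.comp_apply,
      smul_apply, ContinuousLinearMap.flip_apply, bracketCLM_apply]
    rw [add_comm]
    congr 2
    rw [𝔾.leftInv_eq v g]
    simp [bracket_bracket_left]
  have hsymm := (hf.isSymmSndFDerivAt (by simp)).eq (𝔾.leftInv v g) (𝔾.leftInv w g)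
  rw [key, key, hsymm, add_sub_add_left_eq_sub, ← map_sub]
  congr 1
  rw [𝔾.bracket_swap w v]
  module

/-- Derivatives along brackets commute with left-invariant derivatives. -/
theorem fderiv_dirD_bracket {v w z : E} {f : E → ℝ} {g : E} (hf : ContDiffAt ℝ 2 f g) :
    𝔾.dirD z (fun p => fderiv ℝ f p (𝔾.bracket v w)) g =
      fderiv ℝ (𝔾.dirD z f) g (𝔾.bracket v w) := by
  have h := 𝔾.dirD_comm (v := z) (w := 𝔾.bracket v w) hf
  have h1 : 𝔾.dirD (𝔾.bracket v w) f = fun p => fderiv ℝ f p (𝔾.bracket v w) := by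
    ext p; rw [dirD, leftInv_bracket]
  rw [h1, bracket_bracket, map_zero, sub_eq_zero] at h
  rw [h, dirD, leftInv_bracket]

end Derivative

end StepTwoCarnot

namespace StepTwoCarnot

/-! ### Integration by parts for left-invariant derivatives -/

section IntegrationByParts

variable {E : Type*} [NormedAddCommGroup E] [InnerProductSpace ℝ E] [FiniteDimensional ℝ E]
  [MeasurableSpace E] [BorelSpace E] (𝔾 : StepTwoCarnot E)

/-- Left-invariant fields are divergence free for Lebesgue measure: the coefficients are affine,
with divergence half the trace of `g ↦ [g, v]`, which is zero. The field is split along an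
orthonormal basis and each affine coefficient is integrated by parts. -/
theorem integral_dirD_eq_zero {v : E} {F : E → ℝ} (hF : ContDiff ℝ 1 F)
    (hc : HasCompactSupport F) : ∫ g, 𝔾.dirD v F g = 0 := by
  have hd : Differentiable ℝ F := hF.differentiable (by norm_num)
  have hcont (w : E) : Continuous fun g => fderiv ℝ F g w :=
    (hF.continuous_fderiv (by norm_num)).clm_apply continuous_const
  have hcs (w : E) : HasCompactSupport fun g => fderiv ℝ F g w :=
    hc.fderiv_apply (𝕜 := ℝ) w
  have hibp (w : E) (L : E →L[ℝ] ℝ) (a : ℝ) :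
      ∫ g, (a + L g) * fderiv ℝ F g w = -∫ g, L w * F g := by
    have hLd (g : E) : HasFDerivAt (fun g => a + L g) L g := L.hasFDerivAt.const_add a
    have hLc : Continuous fun g => a + L g := continuous_const.add L.continuous
    have h := integral_mul_fderiv_eq_neg_fderiv_mul_of_integrable (μ := (volume : Measure E))
      (f := fun g => a + L g) (g := F) (v := w) ?_ ?_ ?_ ?_ ?_
    · rw [h]
      congr 1
      exact integral_congr_ae (ae_of_all _ fun g => by simp only [(hLd g).fderiv])
    · simp only [fun g => (hLd g).fderiv]
      exact (hF.continuous.integrable_of_hasCompactSupport hc).const_mul _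
    · exact (hLc.mul (hcont w)).integrable_of_hasCompactSupport (hcs w).mul_left
    · exact (hLc.mul hF.continuous).integrable_of_hasCompactSupport hc.mul_left
    · exact fun g _ => (hLd g).differentiableAt
    · exact fun g _ => hd g
  let c := stdOrthonormalBasis ℝ E
  let L (k) : E →L[ℝ] ℝ := (innerSL ℝ (c k)).comp (𝔾.bracketCLM.flip v)
  have hL (k) (g : E) : L k g = inner ℝ (c k) (𝔾.bracket g v) := rfl
  have hsplit (g : E) : 𝔾.dirD v F g = (1 + (0 : E →L[ℝ] ℝ) g) * fderiv ℝ F g v +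
      ∑ k, (1 / 2 : ℝ) * ((0 + L k g) * fderiv ℝ F g (c k)) := by
    have h1 : 𝔾.bracket g v = ∑ k, L k g • c k := by
      conv_lhs => rw [← c.sum_repr' (𝔾.bracket g v)]
      simp only [hL]
    rw [dirD, leftInv_eq, map_add, map_smul, h1, map_sum, ← Finset.mul_sum]
    simp
  have hInt (k) : Integrable fun g => (1 / 2 : ℝ) * ((0 + L k g) * fderiv ℝ F g (c k)) := by
    refine Integrable.const_mul ?_ _
    exact ((continuous_const.add (L k).continuous).mul
      (hcont _)).integrable_of_hasCompactSupport (hcs _).mul_left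
  simp only [hsplit]
  rw [integral_add, integral_finsetSum _ fun k _ => hInt k]
  · simp only [integral_const_mul, hibp]
    have htr : ∑ k, L k (c k) = 0 := by
      rw [← 𝔾.trace_bracket_flip v, LinearMap.trace_eq_sum_inner _ c]
      rfl
    rw [← Finset.mul_sum, Finset.sum_neg_distrib, ← Finset.sum_mul, htr]
    simp
  · simpa using (hcont v).integrable_of_hasCompactSupport (hcs v)
  · exact integrable_finsetSum _ fun k _ => hInt k

theorem integral_dirD_mul {v : E} {f h : E → ℝ} (hf : ContDiff ℝ 1 f) (hh : ContDiff ℝ 1 h)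
    (hc : HasCompactSupport h) :
    ∫ g, 𝔾.dirD v f g * h g = -∫ g, f g * 𝔾.dirD v h g := by
  have h0 := 𝔾.integral_dirD_eq_zero (v := v) (hf.mul hh) hc.mul_left
  have hfd := hf.differentiable (by norm_num)
  have hhd := hh.differentiable (by norm_num)
  have hi1 : Integrable fun g => f g * 𝔾.dirD v h g :=
    (hf.continuous.mul (𝔾.continuous_dirD hh)).integrable_of_hasCompactSupport
      (𝔾.hasCompactSupport_dirD hc).mul_left
  have hi2 : Integrable fun g => h g * 𝔾.dirD v f g :=
    (hh.continuous.mul (𝔾.continuous_dirD hf)).integrable_of_hasCompactSupport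
      hc.mul_right
  have h1 : ∫ g, 𝔾.dirD v (fun p => f p * h p) g =
      ∫ g, (f g * 𝔾.dirD v h g + h g * 𝔾.dirD v f g) :=
    integral_congr_ae (ae_of_all _ fun g => 𝔾.dirD_mul (hfd g) (hhd g))
  rw [integral_add hi1 hi2] at h1
  simp only [mul_comm (𝔾.dirD v f _)]
  have h2 : ∫ g, 𝔾.dirD v (fun p => f p * h p) g = 0 := h0
  linarith

/-- Moving both derivatives from `ψ` to `f` leaves the commutator of the two fields applied to `f`.
The resulting formula contains only first derivatives of `f`, which allows the extension to `C¹`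
functions by mollification. -/
theorem integral_dirD_antisymm_of_contDiff_two {v w : E} {f ψ : E → ℝ} (hf : ContDiff ℝ 2 f)
    (hψ : ContDiff ℝ 1 ψ) (hc : HasCompactSupport ψ) :
    ∫ g, (𝔾.dirD v f g * 𝔾.dirD w ψ g - 𝔾.dirD w f g * 𝔾.dirD v ψ g) =
      ∫ g, ψ g * fderiv ℝ f g (𝔾.bracket v w) := by
  have hf1 : ContDiff ℝ 1 f := hf.of_le (by norm_num)
  have hD (v : E) : ContDiff ℝ 1 (𝔾.dirD v f) := 𝔾.contDiff_dirD (n := 1) hf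
  have hi (v w : E) : Integrable fun g => 𝔾.dirD v f g * 𝔾.dirD w ψ g :=
    ((𝔾.continuous_dirD hf1).mul (𝔾.continuous_dirD hψ)).integrable_of_hasCompactSupport
      (𝔾.hasCompactSupport_dirD hc).mul_left
  have hi' (v w : E) : Integrable fun g => 𝔾.dirD v (𝔾.dirD w f) g * ψ g :=
    ((𝔾.continuous_dirD (hD w)).mul hψ.continuous).integrable_of_hasCompactSupport
      hc.mul_left
  rw [integral_sub (hi v w) (hi w v)]
  have h1 := 𝔾.integral_dirD_mul (v := w) (hD v) hψ hc
  have h2 := 𝔾.integral_dirD_mul (v := v) (hD w) hψ hc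
  have h3 : ∫ g, ψ g * fderiv ℝ f g (𝔾.bracket v w) =
      ∫ g, (𝔾.dirD v (𝔾.dirD w f) g * ψ g - 𝔾.dirD w (𝔾.dirD v f) g * ψ g) :=
    integral_congr_ae (ae_of_all _ fun g => by
      simp only [← 𝔾.dirD_comm hf.contDiffAt]; ring)
  rw [h3, integral_sub (hi' v w) (hi' w v), h1, h2]
  ring

/-- The antisymmetrized product of two left-invariant derivatives, for functions which are only
once differentiable. -/
theorem integral_dirD_antisymm {v w : E} {f ψ : E → ℝ} (hf : ContDiff ℝ 1 f)
    (hfc : HasCompactSupport f) (hψ : ContDiff ℝ 1 ψ) (hc : HasCompactSupport ψ) :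
    ∫ g, (𝔾.dirD v f g * 𝔾.dirD w ψ g - 𝔾.dirD w f g * 𝔾.dirD v ψ g) =
      ∫ g, ψ g * fderiv ℝ f g (𝔾.bracket v w) := by
  -- Both sides involve `f` only through first derivatives. These commute with the convolution,
  -- converge pointwise and are uniformly bounded, so dominated convergence applies.
  let ρ (n : ℕ) : ContDiffBump (0 : E) :=
    ⟨1 / (n + 2), 1 / (n + 1), by positivity, by gcongr; norm_num⟩
  have hρ : Tendsto (fun n => (ρ n).rOut) atTop (𝓝 0) := tendsto_one_div_add_atTop_nhds_zero_nat
  let F (n : ℕ) : E → ℝ :=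
    MeasureTheory.convolution ((ρ n).normed volume) f (ContinuousLinearMap.lsmul ℝ ℝ) volume
  have hFs (n : ℕ) : ContDiff ℝ 2 (F n) :=
    HasCompactSupport.contDiff_convolution_left _ (ρ n).hasCompactSupport_normed
      (ρ n).contDiff_normed hf.continuous.locallyIntegrable
  have hcont (w : E) : Continuous fun g => fderiv ℝ f g w :=
    (hf.continuous_fderiv (by norm_num)).clm_apply continuous_const
  have hFd (n : ℕ) (x w : E) : fderiv ℝ (F n) x w = MeasureTheory.convolution
      ((ρ n).normed volume) (fun a => fderiv ℝ f a w) (ContinuousLinearMap.lsmul ℝ ℝ) volume x := by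
    have h := HasCompactSupport.hasFDerivAt_convolution_right (ContinuousLinearMap.lsmul ℝ ℝ)
      (μ := (volume : Measure E)) hfc
      ((ρ n).continuous_normed (μ := (volume : Measure E))).locallyIntegrable hf x
    rw [h.fderiv]
    exact convolution_precompR_apply _
      ((ρ n).continuous_normed (μ := (volume : Measure E))).locallyIntegrable (hfc.fderiv ℝ)
      (hf.continuous_fderiv (by norm_num)) x w
  have hlim (x w : E) : Tendsto (fun n => fderiv ℝ (F n) x w) atTop (𝓝 (fderiv ℝ f x w)) := by
    simp only [hFd]
    exact ContDiffBump.convolution_tendsto_right_of_continuous hρ (hcont w) x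
  obtain ⟨C, hC⟩ := (hf.continuous_fderiv (by norm_num)).bounded_above_of_compact_support
    (hfc.fderiv ℝ)
  -- Two values of the derivative of `f` along `w` differ by at most `2 C ‖w‖`; hence so do the
  -- average and the value at `x`. The third `C ‖w‖` bounds the value at `x`.
  have hbd (n : ℕ) (x w : E) : ‖fderiv ℝ (F n) x w‖ ≤ 3 * C * ‖w‖ := by
    have hle (a : E) : ‖fderiv ℝ f a w‖ ≤ C * ‖w‖ :=
      (ContinuousLinearMap.le_opNorm _ _).trans (by gcongr; exact hC a)
    have h := ContDiffBump.dist_normed_convolution_le (φ := ρ n) (μ := (volume : Measure E))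
      (g := fun a => fderiv ℝ f a w) (x₀ := x) (ε := 2 * (C * ‖w‖))
      (hcont w).aestronglyMeasurable fun a _ => by
        rw [dist_eq_norm]
        exact (norm_sub_le _ _).trans (by linarith [hle a, hle x])
    rw [← hFd, dist_eq_norm] at h
    have h' := norm_le_norm_sub_add (fderiv ℝ (F n) x w) (fderiv ℝ f x w)
    linarith [hle x]
  have hFc1 (n : ℕ) : ContDiff ℝ 1 (F n) := (hFs n).of_le (by norm_num)
  have hL : Tendsto (fun n => ∫ g, (𝔾.dirD v (F n) g * 𝔾.dirD w ψ g -
      𝔾.dirD w (F n) g * 𝔾.dirD v ψ g)) atTop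
      (𝓝 (∫ g, (𝔾.dirD v f g * 𝔾.dirD w ψ g - 𝔾.dirD w f g * 𝔾.dirD v ψ g))) := by
    refine tendsto_integral_of_dominated_convergence
      (fun g => 3 * C * ‖𝔾.leftInv v g‖ * ‖𝔾.dirD w ψ g‖ +
        3 * C * ‖𝔾.leftInv w g‖ * ‖𝔾.dirD v ψ g‖) ?_ ?_ ?_ ?_
    · intro n
      exact (((𝔾.continuous_dirD (hFc1 n)).mul (𝔾.continuous_dirD hψ)).sub
        ((𝔾.continuous_dirD (hFc1 n)).mul (𝔾.continuous_dirD hψ))).aestronglyMeasurable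
    · have (v w : E) : Integrable fun g => 3 * C * ‖𝔾.leftInv v g‖ * ‖𝔾.dirD w ψ g‖ :=
        ((continuous_const.mul (𝔾.continuous_leftInv v).norm).mul
          (𝔾.continuous_dirD hψ).norm).integrable_of_hasCompactSupport
          (𝔾.hasCompactSupport_dirD hc).norm.mul_left
      exact (this v w).add (this w v)
    · intro n
      refine ae_of_all _ fun g => (norm_sub_le _ _).trans ?_
      rw [norm_mul, norm_mul]
      gcongr <;> exact hbd n g _
    · exact ae_of_all _ fun g => ((hlim g _).mul_const _).sub ((hlim g _).mul_const _)
  have hR : Tendsto (fun n => ∫ g, ψ g * fderiv ℝ (F n) g (𝔾.bracket v w)) atTop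
      (𝓝 (∫ g, ψ g * fderiv ℝ f g (𝔾.bracket v w))) := by
    refine tendsto_integral_of_dominated_convergence
      (fun g => ‖ψ g‖ * (3 * C * ‖𝔾.bracket v w‖)) ?_ ?_ ?_ ?_
    · intro n
      exact (hψ.continuous.mul (((hFc1 n).continuous_fderiv (by norm_num)).clm_apply
        continuous_const)).aestronglyMeasurable
    · exact (hψ.continuous.norm.integrable_of_hasCompactSupport hc.norm).mul_const _
    · intro n
      refine ae_of_all _ fun g => ?_
      rw [norm_mul]
      gcongr
      exact hbd n g _
    · exact ae_of_all _ fun g => (hlim g _).const_mul _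
  refine tendsto_nhds_unique hL (hR.congr fun n => ?_)
  exact (𝔾.integral_dirD_antisymm_of_contDiff_two (hFs n) hψ hc).symm

end IntegrationByParts

end StepTwoCarnot

/-- The coefficients of the flux field built from a gradient `f` and a Hessian `a`. -/
def fluxCoeff {m : ℕ} (f : Fin m → ℝ) (a : Fin m → Fin m → ℝ) (i : Fin m) : ℝ :=
  ∑ j, (f i * a j j + (a i j - 2 * a j i) * f j)

/-- The divergence of the flux field, as a quadratic form in the Hessian `a`. -/
def hessQuad {m : ℕ} (a : Fin m → Fin m → ℝ) : ℝ :=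
  ∑ i, ∑ j, (a i i * a j j - a j i * a i j + (a i j - a j i) * a i j)

namespace StepTwoCarnot

/-! ### The divergence of the flux field, in weak form -/

section WeakIdentity

variable {E : Type*} [NormedAddCommGroup E] [InnerProductSpace ℝ E] [FiniteDimensional ℝ E]
  [MeasurableSpace E] [BorelSpace E] (𝔾 : StepTwoCarnot E)

/-- The antisymmetric formula with `X_v u` and `ψ = η X_w u` produces `[v, w] X_v u`. As `[v, w]` is
central this equals `X_v [v, w] u`, where `[v, w] u` is of class `C¹`, and one more integration by
parts returns it to second derivatives. Third derivatives of `u` cancel in this way without having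
to exist. -/
theorem integral_hessian_pair {v w : E} {u η : E → ℝ} (hu : ContDiff ℝ 2 u)
    (huc : HasCompactSupport u) (hη : ContDiff ℝ 1 η) (hηc : HasCompactSupport η) :
    Integrable (fun g => η g * (𝔾.dirD v (𝔾.dirD v u) g * 𝔾.dirD w (𝔾.dirD w u) g -
        𝔾.dirD w (𝔾.dirD v u) g * 𝔾.dirD v (𝔾.dirD w u) g +
        (𝔾.dirD v (𝔾.dirD w u) g - 𝔾.dirD w (𝔾.dirD v u) g) * 𝔾.dirD v (𝔾.dirD w u) g) +
      (𝔾.dirD w u g * 𝔾.dirD v (𝔾.dirD v u) g * 𝔾.dirD w η g +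
        (𝔾.dirD v (𝔾.dirD w u) g - 2 * 𝔾.dirD w (𝔾.dirD v u) g) * 𝔾.dirD w u g *
          𝔾.dirD v η g)) ∧
    ∫ g, (η g * (𝔾.dirD v (𝔾.dirD v u) g * 𝔾.dirD w (𝔾.dirD w u) g -
        𝔾.dirD w (𝔾.dirD v u) g * 𝔾.dirD v (𝔾.dirD w u) g +
        (𝔾.dirD v (𝔾.dirD w u) g - 𝔾.dirD w (𝔾.dirD v u) g) * 𝔾.dirD v (𝔾.dirD w u) g) +
      (𝔾.dirD w u g * 𝔾.dirD v (𝔾.dirD v u) g * 𝔾.dirD w η g +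
        (𝔾.dirD v (𝔾.dirD w u) g - 2 * 𝔾.dirD w (𝔾.dirD v u) g) * 𝔾.dirD w u g *
          𝔾.dirD v η g)) = 0 := by
  have hD (v : E) : ContDiff ℝ 1 (𝔾.dirD v u) := 𝔾.contDiff_dirD (n := 1) hu
  have hDD (v w : E) : Continuous (𝔾.dirD v (𝔾.dirD w u)) := 𝔾.continuous_dirD (hD w)
  have hDη (v : E) : Continuous (𝔾.dirD v η) := 𝔾.continuous_dirD hη
  have hDηc (v : E) : HasCompactSupport (𝔾.dirD v η) := 𝔾.hasCompactSupport_dirD hηc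
  have hψ : ContDiff ℝ 1 (fun g => η g * 𝔾.dirD w u g) := hη.mul (hD w)
  have hψc : HasCompactSupport (fun g => η g * 𝔾.dirD w u g) := hηc.mul_right
  have hC : ContDiff ℝ 1 fun p => fderiv ℝ u p (𝔾.bracket v w) :=
    (hu.fderiv_right (m := 1) (by norm_num)).clm_apply contDiff_const
  have hB := 𝔾.integral_dirD_antisymm (v := v) (w := w) (hD v)
    (𝔾.hasCompactSupport_dirD huc) hψ hψc
  have hI := 𝔾.integral_dirD_mul (v := v) hC hψ hψc
  have hCeq (g : E) : fderiv ℝ u g (𝔾.bracket v w) =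
      𝔾.dirD v (𝔾.dirD w u) g - 𝔾.dirD w (𝔾.dirD v u) g := (𝔾.dirD_comm hu.contDiffAt).symm
  have hψd (z : E) (g : E) : 𝔾.dirD z (fun g => η g * 𝔾.dirD w u g) g =
      η g * 𝔾.dirD z (𝔾.dirD w u) g + 𝔾.dirD w u g * 𝔾.dirD z η g :=
    𝔾.dirD_mul (hη.differentiable (by norm_num) g) ((hD w).differentiable (by norm_num) g)
  have hswap : ∫ g, 𝔾.dirD v (fun p => fderiv ℝ u p (𝔾.bracket v w)) g *
      (η g * 𝔾.dirD w u g) = ∫ g, (η g * 𝔾.dirD w u g) *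
        fderiv ℝ (𝔾.dirD v u) g (𝔾.bracket v w) :=
    integral_congr_ae (ae_of_all _ fun g => by
      simp only [𝔾.fderiv_dirD_bracket hu.contDiffAt]; ring)
  rw [hI, ← hB] at hswap
  simp only [hCeq, hψd] at hswap
  set A : E → ℝ := fun g => 𝔾.dirD v (𝔾.dirD v u) g *
      (η g * 𝔾.dirD w (𝔾.dirD w u) g + 𝔾.dirD w u g * 𝔾.dirD w η g) -
        𝔾.dirD w (𝔾.dirD v u) g *
          (η g * 𝔾.dirD v (𝔾.dirD w u) g + 𝔾.dirD w u g * 𝔾.dirD v η g) with hA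
  set B : E → ℝ := fun g => (𝔾.dirD v (𝔾.dirD w u) g - 𝔾.dirD w (𝔾.dirD v u) g) *
      (η g * 𝔾.dirD v (𝔾.dirD w u) g + 𝔾.dirD w u g * 𝔾.dirD v η g) with hB'
  have hci (z : E) : Continuous (fun g => η g * 𝔾.dirD z (𝔾.dirD w u) g +
      𝔾.dirD w u g * 𝔾.dirD z η g) :=
    (hη.continuous.mul (hDD z w)).add ((hD w).continuous.mul (hDη z))
  have hcc (z : E) : HasCompactSupport (fun g => η g * 𝔾.dirD z (𝔾.dirD w u) g +
      𝔾.dirD w u g * 𝔾.dirD z η g) :=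
    HasCompactSupport.add hηc.mul_right (hDηc z).mul_left
  have hAi : Integrable A :=
    (((hDD v v).mul (hci w)).integrable_of_hasCompactSupport (hcc w).mul_left).sub
      (((hDD w v).mul (hci v)).integrable_of_hasCompactSupport (hcc v).mul_left)
  have hBi : Integrable B :=
    (((hDD v w).sub (hDD w v)).mul (hci v)).integrable_of_hasCompactSupport (hcc v).mul_left
  have hsum : (fun g => η g * (𝔾.dirD v (𝔾.dirD v u) g * 𝔾.dirD w (𝔾.dirD w u) g -
        𝔾.dirD w (𝔾.dirD v u) g * 𝔾.dirD v (𝔾.dirD w u) g +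
        (𝔾.dirD v (𝔾.dirD w u) g - 𝔾.dirD w (𝔾.dirD v u) g) * 𝔾.dirD v (𝔾.dirD w u) g) +
      (𝔾.dirD w u g * 𝔾.dirD v (𝔾.dirD v u) g * 𝔾.dirD w η g +
        (𝔾.dirD v (𝔾.dirD w u) g - 2 * 𝔾.dirD w (𝔾.dirD v u) g) * 𝔾.dirD w u g *
          𝔾.dirD v η g)) = fun g => A g + B g := by
    ext g
    simp only [hA, hB']
    ring
  rw [hsum]
  refine ⟨hAi.add hBi, ?_⟩
  rw [integral_add hAi hBi]
  linarith

theorem integral_hessQuad_of_hasCompactSupport {m : ℕ} (e : Fin m → E) {u η : E → ℝ}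
    (hu : ContDiff ℝ 2 u) (huc : HasCompactSupport u) (hη : ContDiff ℝ 1 η)
    (hηc : HasCompactSupport η) :
    ∫ g, (η g * hessQuad (fun i j => 𝔾.dirD (e i) (𝔾.dirD (e j) u) g) +
      ∑ i, fluxCoeff (fun i => 𝔾.dirD (e i) u g)
        (fun i j => 𝔾.dirD (e i) (𝔾.dirD (e j) u) g) i * 𝔾.dirD (e i) η g) = 0 := by
  have h (i j : Fin m) := 𝔾.integral_hessian_pair (v := e i) (w := e j) hu huc hη hηc
  have h0 : ∑ i, ∑ j, ∫ g, _ = (0 : ℝ) :=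
    Finset.sum_eq_zero fun i _ => Finset.sum_eq_zero fun j _ => (h i j).2
  rw [← h0]
  simp only [← integral_finsetSum Finset.univ fun j _ => (h _ j).1]
  rw [← integral_finsetSum Finset.univ fun i _ => integrable_finsetSum _ fun j _ => (h i j).1]
  refine integral_congr_ae (ae_of_all _ fun g => ?_)
  simp only [hessQuad, fluxCoeff, Finset.mul_sum, Finset.sum_mul]
  simp only [Finset.sum_add_distrib (f := fun i => _ * _), add_mul]
  -- In the pair formula the trace term comes with the derivative of `η` in the other direction; the
  -- sum over all pairs restores the form of the flux.
  have hsw : ∑ i, ∑ j, 𝔾.dirD (e i) u g * 𝔾.dirD (e j) (𝔾.dirD (e j) u) g * 𝔾.dirD (e i) η g =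
      ∑ i, ∑ j, 𝔾.dirD (e j) u g * 𝔾.dirD (e i) (𝔾.dirD (e i) u) g * 𝔾.dirD (e j) η g :=
    Finset.sum_comm
  simp only [Finset.sum_add_distrib, hsw]

/-- Two nested compact neighbourhoods are used so that the cutoff is `1` in a neighbourhood of `K`,
and not just on it: derivatives are compared at the points of `K`. -/
theorem exists_cutoff {K Ω : Set E} (hK : IsCompact K) (hΩ : IsOpen Ω) (hKΩ : K ⊆ Ω) :
    ∃ θ : E → ℝ, ContDiff ℝ 2 θ ∧ HasCompactSupport θ ∧ tsupport θ ⊆ Ω ∧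
      ∀ g ∈ K, θ =ᶠ[𝓝 g] 1 := by
  obtain ⟨L, hL, hKL, hLΩ⟩ := exists_compact_between hK hΩ hKΩ
  obtain ⟨M, hM, hLM, hMΩ⟩ := exists_compact_between hL hΩ hLΩ
  obtain ⟨f, h0, h1, -⟩ := exists_contMDiffMap_zero_one_of_isClosed (n := 2)
    (modelWithCornersSelf ℝ E)
    (isOpen_interior (s := M)).isClosed_compl hL.isClosed
    (disjoint_compl_left_iff_subset.2 hLM)
  have hsub : tsupport f ⊆ M := by
    refine closure_minimal (fun x hx => ?_) hM.isClosed
    by_contra hxM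
    exact hx (h0 fun hx' => hxM (interior_subset hx'))
  refine ⟨f, f.contMDiff.contDiff, hM.of_isClosed_subset (isClosed_tsupport _) hsub,
    hsub.trans hMΩ, fun g hg => ?_⟩
  filter_upwards [mem_interior_iff_mem_nhds.1 (hKL hg)] with x hx using h1 hx

/-- The divergence identity of the flux field, tested against compactly supported functions. -/
theorem integral_hessQuad {m : ℕ} (e : Fin m → E) {Ω : Set E} (hΩ : IsOpen Ω) {u η : E → ℝ}
    (hu : ContDiffOn ℝ 2 u Ω) (hη : ContDiff ℝ 1 η) (hηc : HasCompactSupport η)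
    (hηΩ : tsupport η ⊆ Ω) :
    ∫ g, (η g * hessQuad (fun i j => 𝔾.dirD (e i) (𝔾.dirD (e j) u) g) +
      ∑ i, fluxCoeff (fun i => 𝔾.dirD (e i) u g)
        (fun i j => 𝔾.dirD (e i) (𝔾.dirD (e j) u) g) i * 𝔾.dirD (e i) η g) = 0 := by
  -- Nothing is assumed on `u` outside `Ω`. The product `θ u` is of class `C²` with compact support
  -- on all of `E` and coincides with `u` near the support of `η`.
  obtain ⟨θ, hθ, hθc, hθΩ, hθ1⟩ := exists_cutoff hηc hΩ hηΩ
  have hw : ContDiff ℝ 2 (fun g => θ g * u g) := by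
    refine contDiff_iff_contDiffAt.2 fun g => ?_
    by_cases hg : g ∈ Ω
    · exact hθ.contDiffAt.mul (hu.contDiffAt (hΩ.mem_nhds hg))
    · have hz : (fun g => θ g * u g) =ᶠ[𝓝 g] fun _ => 0 := by
        have h0 : θ =ᶠ[𝓝 g] 0 := notMem_tsupport_iff_eventuallyEq.1 fun h => hg (hθΩ h)
        filter_upwards [h0] with x hx
        simp [hx]
      exact contDiffAt_const.congr_of_eventuallyEq hz
  rw [← 𝔾.integral_hessQuad_of_hasCompactSupport e hw hθc.mul_right hη hηc]
  refine integral_congr_ae (ae_of_all _ fun g => ?_)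
  by_cases hg : g ∈ tsupport η
  · have he : u =ᶠ[𝓝 g] fun g => θ g * u g := by
      filter_upwards [hθ1 g hg] with x hx
      simp [hx]
    have h1 (i : Fin m) := 𝔾.dirD_congr (v := e i) he
    have h2 (i j : Fin m) := 𝔾.dirD_congr (v := e i) (h1 j)
    simp only [fun i => (h1 i).eq_of_nhds, fun i j => (h2 i j).eq_of_nhds]
  · simp [image_eq_zero_of_notMem_tsupport hg, fun i => 𝔾.dirD_eq_zero_of_notMem_tsupport
      (v := e i) hg]

end WeakIdentity

end StepTwoCarnot

/-! ### Graph charts of the boundary -/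

section Charts

variable {E : Type*} [NormedAddCommGroup E] [InnerProductSpace ℝ E] [FiniteDimensional ℝ E]
  [MeasurableSpace E] [BorelSpace E]

/-- Euclidean coordinates of `E` in which an open piece of `Ω` is a subgraph of class `C²`. -/
structure GraphChart (Ω : Set E) where
  /-- the coordinates -/
  coord : E ≃L[ℝ] EuclideanSpace ℝ (Fin (Module.finrank ℝ E - 1)) × ℝ
  inner_eq : ∀ v w, inner ℝ v w = inner ℝ (coord v).1 (coord w).1 + (coord v).2 * (coord w).2
  measurePreserving : MeasurePreserving coord volume (volume.prod volume)
  /-- the function whose graph is the boundary -/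
  height : EuclideanSpace ℝ (Fin (Module.finrank ℝ E - 1)) → ℝ
  contDiff_height : ContDiff ℝ 2 height
  /-- the piece of `E` in which `Ω` is the subgraph -/
  dom : Set E
  isOpen_dom : IsOpen dom
  mem_iff : ∀ p ∈ dom, p ∈ Ω ↔ (coord p).2 < height (coord p).1

theorem exists_coord_of_finrank_eq {F : Type*} [NormedAddCommGroup F] [InnerProductSpace ℝ F]
    [FiniteDimensional ℝ F] [MeasurableSpace F] [BorelSpace F]
    (hfin : Module.finrank ℝ E = Module.finrank ℝ F + 1) {N : E} (hN : ‖N‖ = 1) :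
    ∃ P : E ≃L[ℝ] F × ℝ,
      (∀ v w, inner ℝ v w = inner ℝ (P v).1 (P w).1 + (P v).2 * (P w).2) ∧
      MeasurePreserving P volume (volume.prod volume) ∧ P.symm (0, 1) = N := by
  have hfin' : Module.finrank ℝ E = Module.finrank ℝ (WithLp 2 (F × ℝ)) := by
    rw [(WithLp.linearEquiv 2 ℝ (F × ℝ)).finrank_eq, Module.finrank_prod, Module.finrank_self, hfin]
  let P₀ : E ≃ₗᵢ[ℝ] WithLp 2 (F × ℝ) :=
    (stdOrthonormalBasis ℝ E).equiv (stdOrthonormalBasis ℝ (WithLp 2 (F × ℝ))) (finCongr hfin')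
  have he : ‖P₀ N‖ = ‖WithLp.toLp 2 ((0 : F), (1 : ℝ))‖ := by
    rw [LinearIsometryEquiv.norm_map, hN, WithLp.norm_toLp_snd, norm_one]
  -- The reflection that exchanges two vectors of equal norm turns an arbitrary isometry into one
  -- that takes `N` to the vertical unit vector.
  let P₁ : E ≃ₗᵢ[ℝ] WithLp 2 (F × ℝ) :=
    P₀.trans (Submodule.reflection (Submodule.span ℝ {P₀ N - WithLp.toLp 2 ((0 : F), (1 : ℝ))})ᗮ)
  have hP₁ : P₁ N = WithLp.toLp 2 ((0 : F), (1 : ℝ)) := Submodule.reflection_sub he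
  clear_value P₁
  refine ⟨P₁.toContinuousLinearEquiv.trans (WithLp.prodContinuousLinearEquiv 2 ℝ F ℝ),
    fun v w => ?_, ?_, ?_⟩
  · rw [← P₁.inner_map_map v w, WithLp.prod_inner_apply]
    congr 1
    exact mul_comm _ _
  · exact (WithLp.volume_preserving_ofLp _ _).comp P₁.measurePreserving
  · rw [ContinuousLinearEquiv.symm_apply_eq]
    change _ = WithLp.ofLp (P₁ N)
    rw [hP₁]

theorem exists_coord_of_norm_eq_one {N : E} (hN : ‖N‖ = 1) :
    ∃ P : E ≃L[ℝ] EuclideanSpace ℝ (Fin (Module.finrank ℝ E - 1)) × ℝ,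
      (∀ v w, inner ℝ v w = inner ℝ (P v).1 (P w).1 + (P v).2 * (P w).2) ∧
      MeasurePreserving P volume (volume.prod volume) ∧ P.symm (0, 1) = N := by
  have : Nontrivial E := ⟨N, 0, fun h => by simp [h] at hN⟩
  have hpos : 0 < Module.finrank ℝ E := Module.finrank_pos
  refine exists_coord_of_finrank_eq ?_ hN
  rw [finrank_euclideanSpace_fin]
  omega

/-- The implicit function theorem describes only the zero set. Strict monotonicity of `Φ` in the
last variable, on a convex interval containing both heights, tells on which side of the graph `Φ` is
negative. -/
theorem eventually_subgraph {F : Type*} [NormedAddCommGroup F] [NormedSpace ℝ F]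
    [CompleteSpace F] {Φ : F × ℝ → ℝ} {u : F × ℝ} (hΦ : ContDiffAt ℝ 2 Φ u) (h0 : Φ u = 0)
    (hpos : 0 < fderiv ℝ Φ u (0, 1)) :
    ∃ h : F → ℝ, ContDiffAt ℝ 2 h u.1 ∧ ∀ᶠ p in 𝓝 u, (Φ p < 0 ↔ p.2 < h p.1) := by
  have hinv : (fderiv ℝ Φ u ∘L .inr ℝ F ℝ).IsInvertible := by
    refine ⟨ContinuousLinearEquiv.unitsEquivAut ℝ (Units.mk0 _ hpos.ne'), ?_⟩
    ext
    simp
  let h := hΦ.implicitFunction (by norm_num) hinv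
  have hh : ContDiffAt ℝ 2 h u.1 := hΦ.contDiffAt_implicitFunction (by norm_num) hinv
  have hu : h u.1 = u.2 := hΦ.implicitFunction_apply_self (by norm_num) hinv
  refine ⟨h, hh, ?_⟩
  have e1 : ∀ᶠ x in 𝓝 u.1, Φ (x, h x) = 0 := by
    simpa only [h0] using hΦ.eventually_apply_implicitFunction (by norm_num) hinv
  have e2 : ∀ᶠ p in 𝓝 u, 0 < fderiv ℝ Φ p (0, 1) ∧ DifferentiableAt ℝ Φ p := by
    have hc : ContinuousAt (fun p => fderiv ℝ Φ p (0, 1)) u :=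
      (hΦ.fderiv_right (m := 1) (by norm_num)).continuousAt.clm_apply continuousAt_const
    refine (hc.eventually (lt_mem_nhds hpos)).and ?_
    filter_upwards [(hΦ.of_le (m := 1) (by norm_num)).eventually (by simp)] with p hp
    exact hp.differentiableAt (by norm_num)
  obtain ⟨r, hr, hball⟩ := Metric.eventually_nhds_iff_ball.1 e2
  have e3 : ∀ᶠ x in 𝓝 u.1, h x ∈ Metric.ball u.2 r := by
    refine hh.continuousAt.eventually_mem ?_
    rw [hu]
    exact Metric.ball_mem_nhds _ hr
  have e4 : ∀ᶠ p in 𝓝 u, p ∈ Metric.ball u r := Metric.ball_mem_nhds _ hr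
  filter_upwards [continuousAt_fst.eventually e1, continuousAt_fst.eventually e3, e4] with p h1 h3 h4
  obtain ⟨x, t⟩ := p
  simp only [Metric.mem_ball, Prod.dist_eq, max_lt_iff] at h4
  have hmem (s : ℝ) (hs : s ∈ Metric.ball u.2 r) : (x, s) ∈ Metric.ball u r := by
    simpa [Metric.mem_ball, Prod.dist_eq] using ⟨h4.1, hs⟩
  have hder (s : ℝ) (hs : s ∈ Metric.ball u.2 r) :
      HasDerivAt (fun s => Φ (x, s)) (fderiv ℝ Φ (x, s) (0, 1)) s :=
    ((hball _ (hmem s hs)).2.hasFDerivAt).comp_hasDerivAt s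
      ((hasDerivAt_const s x).prodMk (hasDerivAt_id s))
  have hmono : StrictMonoOn (fun s => Φ (x, s)) (Metric.ball u.2 r) := by
    refine strictMonoOn_of_deriv_pos (convex_ball _ _)
      (fun s hs => (hder s hs).continuousAt.continuousWithinAt) fun s hs => ?_
    rw [Metric.isOpen_ball.interior_eq] at hs
    rw [(hder s hs).deriv]
    exact (hball _ (hmem s hs)).1
  have := hmono.lt_iff_lt (a := t) (b := h x) h4.2 h3
  simp only [h1] at this
  exact this

/-- A bump function makes the height of a chart `C²` on the whole space, so that the parametrization
and the defining function of a chart are global `C²` maps. -/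
theorem exists_contDiff_eventuallyEq {F : Type*} [NormedAddCommGroup F] [InnerProductSpace ℝ F]
    {h : F → ℝ} {x : F} (hh : ContDiffAt ℝ 2 h x) :
    ∃ h' : F → ℝ, ContDiff ℝ 2 h' ∧ h' =ᶠ[𝓝 x] h := by
  obtain ⟨r, hr, hball⟩ := Metric.eventually_nhds_iff_ball.1 (hh.eventually (by simp))
  let χ : ContDiffBump x := ⟨r / 4, r / 2, by positivity, by linarith⟩
  refine ⟨fun y => χ y * h y, contDiff_iff_contDiffAt.2 fun y => ?_, ?_⟩
  · by_cases hy : y ∈ Metric.ball x r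
    · exact χ.contDiff.contDiffAt.mul (hball y hy)
    · have hz : (fun y => χ y * h y) =ᶠ[𝓝 y] fun _ => 0 := by
        have h0 : (χ : F → ℝ) =ᶠ[𝓝 y] 0 := by
          refine notMem_tsupport_iff_eventuallyEq.1 fun h => hy ?_
          rw [χ.tsupport_eq] at h
          exact Metric.closedBall_subset_ball (by change r / 2 < r; linarith) h
        filter_upwards [h0] with z hz
        simp [hz]
      exact contDiffAt_const.congr_of_eventuallyEq hz
  · filter_upwards [χ.eventuallyEq_one] with y hy
    simp [hy]

theorem exists_graphChart {Ω : Set E} {φ : E → ℝ} {g : E} (hφ : IsLocalDefining Ω φ g) :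
    ∃ c : GraphChart Ω, g ∈ c.dom := by
  obtain ⟨hC, h0, hne, hΩ⟩ := hφ
  -- `φ` increases along `N`. With `N` as the vertical direction, `Ω` lies below the graph.
  obtain ⟨N, hN, hpos⟩ : ∃ N : E, ‖N‖ = 1 ∧ 0 < fderiv ℝ φ g N := by
    obtain ⟨v, hv⟩ : ∃ v, fderiv ℝ φ g v ≠ 0 := by
      by_contra! h
      exact hne (ContinuousLinearMap.ext h)
    have hv0 : v ≠ 0 := fun h => hv (by simp [h])
    have hn : 0 < ‖v‖ := norm_pos_iff.2 hv0
    rcases lt_or_gt_of_ne hv with h | h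
    · refine ⟨(-‖v‖⁻¹) • v, by simp [norm_smul, hn.ne'], ?_⟩
      rw [map_smul, smul_eq_mul]
      exact mul_pos_of_neg_of_neg (by simpa using hv0) h
    · refine ⟨‖v‖⁻¹ • v, by simp [norm_smul, hn.ne'], ?_⟩
      rw [map_smul, smul_eq_mul]
      positivity
  obtain ⟨P, hin, hmp, hPN⟩ := exists_coord_of_norm_eq_one hN
  have hg : P.symm (P g) = g := P.symm_apply_apply g
  have hΦ : ContDiffAt ℝ 2 (φ ∘ P.symm) (P g) :=
    ContDiffAt.comp _ (by rwa [hg]) P.symm.contDiff.contDiffAt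
  have hder : fderiv ℝ (φ ∘ P.symm) (P g) (0, 1) = fderiv ℝ φ g N := by
    have hd : DifferentiableAt ℝ φ (P.symm (P g)) := by
      rw [hg]; exact hC.differentiableAt (by norm_num)
    rw [fderiv_comp _ hd P.symm.differentiableAt, ContinuousLinearEquiv.fderiv, hg]
    simp [hPN]
  obtain ⟨h, hh, hev⟩ := eventually_subgraph hΦ (by simpa [hg] using h0) (by rwa [hder])
  obtain ⟨h', hh', heq⟩ := exists_contDiff_eventuallyEq hh
  have hall : ∀ᶠ p in 𝓝 g, p ∈ Ω ↔ (P p).2 < h' (P p).1 := by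
    have hc : ContinuousAt P g := P.continuous.continuousAt
    have hc1 : ContinuousAt (fun p => (P p).1) g := continuousAt_fst.comp hc
    filter_upwards [hΩ, hc.eventually hev, hc1.eventually heq] with p h1 h2 h3
    rw [h1, h3, ← h2, Function.comp_apply, P.symm_apply_apply]
  obtain ⟨B, hB, hBo, hgB⟩ := eventually_nhds_iff.1 hall
  exact ⟨⟨P, hin, hmp, h', hh', B, hBo, hB⟩, hgB⟩

end Charts

/-! ### Local defining functions: uniqueness of the normal, tangent cones -/

section LocalDefining

variable {E : Type*} [NormedAddCommGroup E] [InnerProductSpace ℝ E]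

theorem tendsto_add_smul_nhdsGT (g v : E) :
    Tendsto (fun t : ℝ => g + t • v) (𝓝[>] 0) (𝓝 g) := by
  have : Continuous fun t : ℝ => g + t • v := by fun_prop
  have := this.tendsto 0
  simp only [zero_smul, add_zero] at this
  exact this.mono_left nhdsWithin_le_nhds

theorem IsLocalDefining.eventually_mem {Ω : Set E} {φ : E → ℝ} {g v : E}
    (h : IsLocalDefining Ω φ g) (hv : fderiv ℝ φ g v < 0) :
    ∀ᶠ t in 𝓝[>] (0 : ℝ), g + t • v ∈ Ω := by
  obtain ⟨hC, h0, -, hΩ⟩ := h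
  have hline : HasDerivAt (fun t : ℝ => g + t • v) v 0 := by
    simpa using ((hasDerivAt_id (0 : ℝ)).smul_const v).const_add g
  have hd : HasDerivAt (fun t : ℝ => φ (g + t • v)) (fderiv ℝ φ g v) 0 := by
    have hf : HasFDerivAt φ (fderiv ℝ φ g) (g + (0 : ℝ) • v) := by
      simpa using (hC.differentiableAt (by norm_num)).hasFDerivAt
    exact hf.comp_hasDerivAt (0 : ℝ) hline
  have hneg : ∀ᶠ t in 𝓝[>] (0 : ℝ), φ (g + t • v) < 0 := by
    have hs := (hd.tendsto_slope.mono_left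
      (nhdsWithin_mono _ (fun t (ht : 0 < t) => ht.ne'))).eventually (gt_mem_nhds hv)
    filter_upwards [hs, self_mem_nhdsWithin] with t ht (ht0 : 0 < t)
    rw [slope_def_field] at ht
    simp only [sub_zero, zero_smul, add_zero, h0] at ht
    by_contra! hcon
    exact absurd ht (not_lt.2 (div_nonneg hcon ht0.le))
  filter_upwards [hneg, (tendsto_add_smul_nhdsGT g v).eventually hΩ] with t h1 h2 using h2.2 h1

theorem IsLocalDefining.eventually_notMem {Ω : Set E} {φ : E → ℝ} {g v : E}
    (h : IsLocalDefining Ω φ g) (hv : 0 < fderiv ℝ φ g v) :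
    ∀ᶠ t in 𝓝[>] (0 : ℝ), g + t • v ∉ Ω := by
  obtain ⟨hC, h0, -, hΩ⟩ := h
  have h' : IsLocalDefining {p | 0 < φ p} (fun p => -φ p) g := by
    refine ⟨hC.neg, by simp [h0], ?_, Eventually.of_forall fun p => by simp⟩
    rw [fderiv_fun_neg, neg_ne_zero]
    intro h
    simp [h] at hv
  filter_upwards [h'.eventually_mem (v := v) (by simpa [fderiv_fun_neg] using hv),
    (tendsto_add_smul_nhdsGT g v).eventually hΩ] with t h1 h2 h3
  exact absurd (h2.1 h3) (not_lt.2 (le_of_lt h1))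

/-- A direction of negative derivative enters `Ω` and one of positive derivative leaves it, whatever
the defining function. The two differentials thus have weakly compatible signs on the open half
spaces of `φ`, which forces proportionality with a positive factor. This makes the outer normal
independent of the choice of defining function. -/
theorem IsLocalDefining.exists_fderiv_eq_smul {Ω : Set E} {φ φ' : E → ℝ} {g : E}
    (h : IsLocalDefining Ω φ g) (h' : IsLocalDefining Ω φ' g) :
    ∃ c : ℝ, 0 < c ∧ ∀ v, fderiv ℝ φ' g v = c * fderiv ℝ φ g v := by
  have hle (v : E) (hv : fderiv ℝ φ g v < 0) : fderiv ℝ φ' g v ≤ 0 := by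
    by_contra! hcon
    obtain ⟨t, ht1, ht2⟩ := ((h.eventually_mem hv).and (h'.eventually_notMem hcon)).exists
    exact ht2 ht1
  have hge (v : E) (hv : 0 < fderiv ℝ φ g v) : 0 ≤ fderiv ℝ φ' g v := by
    have := hle (-v) (by simpa using hv)
    simpa using this
  obtain ⟨w, hw⟩ : ∃ w, fderiv ℝ φ g w = 1 := by
    obtain ⟨w, hw⟩ : ∃ w, fderiv ℝ φ g w ≠ 0 := by
      by_contra! hcon
      exact h.2.2.1 (ContinuousLinearMap.ext hcon)
    exact ⟨(fderiv ℝ φ g w)⁻¹ • w, by simp [hw]⟩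
  -- A vector of the kernel is a limit of the vectors `v + δ w` of the open half space, where the
  -- sign is known; `δ` is small enough for the error to stay below `ε`.
  have hker0 (v : E) (hv : fderiv ℝ φ g v = 0) : 0 ≤ fderiv ℝ φ' g v := by
    refine le_of_forall_pos_le_add fun ε hε => ?_
    set δ := ε / (|fderiv ℝ φ' g w| + 1)
    have hδ : 0 < δ := by positivity
    have h1 := hge (v + δ • w) (by simp [hv, hw, hδ])
    have h2 : δ * fderiv ℝ φ' g w ≤ ε := by
      have h3 : δ * (|fderiv ℝ φ' g w| + 1) = ε := div_mul_cancel₀ _ (by positivity)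
      nlinarith [le_abs_self (fderiv ℝ φ' g w)]
    simp only [map_add, map_smul, smul_eq_mul] at h1
    linarith
  have hker (v : E) (hv : fderiv ℝ φ g v = 0) : fderiv ℝ φ' g v = 0 := by
    refine le_antisymm ?_ (hker0 v hv)
    simpa using hker0 (-v) (by simpa using hv)
  have heq (v : E) : fderiv ℝ φ' g v = fderiv ℝ φ' g w * fderiv ℝ φ g v := by
    have := hker (v - fderiv ℝ φ g v • w) (by simp [hw])
    simp only [map_sub, map_smul, smul_eq_mul] at this
    linarith
  refine ⟨fderiv ℝ φ' g w, lt_of_le_of_ne (hge w (by simp [hw])) fun h0 => ?_, heq⟩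
  refine h'.2.2.1 (ContinuousLinearMap.ext fun v => ?_)
  rw [heq v, ← h0]
  simp

theorem IsLocalDefining.exists_fderiv_neg {Ω : Set E} {φ : E → ℝ} {g : E}
    (h : IsLocalDefining Ω φ g) : ∃ v, fderiv ℝ φ g v < 0 := by
  by_contra! hcon
  refine h.2.2.1 (ContinuousLinearMap.ext fun v => le_antisymm ?_ (hcon v))
  simpa using hcon (-v)

theorem IsLocalDefining.mem_frontier {Ω : Set E} {φ : E → ℝ} {g : E}
    (h : IsLocalDefining Ω φ g) : g ∈ frontier Ω := by
  obtain ⟨v, hv⟩ := h.exists_fderiv_neg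
  have hg : g ∉ Ω := fun hg => by
    have := h.2.2.2.self_of_nhds.1 hg
    rw [h.2.1] at this
    exact lt_irrefl _ this
  refine ⟨?_, fun hi => hg (interior_subset hi)⟩
  exact mem_closure_of_tendsto (tendsto_add_smul_nhdsGT g v) (h.eventually_mem hv)

/-- The tangent cone of the closure contains an open half space, which spans `E`. Derivatives
relative to the closure are therefore determined at boundary points. -/
theorem IsLocalDefining.uniqueDiffWithinAt [FiniteDimensional ℝ E] {Ω : Set E} {φ : E → ℝ} {g : E}
    (h : IsLocalDefining Ω φ g) : UniqueDiffWithinAt ℝ (closure Ω) g := by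
  refine ⟨?_, by simpa using h.mem_frontier.1⟩
  have hsub : {v | fderiv ℝ φ g v < 0} ⊆ tangentConeAt ℝ (closure Ω) g := fun v hv =>
    mem_tangentConeAt_of_add_smul_mem (tendsto_id'.2 (nhdsGT_le_nhdsNE 0))
      ((h.eventually_mem hv).mono fun _ ht => subset_closure ht)
  have : Submodule.span ℝ (tangentConeAt ℝ (closure Ω) g) = ⊤ := by
    refine Submodule.eq_top_of_nonempty_interior' _ ?_
    obtain ⟨v, hv⟩ := h.exists_fderiv_neg
    refine ⟨v, mem_interior.2 ⟨_, hsub.trans Submodule.subset_span, ?_, hv⟩⟩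
    exact isOpen_lt (fderiv ℝ φ g).continuous continuous_const
  rw [this]
  exact dense_univ

theorem IsC2BoundedOpen.uniqueDiffOn [FiniteDimensional ℝ E] {Ω : Set E}
    (hΩ : IsC2BoundedOpen Ω) : UniqueDiffOn ℝ (closure Ω) := by
  intro g hg
  by_cases h : g ∈ Ω
  · exact (hΩ.1.uniqueDiffWithinAt h).mono subset_closure
  · obtain ⟨φ, hφ⟩ := hΩ.2.2 g ⟨hg, fun hi => h (interior_subset hi)⟩
    exact hφ.uniqueDiffWithinAt

end LocalDefining

/-! ### Calculus in a graph chart -/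

namespace GraphChart

variable {E : Type*} [NormedAddCommGroup E] [InnerProductSpace ℝ E] [FiniteDimensional ℝ E]
  [MeasurableSpace E] [BorelSpace E] {Ω : Set E} (c : GraphChart Ω)

/-- The parametrization of the graph. -/
def param (y : EuclideanSpace ℝ (Fin (Module.finrank ℝ E - 1))) : E :=
  c.coord.symm (y, c.height y)

/-- The defining function of the subgraph. -/
def defn (p : E) : ℝ := (c.coord p).2 - c.height (c.coord p).1

theorem coord_param (y) : c.coord (c.param y) = (y, c.height y) := c.coord.apply_symm_apply _

theorem defn_param (y) : c.defn (c.param y) = 0 := by simp [defn, coord_param]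

theorem param_coord {p : E} (hp : c.defn p = 0) : c.param (c.coord p).1 = p := by
  rw [param, ContinuousLinearEquiv.symm_apply_eq]
  exact Prod.ext rfl (sub_eq_zero.1 hp).symm

theorem contDiff_defn : ContDiff ℝ 2 c.defn :=
  (contDiff_snd.comp c.coord.contDiff).sub
    (c.contDiff_height.comp (contDiff_fst.comp c.coord.contDiff))

theorem contDiff_param : ContDiff ℝ 2 c.param :=
  c.coord.symm.contDiff.comp (contDiff_id.prodMk c.contDiff_height)

theorem fderiv_defn (p v : E) :
    fderiv ℝ c.defn p v = (c.coord v).2 - fderiv ℝ c.height (c.coord p).1 (c.coord v).1 := by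
  have h1 : HasFDerivAt (fun p => (c.coord p).2)
      ((ContinuousLinearMap.snd ℝ (EuclideanSpace ℝ (Fin (Module.finrank ℝ E - 1))) ℝ).comp
        (c.coord : E →L[ℝ] EuclideanSpace ℝ (Fin (Module.finrank ℝ E - 1)) × ℝ)) p :=
    ((ContinuousLinearMap.snd ℝ (EuclideanSpace ℝ (Fin (Module.finrank ℝ E - 1))) ℝ).comp
        (c.coord : E →L[ℝ] EuclideanSpace ℝ (Fin (Module.finrank ℝ E - 1)) × ℝ)).hasFDerivAt
  have h2 : HasFDerivAt (fun p => (c.coord p).1)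
      ((ContinuousLinearMap.fst ℝ (EuclideanSpace ℝ (Fin (Module.finrank ℝ E - 1))) ℝ).comp
        (c.coord : E →L[ℝ] EuclideanSpace ℝ (Fin (Module.finrank ℝ E - 1)) × ℝ)) p :=
    ((ContinuousLinearMap.fst ℝ (EuclideanSpace ℝ (Fin (Module.finrank ℝ E - 1))) ℝ).comp
        (c.coord : E →L[ℝ] EuclideanSpace ℝ (Fin (Module.finrank ℝ E - 1)) × ℝ)).hasFDerivAt
  have h3 := (c.contDiff_height.differentiable (by norm_num) (c.coord p).1).hasFDerivAt.comp p h2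
  have h4 : fderiv ℝ c.defn p = _ := (h1.sub h3).fderiv
  rw [h4]
  rfl

theorem hasFDerivAt_param (y) : HasFDerivAt c.param
    ((c.coord.symm : EuclideanSpace ℝ (Fin (Module.finrank ℝ E - 1)) × ℝ →L[ℝ] E).comp
      ((ContinuousLinearMap.id ℝ _).prod (fderiv ℝ c.height y))) y :=
  (c.coord.symm : EuclideanSpace ℝ (Fin (Module.finrank ℝ E - 1)) × ℝ →L[ℝ] E).hasFDerivAt.comp y
    ((hasFDerivAt_id y).prodMk (c.contDiff_height.differentiable (by norm_num) y).hasFDerivAt)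

theorem fderiv_param (y v) :
    fderiv ℝ c.param y v = c.coord.symm (v, fderiv ℝ c.height y v) := by
  rw [(c.hasFDerivAt_param y).fderiv]
  rfl

theorem isLocalDefining {p : E} (hp : p ∈ c.dom) (h0 : c.defn p = 0) :
    IsLocalDefining Ω c.defn p := by
  refine ⟨c.contDiff_defn.contDiffAt, h0, fun h => ?_, ?_⟩
  · have := c.fderiv_defn p (c.coord.symm (0, 1))
    rw [h] at this
    simp at this
  · filter_upwards [c.isOpen_dom.mem_nhds hp] with q hq
    rw [c.mem_iff q hq, defn, sub_neg]

theorem mem_frontier_iff (hΩ : IsOpen Ω) {p : E} (hp : p ∈ c.dom) :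
    p ∈ frontier Ω ↔ c.defn p = 0 := by
  refine ⟨fun h => ?_, fun h => (c.isLocalDefining hp h).mem_frontier⟩
  rw [hΩ.frontier_eq] at h
  refine le_antisymm ?_ ?_
  · by_contra! hcon
    have ho : IsOpen (c.dom ∩ {q | 0 < c.defn q}) :=
      c.isOpen_dom.inter (isOpen_lt continuous_const c.contDiff_defn.continuous)
    obtain ⟨q, ⟨hq1, hq2⟩, hq⟩ := mem_closure_iff.1 h.1 _ ho ⟨hp, hcon⟩
    rw [c.mem_iff q hq1, ← sub_neg] at hq
    exact absurd hq (not_lt.2 (le_of_lt hq2))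
  · by_contra! hcon
    exact h.2 ((c.mem_iff p hp).2 (sub_neg.1 hcon))

theorem param_mem_frontier {y} (hy : c.param y ∈ c.dom) : c.param y ∈ frontier Ω :=
  (c.isLocalDefining hy (c.defn_param y)).mem_frontier

theorem fderiv_param_coord {p v : E} (hv : fderiv ℝ c.defn p v = 0) :
    fderiv ℝ c.param (c.coord p).1 (c.coord v).1 = v := by
  rw [fderiv_param, ContinuousLinearEquiv.symm_apply_eq]
  refine Prod.ext rfl ?_
  rw [fderiv_defn, sub_eq_zero] at hv
  exact hv.symm

theorem isLocalParam : StepTwoCarnot.IsLocalParam (frontier Ω) (c.param ⁻¹' c.dom) c.param := by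
  refine ⟨c.isOpen_dom.preimage c.contDiff_param.continuous,
    (c.contDiff_param.of_le (by norm_num)).contDiffOn, fun y _ y' _ h => ?_, fun y _ v v' h => ?_,
    fun y hy => c.param_mem_frontier hy⟩
  · have := congrArg c.coord h
    rw [coord_param, coord_param] at this
    exact (Prod.mk.inj this).1
  · rw [fderiv_param, fderiv_param] at h
    exact (Prod.mk.inj (c.coord.symm.injective h)).1

/-- The orthonormal basis of `E` given by the coordinates. -/
def basis : OrthonormalBasis (Fin (Module.finrank ℝ E - 1) ⊕ Unit) ℝ E :=
  OrthonormalBasis.mk (v := Sum.elim (fun i => c.coord.symm (EuclideanSpace.single i 1, 0))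
      (fun _ => c.coord.symm (0, 1))) (by
    rw [orthonormal_iff_ite]
    rintro (i | i) (j | j)
    · simp [c.inner_eq, EuclideanSpace.inner_single_left]
    · simp [c.inner_eq]
    · simp [c.inner_eq]
    · simp [c.inner_eq (c.coord.symm _), -inner_self_eq_norm_sq_to_K]) (by
    rintro p -
    have : p = ∑ i, (c.coord p).1 i • c.coord.symm (EuclideanSpace.single i 1, (0 : ℝ)) +
        (c.coord p).2 • c.coord.symm (0, 1) := by
      apply c.coord.injective
      refine Prod.ext ?_ ?_
      · ext j
        simp [Prod.fst_sum, Finset.sum_apply, Pi.single_apply]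
      · simp [Prod.snd_sum]
    rw [this]
    refine Submodule.add_mem _ (Submodule.sum_mem _ fun i _ => Submodule.smul_mem _ _ ?_)
      (Submodule.smul_mem _ _ ?_)
    · exact Submodule.subset_span ⟨Sum.inl i, rfl⟩
    · exact Submodule.subset_span ⟨Sum.inr (), rfl⟩)

theorem basis_repr_inl (p : E) (i) : c.basis.repr p (Sum.inl i) = (c.coord p).1 i := by
  rw [OrthonormalBasis.repr_apply_apply]
  simp [basis, c.inner_eq, EuclideanSpace.inner_single_left]

theorem basis_repr_inr (p : E) (i) : c.basis.repr p (Sum.inr i) = (c.coord p).2 := by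
  rw [OrthonormalBasis.repr_apply_apply]
  simp [basis, c.inner_eq]

end GraphChart

namespace StepTwoCarnot

/-! ### The outer Riemannian normal as a normalized gradient -/

section Normal

variable {E : Type*} [NormedAddCommGroup E] [InnerProductSpace ℝ E] [FiniteDimensional ℝ E]
  (𝔾 : StepTwoCarnot E)

/-- The Riemannian gradient of `φ` at `g`, translated to the identity. -/
def gradAt (φ : E → ℝ) (g : E) : E :=
  (InnerProductSpace.toDual ℝ E).symm ((fderiv ℝ φ g).comp (𝔾.leftInvCLM g))

theorem inner_gradAt (φ : E → ℝ) (g v : E) :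
    inner ℝ (𝔾.gradAt φ g) v = fderiv ℝ φ g (𝔾.leftInv v g) := by
  rw [gradAt, InnerProductSpace.toDual_symm_apply, ← leftInvCLM_apply]
  rfl

theorem inner_gradAt_leftInvSymm (φ : E → ℝ) (g v : E) :
    inner ℝ (𝔾.gradAt φ g) (𝔾.leftInvSymm g v) = fderiv ℝ φ g v := by
  rw [inner_gradAt, leftInv_leftInvSymm]

variable {Ω : Set E} {φ : E → ℝ} {g : E}

theorem norm_gradAt_pos (h : IsLocalDefining Ω φ g) : 0 < ‖𝔾.gradAt φ g‖ := by
  rw [norm_pos_iff]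
  intro h0
  refine h.2.2.1 (ContinuousLinearMap.ext fun v => ?_)
  rw [← 𝔾.inner_gradAt_leftInvSymm, h0]
  simp

theorem isOuterNormal_leftInv (h : IsLocalDefining Ω φ g) :
    𝔾.IsOuterNormal Ω g (𝔾.leftInv (‖𝔾.gradAt φ g‖⁻¹ • 𝔾.gradAt φ g) g) := by
  have hpos := 𝔾.norm_gradAt_pos h
  refine ⟨?_, φ, h, ‖𝔾.gradAt φ g‖, hpos, fun v => ?_⟩
  · rw [metric_leftInv, inner_smul_left, inner_smul_right, real_inner_self_eq_norm_sq]
    simp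
    field_simp
  · rw [metric_eq, leftInvSymm_leftInv, inner_smul_left, inner_gradAt_leftInvSymm]
    simp
    field_simp

theorem IsOuterNormal.eq {ν : E} (hν : 𝔾.IsOuterNormal Ω g ν) (h : IsLocalDefining Ω φ g) :
    ν = 𝔾.leftInv (‖𝔾.gradAt φ g‖⁻¹ • 𝔾.gradAt φ g) g := by
  obtain ⟨h1, φ', hφ', c', hc', hd'⟩ := hν
  obtain ⟨c, hc, hd⟩ := hφ'.exists_fderiv_eq_smul h
  have hpos := 𝔾.norm_gradAt_pos h
  have heq : 𝔾.gradAt φ g = (c * c') • 𝔾.leftInvSymm g ν := by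
    refine ext_inner_right ℝ fun v => ?_
    rw [inner_gradAt, hd, hd', metric_eq, leftInvSymm_leftInv, inner_smul_left]
    simp [mul_assoc]
  have hn : ‖𝔾.leftInvSymm g ν‖ = 1 := by
    rw [metric_eq, real_inner_self_eq_norm_sq] at h1
    exact (pow_eq_one_iff_of_nonneg (norm_nonneg _) (by norm_num)).1 h1
  have hcc : ‖𝔾.gradAt φ g‖ = c * c' := by
    rw [heq, norm_smul, hn, mul_one, Real.norm_of_nonneg (by positivity)]
  rw [hcc, heq, smul_smul, inv_mul_cancel₀ (by positivity), one_smul, leftInv_leftInvSymm]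

theorem outerNormal_eq (h : IsLocalDefining Ω φ g) :
    𝔾.outerNormal Ω g = 𝔾.leftInv (‖𝔾.gradAt φ g‖⁻¹ • 𝔾.gradAt φ g) g := by
  have hex : ∃ ν, 𝔾.IsOuterNormal Ω g ν := ⟨_, 𝔾.isOuterNormal_leftInv h⟩
  rw [outerNormal, dif_pos hex]
  exact IsOuterNormal.eq 𝔾 hex.choose_spec h

theorem outerNormal_eq_zero (hg : g ∉ frontier Ω) : 𝔾.outerNormal Ω g = 0 := by
  rw [outerNormal, dif_neg]
  rintro ⟨ν, -, φ, hφ, -⟩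
  exact hg hφ.mem_frontier

theorem metric_outerNormal (h : IsLocalDefining Ω φ g) (v : E) :
    𝔾.metric g (𝔾.outerNormal Ω g) v = ‖𝔾.gradAt φ g‖⁻¹ * fderiv ℝ φ g v := by
  rw [𝔾.outerNormal_eq h, metric_eq, leftInvSymm_leftInv, inner_smul_left,
    inner_gradAt_leftInvSymm]
  simp

end Normal

/-! ### The area element of a graph -/

section Area

variable {E : Type*} [NormedAddCommGroup E] [InnerProductSpace ℝ E] [FiniteDimensional ℝ E]
  [MeasurableSpace E] [BorelSpace E] (𝔾 : StepTwoCarnot E) {Ω : Set E}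

theorem det_gram_eq_sq {ι : Type*} [Fintype ι] [DecidableEq ι] (β : OrthonormalBasis ι ℝ E)
    (A : E →ₗ[ℝ] E) (x : ι → E) :
    (Matrix.of fun i j => inner ℝ (A (x i)) (A (x j))).det =
      LinearMap.det A ^ 2 * (β.toBasis.toMatrix x).det ^ 2 := by
  have h : (Matrix.of fun i j => inner ℝ (A (x i)) (A (x j))) =
      (β.toBasis.toMatrix (A ∘ x)).transpose * β.toBasis.toMatrix (A ∘ x) := by
    ext i j
    simp only [Matrix.of_apply, Matrix.mul_apply, Matrix.transpose_apply,
      Module.Basis.toMatrix_apply, OrthonormalBasis.coe_toBasis_repr_apply, Function.comp]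
    rw [← β.sum_inner_mul_inner]
    refine Finset.sum_congr rfl fun k _ => ?_
    rw [β.repr_apply_apply, β.repr_apply_apply, real_inner_comm (β k)]
  have h2 := Module.Basis.det_comp β.toBasis A x
  rw [Module.Basis.det_apply, Module.Basis.det_apply] at h2
  rw [h, Matrix.det_mul, Matrix.det_transpose, h2]
  ring

/-- Adjoin the unit normal to the coordinate tangent vectors. The Gram matrix becomes block diagonal
with a last entry `1`, so the area element is the absolute value of one full determinant; left
translation does not change its square. In the basis of the chart the Schur complement of the
identity block is the derivative of `c.defn` along the unit normal, that is, the norm of the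
gradient. -/
theorem areaElement_param (c : GraphChart Ω) {y} (hy : c.param y ∈ c.dom) :
    𝔾.areaElement c.param y = ‖𝔾.gradAt c.defn (c.param y)‖ := by
  set g := c.param y with hg
  have hdef := c.isLocalDefining hy (c.defn_param y)
  have hpos := 𝔾.norm_gradAt_pos hdef
  set w := 𝔾.gradAt c.defn g with hw
  set n : E := ‖w‖⁻¹ • w with hn
  have hnn : inner ℝ n n = (1 : ℝ) := by
    rw [hn, inner_smul_left, inner_smul_right, real_inner_self_eq_norm_sq]
    simp
    field_simp
  let D (i) : E := fderiv ℝ c.param y (EuclideanSpace.single i 1)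
  have hD (i) : c.coord (D i) = (EuclideanSpace.single i 1,
      fderiv ℝ c.height y (EuclideanSpace.single i 1)) := by
    simp [D, c.fderiv_param]
  have htan (i) : inner ℝ n (𝔾.leftInvSymm g (D i)) = (0 : ℝ) := by
    rw [hn, inner_smul_left, hw, 𝔾.inner_gradAt_leftInvSymm, c.fderiv_defn, hD, hg, c.coord_param]
    simp
  let x : Fin (Module.finrank ℝ E - 1) ⊕ Unit → E := Sum.elim D fun _ => 𝔾.leftInv n g
  have hgram := det_gram_eq_sq c.basis (𝔾.leftInvSymmL g) x
  rw [𝔾.det_leftInvSymmL_sq, one_mul] at hgram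
  have hmat : c.basis.toBasis.toMatrix x = Matrix.fromBlocks 1
      (Matrix.of fun i _ => (c.coord (𝔾.leftInv n g)).1 i)
      (Matrix.of fun _ i => fderiv ℝ c.height y (EuclideanSpace.single i 1))
      (Matrix.of fun _ _ => (c.coord (𝔾.leftInv n g)).2) := by
    ext i j
    rw [Module.Basis.toMatrix_apply, OrthonormalBasis.coe_toBasis_repr_apply]
    rcases i with i | i <;> rcases j with j | j <;>
      simp [x, c.basis_repr_inl, c.basis_repr_inr, hD, Matrix.one_apply]
  have hdet : (c.basis.toBasis.toMatrix x).det = ‖w‖ := by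
    rw [hmat, Matrix.det_fromBlocks_one₁₁, Matrix.det_unique]
    have hflux : fderiv ℝ c.defn g (𝔾.leftInv n g) = ‖w‖ := by
      rw [← 𝔾.inner_gradAt, ← hw, hn, inner_smul_right, real_inner_self_eq_norm_sq]
      field_simp
    rw [← hflux, c.fderiv_defn, hg, c.coord_param]
    simp only [Matrix.sub_apply, Matrix.of_apply, Matrix.mul_apply]
    congr 1
    conv_rhs => rw [← (EuclideanSpace.basisFun _ ℝ).sum_repr (c.coord (𝔾.leftInv n g)).1]
    rw [map_sum]
    refine Finset.sum_congr rfl fun i _ => ?_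
    rw [map_smul, smul_eq_mul, mul_comm]
    simp [hg]
  have hblock : (Matrix.of fun i j => inner ℝ (𝔾.leftInvSymmL g (x i)) (𝔾.leftInvSymmL g (x j))) =
      Matrix.fromBlocks (Matrix.of fun i j => 𝔾.metric g (D i) (D j)) 0 0 1 := by
    ext i j
    rcases i with i | i <;> rcases j with j | j
    · simp [x, metric_eq, leftInvSymmL]
    · simp [x, leftInvSymmL, leftInvSymm_leftInv, real_inner_comm, htan]
    · simp [x, leftInvSymmL, leftInvSymm_leftInv, htan]
    · simpa [x, leftInvSymmL, leftInvSymm_leftInv, -inner_self_eq_norm_sq_to_K] using hnn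
  rw [hblock, Matrix.det_fromBlocks_zero₂₁, Matrix.det_one, mul_one, hdet] at hgram
  rw [areaElement, hgram, Real.sqrt_sq hpos.le]

/-- The norm of the gradient cancels: in a chart the flux through the surface is the differential of
the defining function applied to the field, exactly what the thin layers produce. -/
theorem areaElement_mul_metric (c : GraphChart Ω) {y} (hy : c.param y ∈ c.dom) (v : E) :
    𝔾.areaElement c.param y * 𝔾.metric (c.param y) (𝔾.outerNormal Ω (c.param y)) v =
      fderiv ℝ c.defn (c.param y) v := by
  have hdef := c.isLocalDefining hy (c.defn_param y)
  have hpos := 𝔾.norm_gradAt_pos hdef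
  rw [𝔾.areaElement_param c hy, 𝔾.metric_outerNormal hdef]
  field_simp

end Area

end StepTwoCarnot

namespace StepTwoCarnot

/-! ### The surface measure in charts -/

section SurfaceMeasure

variable {E : Type*} [NormedAddCommGroup E] [InnerProductSpace ℝ E] [FiniteDimensional ℝ E]
  (𝔾 : StepTwoCarnot E)

theorem det_gram_comp {d : ℕ} (K : EuclideanSpace ℝ (Fin d) →ₗ[ℝ] E)
    (T : EuclideanSpace ℝ (Fin d) →ₗ[ℝ] EuclideanSpace ℝ (Fin d)) :
    (Matrix.of fun i j => inner ℝ (K (T (EuclideanSpace.single i 1)))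
      (K (T (EuclideanSpace.single j 1)))).det = LinearMap.det T ^ 2 *
    (Matrix.of fun i j => inner ℝ (K (EuclideanSpace.single i 1))
      (K (EuclideanSpace.single j 1))).det := by
  let β := (EuclideanSpace.basisFun (Fin d) ℝ).toBasis
  have hM (i j) : LinearMap.toMatrix β β T i j = T (EuclideanSpace.single j 1) i := by
    simp [β, LinearMap.toMatrix_apply]
  have hexp (j : Fin d) : K (T (EuclideanSpace.single j 1)) =
      ∑ k, LinearMap.toMatrix β β T k j • K (EuclideanSpace.single k 1) := by
    conv_lhs => rw [← (EuclideanSpace.basisFun (Fin d) ℝ).sum_repr (T (EuclideanSpace.single j 1))]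
    rw [map_sum]
    refine Finset.sum_congr rfl fun k _ => ?_
    rw [map_smul, hM]
    simp
  have h : (Matrix.of fun i j => inner ℝ (K (T (EuclideanSpace.single i 1)))
      (K (T (EuclideanSpace.single j 1)))) = (LinearMap.toMatrix β β T).transpose *
      (Matrix.of fun i j => inner ℝ (K (EuclideanSpace.single i 1))
        (K (EuclideanSpace.single j 1))) * LinearMap.toMatrix β β T := by
    ext i j
    simp only [Matrix.of_apply, hexp, Matrix.mul_apply, Matrix.transpose_apply, sum_inner,
      inner_sum, inner_smul_left, inner_smul_right, Finset.sum_mul, Finset.mul_sum, conj_trivial]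
    refine Finset.sum_congr rfl fun k _ => Finset.sum_congr rfl fun l _ => by ring
  rw [h, Matrix.det_mul, Matrix.det_mul, Matrix.det_transpose, LinearMap.det_toMatrix]
  ring

theorem areaElement_eq_of_fderiv_comp {d : ℕ} {ψ ψ' : EuclideanSpace ℝ (Fin d) → E}
    {y y' : EuclideanSpace ℝ (Fin d)} {T : EuclideanSpace ℝ (Fin d) →L[ℝ] EuclideanSpace ℝ (Fin d)}
    (h0 : ψ' y' = ψ y) (h : fderiv ℝ ψ y = (fderiv ℝ ψ' y').comp T) :
    𝔾.areaElement ψ y = |T.det| * 𝔾.areaElement ψ' y' := by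
  have := det_gram_comp (𝔾.leftInvSymmL (ψ y) ∘ₗ (fderiv ℝ ψ' y').toLinearMap) T.toLinearMap
  have h1 : (Matrix.of fun i j : Fin d => 𝔾.metric (ψ y)
      (fderiv ℝ ψ y (EuclideanSpace.single i 1)) (fderiv ℝ ψ y (EuclideanSpace.single j 1))).det =
      T.det ^ 2 * (Matrix.of fun i j : Fin d => 𝔾.metric (ψ' y')
      (fderiv ℝ ψ' y' (EuclideanSpace.single i 1))
      (fderiv ℝ ψ' y' (EuclideanSpace.single j 1))).det := by
    simp only [metric_eq, h, h0]
    exact this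
  rw [areaElement, areaElement, h1, Real.sqrt_mul (sq_nonneg _), Real.sqrt_sq_eq_abs]

variable [MeasurableSpace E] [BorelSpace E] {Ω : Set E}

theorem continuous_gradAt {φ : E → ℝ} (hφ : ContDiff ℝ 1 φ) : Continuous (𝔾.gradAt φ) := by
  unfold gradAt
  exact (InnerProductSpace.toDual ℝ E).symm.continuous.comp
    ((hφ.continuous_fderiv (by norm_num)).clm_comp (𝔾.contDiff_leftInvCLM (n := 0)).continuous)

/-- The surface measure of the graph in a chart. -/
def chartMeasure (c : GraphChart Ω) : Measure E :=
  Measure.map c.param ((volume.restrict (c.param ⁻¹' c.dom)).withDensity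
    fun y => ENNReal.ofReal ‖𝔾.gradAt c.defn (c.param y)‖)

theorem chartMeasure_eq (c : GraphChart Ω) : 𝔾.chartMeasure c =
    Measure.map c.param ((volume.restrict (c.param ⁻¹' c.dom)).withDensity
      fun y => ENNReal.ofReal (𝔾.areaElement c.param y)) := by
  rw [chartMeasure]
  congr 1
  refine withDensity_congr_ae ?_
  filter_upwards [ae_restrict_mem
    (c.isOpen_dom.preimage c.contDiff_param.continuous).measurableSet] with y hy
  rw [𝔾.areaElement_param c hy]

theorem paramMeasure_le {U : Set (EuclideanSpace ℝ (Fin (Module.finrank ℝ E - 1)))}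
    {ψ : EuclideanSpace ℝ (Fin (Module.finrank ℝ E - 1)) → E}
    (h : IsLocalParam (frontier Ω) U ψ) :
    Measure.map ψ ((volume.restrict U).withDensity
      fun y => ENNReal.ofReal (𝔾.areaElement ψ y)) ≤ 𝔾.surfaceMeasure Ω :=
  le_sSup ⟨U, ψ, h, rfl⟩

theorem chartMeasure_le (c : GraphChart Ω) : 𝔾.chartMeasure c ≤ 𝔾.surfaceMeasure Ω := by
  rw [𝔾.chartMeasure_eq c]
  exact 𝔾.paramMeasure_le c.isLocalParam

theorem chartMeasure_apply (c : GraphChart Ω) {B : Set E} (hB : MeasurableSet B) :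
    𝔾.chartMeasure c B = ∫⁻ y in c.param ⁻¹' (B ∩ c.dom),
      ENNReal.ofReal ‖𝔾.gradAt c.defn (c.param y)‖ := by
  have hm : Measurable c.param := c.contDiff_param.continuous.measurable
  rw [chartMeasure, Measure.map_apply hm hB, withDensity_apply _ (hm hB),
    Measure.restrict_restrict (hm hB)]
  rfl

/-- The image of the area element of a parametrization. -/
theorem paramMeasure_apply {d : ℕ} {S : Set E} {U : Set (EuclideanSpace ℝ (Fin d))}
    {ψ : EuclideanSpace ℝ (Fin d) → E} (h : IsLocalParam S U ψ) {B : Set E}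
    (hB : MeasurableSet B) :
    MeasurableSet (U ∩ ψ ⁻¹' B) ∧ Measure.map ψ ((volume.restrict U).withDensity
      fun y => ENNReal.ofReal (𝔾.areaElement ψ y)) B =
    ∫⁻ y in U ∩ ψ ⁻¹' B, ENNReal.ofReal (𝔾.areaElement ψ y) := by
  classical
  have hU : MeasurableSet U := h.1.measurableSet
  let ψ' := U.piecewise ψ fun _ => 0
  have hm : Measurable ψ' := h.2.1.continuousOn.measurable_piecewise continuousOn_const hU
  have hae : ψ =ᵐ[(volume.restrict U).withDensity
      fun y => ENNReal.ofReal (𝔾.areaElement ψ y)] ψ' := by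
    refine (withDensity_absolutelyContinuous _ _).ae_le ?_
    filter_upwards [ae_restrict_mem hU] with y hy
    simp [ψ', hy]
  have hset : ψ' ⁻¹' B ∩ U = U ∩ ψ ⁻¹' B := by
    ext y
    by_cases hy : y ∈ U <;> simp [ψ', hy]
  refine ⟨hset ▸ (hm hB).inter hU, ?_⟩
  rw [Measure.map_congr hae, Measure.map_apply hm hB, withDensity_apply _ (hm hB),
    Measure.restrict_restrict (hm hB), hset]

/-- Over the domain of the chart `ψ` factors through the graph parametrization by the injective map
`y ↦ π (ψ y)`. The area elements differ by its Jacobian, and the change of variables formula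
identifies the two measures on the image of `ψ`, which may be only a part of the graph. -/
theorem paramMeasure_le_chartMeasure (hΩ : IsOpen Ω) (c : GraphChart Ω)
    {U : Set (EuclideanSpace ℝ (Fin (Module.finrank ℝ E - 1)))}
    {ψ : EuclideanSpace ℝ (Fin (Module.finrank ℝ E - 1)) → E}
    (h : IsLocalParam (frontier Ω) U ψ) {B : Set E} (hB : MeasurableSet B) (hBc : B ⊆ c.dom) :
    Measure.map ψ ((volume.restrict U).withDensity
      fun y => ENNReal.ofReal (𝔾.areaElement ψ y)) B ≤ 𝔾.chartMeasure c B := by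
  obtain ⟨hs, hμ⟩ := 𝔾.paramMeasure_apply h hB
  set s := U ∩ ψ ⁻¹' B
  let π : E →L[ℝ] EuclideanSpace ℝ (Fin (Module.finrank ℝ E - 1)) :=
    (ContinuousLinearMap.fst ℝ _ ℝ).comp c.coord.toContinuousLinearMap
  have hrec (y) (hy : y ∈ U) (hyd : ψ y ∈ c.dom) : c.param (π (ψ y)) = ψ y :=
    c.param_coord ((c.mem_frontier_iff hΩ hyd).1 (h.2.2.2.2 hy))
  have hd (y) (hy : y ∈ U) : HasFDerivAt ψ (fderiv ℝ ψ y) y :=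
    ((h.2.1.contDiffAt (h.1.mem_nhds hy)).differentiableAt (by norm_num)).hasFDerivAt
  have hT (y) (hy : y ∈ U) : HasFDerivAt (fun y => π (ψ y)) (π.comp (fderiv ℝ ψ y)) y :=
    π.hasFDerivAt.comp y (hd y hy)
  have hinj : InjOn (fun y => π (ψ y)) s := fun y hy y' hy' he => by
    refine h.2.2.1 hy.1 hy'.1 ?_
    rw [← hrec y hy.1 (hBc hy.2), ← hrec y' hy'.1 (hBc hy'.2)]
    exact congrArg c.param he
  have harea (y) (hy : y ∈ s) : 𝔾.areaElement ψ y =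
      |(π.comp (fderiv ℝ ψ y)).det| * ‖𝔾.gradAt c.defn (c.param (π (ψ y)))‖ := by
    have hyd := hBc hy.2
    have hr := hrec y hy.1 hyd
    rw [← 𝔾.areaElement_param c (by rwa [hr])]
    refine 𝔾.areaElement_eq_of_fderiv_comp hr ?_
    have hev : ψ =ᶠ[𝓝 y] fun y => c.param (π (ψ y)) := by
      filter_upwards [h.1.mem_nhds hy.1,
        (hd y hy.1).continuousAt.eventually_mem (c.isOpen_dom.mem_nhds hyd)] with z hz hzd
      exact (hrec z hz hzd).symm
    have h1 : HasFDerivAt (fun y => c.param (π (ψ y))) _ y :=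
      HasFDerivAt.comp (g := c.param) (f := fun y => π (ψ y)) y
        (c.hasFDerivAt_param (π (ψ y))).differentiableAt.hasFDerivAt (hT y hy.1)
    exact hev.fderiv_eq.trans h1.fderiv
  rw [hμ, 𝔾.chartMeasure_apply c hB]
  calc ∫⁻ y in s, ENNReal.ofReal (𝔾.areaElement ψ y)
      = ∫⁻ y in s, ENNReal.ofReal |(π.comp (fderiv ℝ ψ y)).det| *
          ENNReal.ofReal ‖𝔾.gradAt c.defn (c.param (π (ψ y)))‖ := by
        refine setLIntegral_congr_fun hs fun y hy => ?_
        simp only [harea y hy, ENNReal.ofReal_mul (abs_nonneg _)]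
    _ = ∫⁻ y in (fun y => π (ψ y)) '' s, ENNReal.ofReal ‖𝔾.gradAt c.defn (c.param y)‖ :=
        (lintegral_image_eq_lintegral_abs_det_fderiv_mul volume hs
          (fun y hy => (hT y hy.1).hasFDerivWithinAt) hinj
          (fun y => ENNReal.ofReal ‖𝔾.gradAt c.defn (c.param y)‖)).symm
    _ ≤ _ := by
        refine lintegral_mono_set ?_
        rintro _ ⟨y, hy, rfl⟩
        have hr := hrec y hy.1 (hBc hy.2)
        simp only [mem_preimage, hr]
        exact ⟨hy.2, hBc hy.2⟩

/-- In a chart the surface measure is the image of the area element. -/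
theorem surfaceMeasure_restrict_dom (hΩ : IsOpen Ω) (c : GraphChart Ω) :
    (𝔾.surfaceMeasure Ω).restrict c.dom = 𝔾.chartMeasure c := by
  have hdom := c.isOpen_dom.measurableSet
  have hc : (𝔾.chartMeasure c).restrict c.dom = 𝔾.chartMeasure c := by
    refine Measure.ext fun B hB => ?_
    rw [Measure.restrict_apply hB, 𝔾.chartMeasure_apply c (hB.inter hdom),
      𝔾.chartMeasure_apply c hB, inter_assoc, inter_self]
  refine le_antisymm ?_ ?_
  -- A supremum of measures is not computed set by set. Instead the right side is shown to dominate
  -- every member of the family, and restriction to `c.dom` then removes its first term.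
  · have hle : 𝔾.surfaceMeasure Ω ≤
        (𝔾.surfaceMeasure Ω).restrict c.domᶜ + 𝔾.chartMeasure c := by
      refine sSup_le ?_
      rintro μ ⟨U, ψ, h, rfl⟩
      refine Measure.le_iff.2 fun B hB => ?_
      rw [← measure_inter_add_sdiff B hdom, add_comm, Measure.add_apply]
      refine add_le_add ?_ ?_
      · rw [Measure.restrict_apply hB, ← sdiff_eq]
        exact Measure.le_iff'.1 (𝔾.paramMeasure_le h) _
      · exact (𝔾.paramMeasure_le_chartMeasure hΩ c h (hB.inter hdom) inter_subset_right).trans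
          (measure_mono inter_subset_left)
    refine (Measure.restrict_mono_measure hle c.dom).trans ?_
    rw [Measure.restrict_add, Measure.restrict_restrict hdom, inter_compl_self,
      Measure.restrict_empty, zero_add, hc]
  · rw [← hc]
    exact Measure.restrict_mono_measure (𝔾.chartMeasure_le c) c.dom

/-- Each image measure is carried by the boundary, so the restriction of the supremum to the
boundary is again an upper bound of the family. -/
theorem surfaceMeasure_compl_frontier : 𝔾.surfaceMeasure Ω (frontier Ω)ᶜ = 0 := by
  have hm : MeasurableSet (frontier Ω) := isClosed_frontier.measurableSet
  have hle : 𝔾.surfaceMeasure Ω ≤ (𝔾.surfaceMeasure Ω).restrict (frontier Ω) := by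
    refine sSup_le ?_
    rintro μ ⟨U, ψ, h, rfl⟩
    refine Measure.le_iff.2 fun B hB => ?_
    rw [Measure.restrict_apply hB]
    refine le_trans ?_ (Measure.le_iff'.1 (𝔾.paramMeasure_le h) _)
    rw [(𝔾.paramMeasure_apply h hB).2, (𝔾.paramMeasure_apply h (hB.inter hm)).2]
    exact lintegral_mono_set fun y hy => ⟨hy.1, hy.2, h.2.2.2.2 hy.1⟩
  have := Measure.le_iff'.1 hle (frontier Ω)ᶜ
  rw [Measure.restrict_apply hm.compl, compl_inter_self, measure_empty] at this
  exact le_antisymm this bot_le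

theorem isFiniteMeasure_surfaceMeasure (hΩ : IsC2BoundedOpen Ω) :
    IsFiniteMeasure (𝔾.surfaceMeasure Ω) := by
  have hcomp : IsCompact (frontier Ω) :=
    hΩ.2.1.isCompact_closure.of_isClosed_subset isClosed_frontier frontier_subset_closure
  have hfr : 𝔾.surfaceMeasure Ω (frontier Ω) < ⊤ := by
    refine hcomp.measure_lt_top_of_nhdsWithin fun g hg => ?_
    obtain ⟨φ, hφ⟩ := hΩ.2.2 g hg
    obtain ⟨c, hc⟩ := exists_graphChart hφ
    obtain ⟨K, hK, hgK, hKc⟩ := exists_compact_subset c.isOpen_dom hc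
    refine ⟨K, mem_nhdsWithin_of_mem_nhds (mem_interior_iff_mem_nhds.1 hgK), ?_⟩
    have hKm := hK.isClosed.measurableSet
    have hKK : K ∩ c.dom = K := inter_eq_left.2 hKc
    have h1 : 𝔾.surfaceMeasure Ω K = 𝔾.chartMeasure c K := by
      rw [← 𝔾.surfaceMeasure_restrict_dom hΩ.1 c, Measure.restrict_apply hKm, hKK]
    rw [h1, 𝔾.chartMeasure_apply c hKm, hKK]
    have hcpt : IsCompact (c.param ⁻¹' K) := by
      have hsub : c.param ⁻¹' K ⊆ (fun p => (c.coord p).1) '' K := fun y hy =>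
        ⟨c.param y, hy, by simp only [c.coord_param]⟩
      exact (hK.image (continuous_fst.comp c.coord.continuous)).of_isClosed_subset
        (hK.isClosed.preimage c.contDiff_param.continuous) hsub
    have hcont : Continuous fun y => ‖𝔾.gradAt c.defn (c.param y)‖ :=
      ((𝔾.continuous_gradAt (c.contDiff_defn.of_le (by norm_num))).comp
        c.contDiff_param.continuous).norm
    obtain ⟨C, hC⟩ := hcpt.exists_bound_of_continuousOn hcont.continuousOn
    refine lt_of_le_of_lt (setLIntegral_mono' hcpt.isClosed.measurableSet
      (g := fun _ => ENNReal.ofReal C) fun y hy => ENNReal.ofReal_le_ofReal ?_) ?_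
    · simpa using hC y hy
    · rw [setLIntegral_const]
      exact ENNReal.mul_lt_top ENNReal.ofReal_lt_top hcpt.measure_lt_top
  refine ⟨?_⟩
  rw [← measure_add_measure_compl isClosed_frontier.measurableSet,
    𝔾.surfaceMeasure_compl_frontier, add_zero]
  exact hfr

theorem setIntegral_dom_surfaceMeasure (hΩ : IsOpen Ω) (c : GraphChart Ω) {f : E → ℝ}
    (hf : AEStronglyMeasurable f (𝔾.surfaceMeasure Ω)) :
    ∫ p in c.dom, f p ∂(𝔾.surfaceMeasure Ω) =
      ∫ y in c.param ⁻¹' c.dom, 𝔾.areaElement c.param y * f (c.param y) := by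
  have hm : Measurable c.param := c.contDiff_param.continuous.measurable
  have hf' : AEStronglyMeasurable f (𝔾.chartMeasure c) := by
    rw [← 𝔾.surfaceMeasure_restrict_dom hΩ c]
    exact hf.restrict
  have hcont : Continuous fun y => ‖𝔾.gradAt c.defn (c.param y)‖ :=
    ((𝔾.continuous_gradAt (c.contDiff_defn.of_le (by norm_num))).comp
      c.contDiff_param.continuous).norm
  rw [𝔾.surfaceMeasure_restrict_dom hΩ c, chartMeasure, integral_map hm.aemeasurable hf',
    integral_withDensity_eq_integral_toReal_smul hcont.measurable.ennreal_ofReal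
      (ae_of_all _ fun _ => ENNReal.ofReal_lt_top)]
  refine setIntegral_congr_fun (c.isOpen_dom.preimage c.contDiff_param.continuous).measurableSet
    fun y hy => ?_
  simp only [ENNReal.toReal_ofReal (norm_nonneg _), smul_eq_mul, 𝔾.areaElement_param c hy]

end SurfaceMeasure

end StepTwoCarnot

/-! ### Concentration of thin layers on a graph -/

section Layer

/-- A smooth step function which increases from `0` at `1` to `1` at `2`. -/
def stepFn (s : ℝ) : ℝ := Real.smoothTransition (s - 1)

theorem contDiff_stepFn : ContDiff ℝ 1 stepFn :=
  Real.smoothTransition.contDiff.comp (contDiff_id.sub contDiff_const)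

theorem stepFn_of_le {s : ℝ} (hs : s ≤ 1) : stepFn s = 0 :=
  Real.smoothTransition.zero_of_nonpos (by linarith)

theorem stepFn_of_ge {s : ℝ} (hs : 2 ≤ s) : stepFn s = 1 :=
  Real.smoothTransition.one_of_one_le (by linarith)

theorem abs_stepFn_le (s : ℝ) : |stepFn s| ≤ 1 := by
  unfold stepFn
  rw [abs_of_nonneg (Real.smoothTransition.nonneg _)]
  exact Real.smoothTransition.le_one _

theorem hasDerivAt_stepFn (s : ℝ) : HasDerivAt stepFn (deriv stepFn s) s :=
  (contDiff_stepFn.differentiable (by norm_num) s).hasDerivAt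

theorem continuous_deriv_stepFn : Continuous (deriv stepFn) :=
  contDiff_stepFn.continuous_deriv (by norm_num)

theorem deriv_stepFn_of_notMem {s : ℝ} (hs : s ∉ Icc (1 : ℝ) 2) : deriv stepFn s = 0 := by
  rw [mem_Icc, not_and_or, not_le, not_le] at hs
  rcases hs with hs | hs
  · have : stepFn =ᶠ[𝓝 s] fun _ => 0 := by
      filter_upwards [gt_mem_nhds hs] with t ht using stepFn_of_le ht.le
    rw [this.deriv_eq, deriv_const]
  · have : stepFn =ᶠ[𝓝 s] fun _ => 1 := by
      filter_upwards [lt_mem_nhds hs] with t ht using stepFn_of_ge ht.le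
    rw [this.deriv_eq, deriv_const]

theorem hasCompactSupport_deriv_stepFn : HasCompactSupport (deriv stepFn) :=
  HasCompactSupport.intro isCompact_Icc fun _ hs => deriv_stepFn_of_notMem hs

theorem integral_deriv_stepFn : ∫ s, deriv stepFn s = 1 := by
  have h := integral_of_hasDerivAt_of_tendsto (m := 0) (n := 1) hasDerivAt_stepFn
    (continuous_deriv_stepFn.integrable_of_hasCompactSupport hasCompactSupport_deriv_stepFn)
    (tendsto_const_nhds.congr' ?_) (tendsto_const_nhds.congr' ?_)
  · rw [h, sub_zero]
  · filter_upwards [eventually_le_atBot (1 : ℝ)] with t ht using (stepFn_of_le ht).symm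
  · filter_upwards [eventually_ge_atTop (2 : ℝ)] with t ht using (stepFn_of_ge ht).symm

variable {F : Type*} [NormedAddCommGroup F] [InnerProductSpace ℝ F] [FiniteDimensional ℝ F]
  [MeasurableSpace F] [BorelSpace F]

/-- On each vertical line the substitution `t = h y - s / r` stretches the layer, of thickness of
order `1 / r`, to the fixed interval where the derivative of `stepFn` lives. The limit in `r` can
then be taken under the integral. -/
theorem integral_layer_eq {k : F × ℝ → ℝ} (hk : Continuous k) (hkc : HasCompactSupport k)
    {h : F → ℝ} (hh : Continuous h) {r : ℝ} (hr : 0 < r) :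
    ∫ q : F × ℝ, k q * (deriv stepFn (r * (h q.1 - q.2)) * r) =
      ∫ q : F × ℝ, k (q.1, h q.1 - r⁻¹ * q.2) * deriv stepFn q.2 := by
  have hc1 : Continuous fun q : F × ℝ => k q * (deriv stepFn (r * (h q.1 - q.2)) * r) := by
    have := continuous_deriv_stepFn
    fun_prop
  have hc2 : Continuous fun q : F × ℝ => k (q.1, h q.1 - r⁻¹ * q.2) * deriv stepFn q.2 := by
    have := continuous_deriv_stepFn
    fun_prop
  have hi1 : Integrable (fun q : F × ℝ => k q * (deriv stepFn (r * (h q.1 - q.2)) * r))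
      (volume.prod volume) := hc1.integrable_of_hasCompactSupport hkc.mul_right
  have hi2 : Integrable (fun q : F × ℝ => k (q.1, h q.1 - r⁻¹ * q.2) * deriv stepFn q.2)
      (volume.prod volume) := by
    refine hc2.integrable_of_hasCompactSupport (HasCompactSupport.intro
      ((hkc.isCompact.image continuous_fst).prod (isCompact_Icc (a := (1 : ℝ)) (b := 2))) ?_)
    intro q hq
    rw [mem_prod, not_and_or] at hq
    rcases hq with hq | hq
    · have hz : k (q.1, h q.1 - r⁻¹ * q.2) = 0 :=
        image_eq_zero_of_notMem_tsupport fun hmem => hq ⟨_, hmem, rfl⟩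
      rw [hz, zero_mul]
    · rw [deriv_stepFn_of_notMem hq, mul_zero]
  rw [Measure.volume_eq_prod, integral_prod _ hi1, integral_prod _ hi2]
  refine integral_congr_ae (ae_of_all _ fun y => ?_)
  have h1 := integral_sub_left_eq_self
    (fun t => k (y, t) * (deriv stepFn (r * (h y - t)) * r)) (volume : Measure ℝ) (h y)
  have h2 := Measure.integral_comp_mul_left
    (fun x => k (y, h y - x) * (deriv stepFn (r * (h y - (h y - x))) * r)) r⁻¹
  simp only
  rw [← h1]
  have h3 : ∫ s, k (y, h y - r⁻¹ * s) * (deriv stepFn (r * (h y - (h y - r⁻¹ * s))) * r) =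
      r * ∫ s, k (y, h y - r⁻¹ * s) * deriv stepFn s := by
    rw [← integral_const_mul]
    refine integral_congr_ae (ae_of_all _ fun s => ?_)
    have : r * (h y - (h y - r⁻¹ * s)) = s := by field_simp; ring
    simp only [this]
    ring
  rw [h3, inv_inv, abs_of_pos hr, smul_eq_mul] at h2
  exact (mul_left_cancel₀ hr.ne' h2).symm

/-- Averages over thin layers below a graph converge to the integral over the graph. -/
theorem tendsto_integral_layer {k : F × ℝ → ℝ} (hk : Continuous k) (hkc : HasCompactSupport k)
    {h : F → ℝ} (hh : Continuous h) :
    Tendsto (fun n : ℕ => ∫ q : F × ℝ,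
      k q * (deriv stepFn (((n : ℝ) + 1) * (h q.1 - q.2)) * ((n : ℝ) + 1))) atTop
      (𝓝 (∫ y, k (y, h y))) := by
  have hlim : ∫ y, k (y, h y) = ∫ q : F × ℝ, k (q.1, h q.1) * deriv stepFn q.2 := by
    rw [Measure.volume_eq_prod, integral_prod_mul (fun y => k (y, h y)) (deriv stepFn),
      integral_deriv_stepFn, mul_one]
  simp only [integral_layer_eq hk hkc hh (show (0 : ℝ) < (_ : ℕ) + 1 by positivity)]
  rw [hlim]
  obtain ⟨C, hC⟩ := hk.bounded_above_of_compact_support hkc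
  let K : Set F := Prod.fst '' tsupport k
  have hK : IsCompact K := hkc.isCompact.image continuous_fst
  have hd := continuous_deriv_stepFn
  refine tendsto_integral_of_dominated_convergence
    (fun q => K.indicator (fun _ => C) q.1 * ‖deriv stepFn q.2‖) ?_ ?_ ?_ ?_
  · intro n
    have : Continuous fun q : F × ℝ =>
        k (q.1, h q.1 - ((n : ℝ) + 1)⁻¹ * q.2) * deriv stepFn q.2 := by fun_prop
    exact this.aestronglyMeasurable
  · rw [Measure.volume_eq_prod]
    refine Integrable.mul_prod (f := K.indicator fun _ => C) (g := fun s => ‖deriv stepFn s‖) ?_ ?_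
    · exact (integrable_indicator_iff hK.isClosed.measurableSet).2
        (integrableOn_const hK.measure_lt_top.ne)
    · exact hd.norm.integrable_of_hasCompactSupport hasCompactSupport_deriv_stepFn.norm
  · intro n
    refine ae_of_all _ fun q => ?_
    rw [norm_mul]
    refine mul_le_mul_of_nonneg_right ?_ (norm_nonneg _)
    by_cases hq : q.1 ∈ K
    · rw [indicator_of_mem hq]
      exact hC _
    · have hz : k (q.1, h q.1 - ((n : ℝ) + 1)⁻¹ * q.2) = 0 :=
        image_eq_zero_of_notMem_tsupport fun hmem => hq ⟨_, hmem, rfl⟩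
      rw [indicator_of_notMem hq, hz, norm_zero]
  · refine ae_of_all _ fun q => Tendsto.mul_const _ ?_
    have hcq : Continuous fun x : ℝ => k (q.1, h q.1 - x * q.2) := by fun_prop
    have h0 : Tendsto (fun n : ℕ => ((n : ℝ) + 1)⁻¹) atTop (𝓝 0) := by
      simpa only [one_div] using tendsto_one_div_add_atTop_nhds_zero_nat (𝕜 := ℝ)
    have := (hcq.tendsto 0).comp h0
    simpa using! this

end Layer

/-! ### Weak divergence and test functions in a chart -/

section WeakDivergence

variable {E : Type*} [NormedAddCommGroup E] [InnerProductSpace ℝ E] [FiniteDimensional ℝ E]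
  [MeasurableSpace E] [BorelSpace E]

/-- `Q` is the divergence of `V` in `Ω` in the sense of distributions. -/
def IsWeakDiv (Ω : Set E) (V : E → E) (Q : E → ℝ) : Prop :=
  ∀ η : E → ℝ, ContDiff ℝ 1 η → HasCompactSupport η → tsupport η ⊆ Ω →
    ∫ g in Ω, (η g * Q g + fderiv ℝ η g (V g)) = 0

theorem integrableOn_mul_add_fderiv {Ω : Set E} {V : E → E} {Q ζ : E → ℝ} (hV : Continuous V)
    (hQ : IntegrableOn Q Ω) (hζ : ContDiff ℝ 1 ζ) (hζc : HasCompactSupport ζ) :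
    IntegrableOn (fun g => ζ g * Q g + fderiv ℝ ζ g (V g)) Ω := by
  obtain ⟨C, hC⟩ := hζ.continuous.bounded_above_of_compact_support hζc
  refine Integrable.add (hQ.bdd_mul hζ.continuous.aestronglyMeasurable (ae_of_all _ hC)) ?_
  have hc : Continuous fun g => fderiv ℝ ζ g (V g) :=
    (hζ.continuous_fderiv (by norm_num)).clm_apply hV
  refine (hc.integrable_of_hasCompactSupport (HasCompactSupport.intro' hζc
    (isClosed_tsupport ζ) fun x hx => ?_)).integrableOn
  rw [fderiv_of_notMem_tsupport ℝ hx, zero_apply]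

/-- The divergence theorem for test functions supported in a chart. -/
theorem IsWeakDiv.setIntegral_chart {Ω : Set E} {V : E → E} {Q : E → ℝ} (h : IsWeakDiv Ω V Q)
    (hV : Continuous V) (hΩ : MeasurableSet Ω) (hQ : IntegrableOn Q Ω) (c : GraphChart Ω)
    {ζ : E → ℝ} (hζ : ContDiff ℝ 1 ζ) (hζc : HasCompactSupport ζ) (hζd : tsupport ζ ⊆ c.dom) :
    ∫ g in Ω, (ζ g * Q g + fderiv ℝ ζ g (V g)) =
      ∫ y, ζ (c.param y) * fderiv ℝ c.defn (c.param y) (V (c.param y)) := by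
  have hdefn : ContDiff ℝ 1 c.defn := c.contDiff_defn.of_le (by norm_num)
  -- Within the chart `χ n` increases from `0` to `1` between the depths `1 / (n + 1)` and `2 / (n +
  -- 1)` below the graph. Since `stepFn` starts only at `1`, the support of `χ n * ζ` stays away
  -- from the boundary and the weak identity applies to this product.
  let χ (n : ℕ) (p : E) : ℝ := stepFn (((n : ℝ) + 1) * -c.defn p)
  have hχ (n : ℕ) : ContDiff ℝ 1 (χ n) := contDiff_stepFn.comp (contDiff_const.mul hdefn.neg)
  have hχd (n : ℕ) (p v : E) : fderiv ℝ (χ n) p v =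
      -(deriv stepFn (((n : ℝ) + 1) * -c.defn p) * ((n : ℝ) + 1) * fderiv ℝ c.defn p v) := by
    have h1 : HasFDerivAt (fun p => ((n : ℝ) + 1) * -c.defn p)
        (((n : ℝ) + 1) • -fderiv ℝ c.defn p) p :=
      ((hdefn.differentiable (by norm_num) p).hasFDerivAt.neg).const_mul _
    have h2 : HasFDerivAt (χ n) _ p := (hasDerivAt_stepFn _).comp_hasFDerivAt p h1
    rw [h2.fderiv]
    simp
    ring
  let k (p : E) : ℝ := ζ p * fderiv ℝ c.defn p (V p)
  have hk : Continuous k :=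
    hζ.continuous.mul ((hdefn.continuous_fderiv (by norm_num)).clm_apply hV)
  have hkc : HasCompactSupport k := hζc.mul_right
  have hkz (n : ℕ) (p : E) (hp : p ∉ Ω) :
      k p * (deriv stepFn (((n : ℝ) + 1) * -c.defn p) * ((n : ℝ) + 1)) = 0 := by
    by_cases hpd : p ∈ tsupport ζ
    · have hnn : 0 ≤ c.defn p := by
        by_contra! hcon
        exact hp ((c.mem_iff p (hζd hpd)).2 (sub_neg.1 hcon))
      rw [deriv_stepFn_of_notMem, zero_mul, mul_zero]
      intro hmem
      have := hmem.1
      nlinarith [(Nat.cast_nonneg n : (0 : ℝ) ≤ n)]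
    · simp [k, image_eq_zero_of_notMem_tsupport hpd]
  have hkey (n : ℕ) : ∫ g in Ω, χ n g * (ζ g * Q g + fderiv ℝ ζ g (V g)) =
      ∫ q : EuclideanSpace ℝ (Fin (Module.finrank ℝ E - 1)) × ℝ, k (c.coord.symm q) *
        (deriv stepFn (((n : ℝ) + 1) * (c.height q.1 - q.2)) * ((n : ℝ) + 1)) := by
    have hη : ContDiff ℝ 1 fun p => χ n p * ζ p := (hχ n).mul hζ
    have hηc : HasCompactSupport fun p => χ n p * ζ p := hζc.mul_left
    have hsub : tsupport (fun p => χ n p * ζ p) ⊆ Ω := by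
      have hcl : IsClosed {p | 1 ≤ ((n : ℝ) + 1) * -c.defn p} :=
        isClosed_le continuous_const (continuous_const.mul hdefn.continuous.neg)
      have h1 : tsupport (fun p => χ n p * ζ p) ⊆ {p | 1 ≤ ((n : ℝ) + 1) * -c.defn p} := by
        refine closure_minimal (fun p hp => ?_) hcl
        by_contra hcon
        exact hp (by simp only [χ, stepFn_of_le (not_le.1 hcon).le, zero_mul])
      intro p hp
      have hp1 : (1 : ℝ) ≤ ((n : ℝ) + 1) * -c.defn p := h1 hp
      have hp2 : p ∈ c.dom := hζd (tsupport_mul_subset_right hp)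
      refine (c.mem_iff p hp2).2 (sub_neg.1 ?_)
      change c.defn p < 0
      by_contra! hcon
      nlinarith [(Nat.cast_nonneg n : (0 : ℝ) ≤ n)]
    have h0 := h _ hη hηc hsub
    have hrw : ∀ g, χ n g * ζ g * Q g + fderiv ℝ (fun p => χ n p * ζ p) g (V g) =
        χ n g * (ζ g * Q g + fderiv ℝ ζ g (V g)) -
          k g * (deriv stepFn (((n : ℝ) + 1) * -c.defn g) * ((n : ℝ) + 1)) := by
      intro g
      rw [fderiv_fun_mul ((hχ n).differentiable (by norm_num) g)
        (hζ.differentiable (by norm_num) g)]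
      simp only [add_apply, smul_apply, smul_eq_mul, hχd, k]
      ring
    simp only [hrw] at h0
    have hi1 : IntegrableOn (fun g => χ n g * (ζ g * Q g + fderiv ℝ ζ g (V g))) Ω :=
      (integrableOn_mul_add_fderiv hV hQ hζ hζc).bdd_mul (hχ n).continuous.aestronglyMeasurable
        (ae_of_all _ fun g => abs_stepFn_le _)
    have hc2 : Continuous fun g =>
        k g * (deriv stepFn (((n : ℝ) + 1) * -c.defn g) * ((n : ℝ) + 1)) :=
      hk.mul ((continuous_deriv_stepFn.comp
        (continuous_const.mul hdefn.continuous.neg)).mul continuous_const)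
    have hi2 := (hc2.integrable_of_hasCompactSupport (μ := (volume : Measure E))
      hkc.mul_right).integrableOn (s := Ω)
    rw [integral_sub hi1 hi2, sub_eq_zero] at h0
    rw [h0, setIntegral_eq_integral_of_forall_compl_eq_zero (hkz n)]
    have hmp := c.measurePreserving.integral_comp
      c.coord.toHomeomorph.measurableEmbedding (fun q => k (c.coord.symm q) *
        (deriv stepFn (((n : ℝ) + 1) * (c.height q.1 - q.2)) * ((n : ℝ) + 1)))
    rw [Measure.volume_eq_prod, ← hmp]
    refine integral_congr_ae (ae_of_all _ fun g => ?_)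
    simp [GraphChart.defn]
  have hL : Tendsto (fun n => ∫ g in Ω, χ n g * (ζ g * Q g + fderiv ℝ ζ g (V g))) atTop
      (𝓝 (∫ g in Ω, (ζ g * Q g + fderiv ℝ ζ g (V g)))) := by
    have hInt := integrableOn_mul_add_fderiv hV hQ hζ hζc
    refine tendsto_integral_of_dominated_convergence
      (fun g => ‖ζ g * Q g + fderiv ℝ ζ g (V g)‖) ?_ hInt.norm ?_ ?_
    · exact fun n => (hχ n).continuous.aestronglyMeasurable.mul hInt.aestronglyMeasurable
    · intro n
      refine ae_of_all _ fun g => ?_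
      rw [norm_mul]
      exact mul_le_of_le_one_left (norm_nonneg _) (abs_stepFn_le _)
    · filter_upwards [ae_restrict_mem hΩ] with g hg
      by_cases hgd : g ∈ tsupport ζ
      · have hneg : 0 < -c.defn g := neg_pos.2 (sub_neg.2 ((c.mem_iff g (hζd hgd)).1 hg))
        have hT : Tendsto (fun n : ℕ => ((n : ℝ) + 1) * -c.defn g) atTop atTop :=
          (tendsto_atTop_add_const_right _ 1 tendsto_natCast_atTop_atTop).atTop_mul_const hneg
        refine tendsto_const_nhds.congr' ?_
        filter_upwards [hT.eventually_ge_atTop 2] with n hn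
        simp only [χ, stepFn_of_ge hn, one_mul]
      · simp [image_eq_zero_of_notMem_tsupport hgd, fderiv_of_notMem_tsupport ℝ hgd]
  have hR := tendsto_integral_layer (k := fun q => k (c.coord.symm q))
    (hk.comp c.coord.symm.continuous)
    (hkc.comp_homeomorph c.coord.symm.toHomeomorph) c.contDiff_height.continuous
  simp only [hkey] at hL
  exact tendsto_nhds_unique hL hR

/-- A finite smooth partition of unity on a compact set. -/
theorem exists_finite_partition {K : Set E} (hK : IsCompact K) (U : E → Set E)
    (hU : ∀ g, IsOpen (U g)) (hKU : ∀ g ∈ K, g ∈ U g) :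
    ∃ (T : Finset E) (ζ : E → E → ℝ), (∀ i, ContDiff ℝ 1 (ζ i)) ∧ (∀ i, HasCompactSupport (ζ i)) ∧
      (∀ i, tsupport (ζ i) ⊆ U i) ∧ ∀ g ∈ K, ∑ i ∈ T, ζ i g = 1 := by
  obtain ⟨R, hR⟩ := hK.isBounded.subset_ball 0
  -- Intersecting with a ball around `K` makes all supports compact.
  obtain ⟨f, hf⟩ := SmoothPartitionOfUnity.exists_isSubordinate (modelWithCornersSelf ℝ E)
    hK.isClosed (fun g => U g ∩ Metric.ball 0 R) (fun g => (hU g).inter Metric.isOpen_ball)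
    (fun g hg => mem_iUnion.2 ⟨g, hKU g hg, hR hg⟩)
  have hfin := f.locallyFinite.finite_nonempty_inter_compact hK
  refine ⟨hfin.toFinset, fun i => f i, fun i => ?_, fun i => ?_, fun i => ?_, fun g hg => ?_⟩
  · exact (f i).contMDiff.contDiff.of_le (by norm_cast)
  · exact Metric.isCompact_of_isClosed_isBounded (isClosed_tsupport _)
      (Metric.isBounded_ball.subset ((hf i).trans inter_subset_right))
  · exact (hf i).trans inter_subset_left
  · rw [← f.sum_eq_one hg]
    refine (finsum_eq_sum_of_support_subset _ fun i hi => ?_).symm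
    simp only [Set.Finite.coe_toFinset, mem_ofPred_eq]
    exact ⟨g, hi, hg⟩

end WeakDivergence

namespace StepTwoCarnot

/-! ### The divergence theorem on a `C²` domain -/

section DivergenceTheorem

variable {E : Type*} [NormedAddCommGroup E] [InnerProductSpace ℝ E] [FiniteDimensional ℝ E]
  [MeasurableSpace E] [BorelSpace E] (𝔾 : StepTwoCarnot E) {Ω : Set E}

theorem continuousOn_metric_outerNormal (hΩ : IsC2BoundedOpen Ω) {V : E → E} (hV : Continuous V) :
    ContinuousOn (fun p => 𝔾.metric p (𝔾.outerNormal Ω p) (V p)) (frontier Ω) := by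
  intro g hg
  obtain ⟨φ, hφ⟩ := hΩ.2.2 g hg
  obtain ⟨c, hc⟩ := exists_graphChart hφ
  have hdefn : ContDiff ℝ 1 c.defn := c.contDiff_defn.of_le (by norm_num)
  have heq (p : E) (hp : p ∈ c.dom ∩ frontier Ω) : 𝔾.metric p (𝔾.outerNormal Ω p) (V p) =
      ‖𝔾.gradAt c.defn p‖⁻¹ * fderiv ℝ c.defn p (V p) :=
    𝔾.metric_outerNormal (c.isLocalDefining hp.1 ((c.mem_frontier_iff hΩ.1 hp.1).1 hp.2)) _
  have hcont : ContinuousAt (fun p => ‖𝔾.gradAt c.defn p‖⁻¹ * fderiv ℝ c.defn p (V p)) g := by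
    refine ContinuousAt.mul ((𝔾.continuous_gradAt hdefn).norm.continuousAt.inv₀ ?_)
      ((hdefn.continuous_fderiv (by norm_num)).clm_apply hV).continuousAt
    exact (𝔾.norm_gradAt_pos (c.isLocalDefining hc ((c.mem_frontier_iff hΩ.1 hc).1 hg))).ne'
  refine hcont.continuousWithinAt.congr_of_eventuallyEq ?_ (heq g ⟨hc, hg⟩)
  filter_upwards [mem_nhdsWithin_of_mem_nhds (c.isOpen_dom.mem_nhds hc), self_mem_nhdsWithin]
    with p hp1 hp2 using heq p ⟨hp1, hp2⟩

theorem ae_mem_frontier : ∀ᵐ p ∂(𝔾.surfaceMeasure Ω), p ∈ frontier Ω := by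
  rw [ae_iff]
  exact 𝔾.surfaceMeasure_compl_frontier

theorem integrable_of_continuousOn_frontier (hΩ : IsC2BoundedOpen Ω) {f : E → ℝ}
    (hf : ContinuousOn f (frontier Ω)) : Integrable f (𝔾.surfaceMeasure Ω) := by
  have := 𝔾.isFiniteMeasure_surfaceMeasure hΩ
  have hcomp : IsCompact (frontier Ω) :=
    hΩ.2.1.isCompact_closure.of_isClosed_subset isClosed_frontier frontier_subset_closure
  have h := hf.integrableOn_compact (μ := 𝔾.surfaceMeasure Ω) hcomp
  rwa [IntegrableOn, Measure.restrict_eq_self_of_ae_mem 𝔾.ae_mem_frontier] at h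

/-- The divergence theorem for a continuous vector field with a weak divergence. -/
theorem setIntegral_eq_of_isWeakDiv (hΩ : IsC2BoundedOpen Ω) {V : E → E} {Q : E → ℝ}
    (hV : Continuous V) (hQ : IntegrableOn Q Ω) (h : IsWeakDiv Ω V Q) :
    ∫ g in Ω, Q g = ∫ p, 𝔾.metric p (𝔾.outerNormal Ω p) (V p) ∂(𝔾.surfaceMeasure Ω) := by
  classical
  have hΩm : MeasurableSet Ω := hΩ.1.measurableSet
  have hG := 𝔾.continuousOn_metric_outerNormal hΩ hV
  have hchart (g : E) (hg : g ∈ frontier Ω) : ∃ c : GraphChart Ω, g ∈ c.dom := by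
    obtain ⟨φ, hφ⟩ := hΩ.2.2 g hg
    exact exists_graphChart hφ
  choose c hc using hchart
  -- Boundary points use a chart. At interior points the whole of `Ω` serves: there the partition
  -- function is itself admissible in the weak identity, and both sides are zero.
  let U (g : E) : Set E :=
    if hg : g ∈ frontier Ω then (c g hg).dom else Ω
  have hUo (g : E) : IsOpen (U g) := by
    by_cases hg : g ∈ frontier Ω
    · simpa [U, hg] using (c g hg).isOpen_dom
    · simpa [U, hg] using hΩ.1
  have hUm (g : E) (hg : g ∈ closure Ω) : g ∈ U g := by
    by_cases hgf : g ∈ frontier Ω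
    · simpa [U, hgf] using hc g hgf
    · have : g ∈ Ω := by
        by_contra hcon
        exact hgf (hΩ.1.frontier_eq ▸ ⟨hg, hcon⟩)
      simpa [U, hgf] using this
  obtain ⟨T, ζ, hζ, hζc, hζU, hsum⟩ :=
    exists_finite_partition hΩ.2.1.isCompact_closure U hUo hUm
  have hζG (i : E) : Integrable (fun p => ζ i p * 𝔾.metric p (𝔾.outerNormal Ω p) (V p))
      (𝔾.surfaceMeasure Ω) :=
    𝔾.integrable_of_continuousOn_frontier hΩ ((hζ i).continuous.continuousOn.mul hG)
  have hloc (i : E) : ∫ g in Ω, (ζ i g * Q g + fderiv ℝ (ζ i) g (V g)) =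
      ∫ p, ζ i p * 𝔾.metric p (𝔾.outerNormal Ω p) (V p) ∂(𝔾.surfaceMeasure Ω) := by
    by_cases hi : i ∈ frontier Ω
    · have hsub : tsupport (ζ i) ⊆ (c i hi).dom := by simpa [U, hi] using hζU i
      rw [h.setIntegral_chart hV hΩm hQ (c i hi) (hζ i) (hζc i) hsub,
        ← setIntegral_eq_integral_of_forall_compl_eq_zero (s := (c i hi).dom),
        𝔾.setIntegral_dom_surfaceMeasure hΩ.1 (c i hi) (hζG i).aestronglyMeasurable,
        ← setIntegral_eq_integral_of_forall_compl_eq_zero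
          (s := (c i hi).param ⁻¹' (c i hi).dom)]
      · refine setIntegral_congr_fun
          ((c i hi).isOpen_dom.preimage (c i hi).contDiff_param.continuous).measurableSet
          fun y hy => ?_
        simp only [← 𝔾.areaElement_mul_metric (c i hi) hy]
        ring
      · intro y hy
        rw [image_eq_zero_of_notMem_tsupport fun hmem => hy (hsub hmem), zero_mul]
      · intro p hp
        rw [image_eq_zero_of_notMem_tsupport fun hmem => hp (hsub hmem), zero_mul]
    · have hsub : tsupport (ζ i) ⊆ Ω := by simpa [U, hi] using hζU i
      rw [h _ (hζ i) (hζc i) hsub]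
      symm
      refine integral_eq_zero_of_ae ?_
      filter_upwards [𝔾.ae_mem_frontier] with p hp
      rw [hΩ.1.frontier_eq] at hp
      rw [image_eq_zero_of_notMem_tsupport fun hmem => hp.2 (hsub hmem), zero_mul]
      rfl
  have hL : ∫ g in Ω, Q g =
      ∑ i ∈ T, ∫ g in Ω, (ζ i g * Q g + fderiv ℝ (ζ i) g (V g)) := by
    rw [← integral_finsetSum T fun i _ => integrableOn_mul_add_fderiv hV hQ (hζ i) (hζc i)]
    refine setIntegral_congr_fun hΩm fun g hg => ?_
    -- The sum is constant near points of `Ω`, so the gradient terms of the partition cancel.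
    have hev : (fun p => ∑ i ∈ T, ζ i p) =ᶠ[𝓝 g] fun _ => 1 := by
      filter_upwards [hΩ.1.mem_nhds hg] with p hp using hsum p (subset_closure hp)
    have hder : ∑ i ∈ T, fderiv ℝ (ζ i) g = 0 := by
      rw [← fderiv_fun_sum fun i _ => (hζ i).differentiable (by norm_num) g, hev.fderiv_eq]
      simp
    have hder' : ∑ i ∈ T, fderiv ℝ (ζ i) g (V g) = 0 := by
      rw [← sum_apply, hder, zero_apply]
    rw [Finset.sum_add_distrib, hder', add_zero, ← Finset.sum_mul, hsum g (subset_closure hg),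
      one_mul]
  rw [hL, Finset.sum_congr rfl fun i _ => hloc i, ← integral_finsetSum T fun i _ => hζG i]
  refine integral_congr_ae ?_
  filter_upwards [𝔾.ae_mem_frontier] with p hp
  rw [← Finset.sum_mul, hsum p (frontier_subset_closure hp), one_mul]

end DivergenceTheorem

end StepTwoCarnot

/-! ### Tangential derivatives on the boundary -/

section Tangential

variable {E : Type*} [NormedAddCommGroup E] [InnerProductSpace ℝ E] [FiniteDimensional ℝ E]
  [MeasurableSpace E] [BorelSpace E] {Ω : Set E}

/-- A function which vanishes on the boundary has no tangential derivative. -/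
theorem GraphChart.fderivWithin_eq_zero (c : GraphChart Ω) {F : E → ℝ}
    {g : E} (hg : g ∈ c.dom) (h0 : c.defn g = 0) (hF : DifferentiableWithinAt ℝ F (closure Ω) g)
    (hz : ∀ᶠ p in 𝓝[frontier Ω] g, F p = 0) {v : E} (hv : fderiv ℝ c.defn g v = 0) :
    fderivWithin ℝ F (closure Ω) g v = 0 := by
  -- The function is differentiable only relative to the closure, so the straight line in direction
  -- `v` is replaced by its lift to the graph, which stays in the boundary for small `s` and has
  -- velocity `v` at `0`.
  let γ (s : ℝ) : E := c.param ((c.coord g).1 + s • (c.coord v).1)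
  have hγ0 : γ 0 = g := by simp [γ, c.param_coord h0]
  have hγ : HasDerivAt γ v 0 := by
    have h1 : HasDerivAt (fun s : ℝ => (c.coord g).1 + s • (c.coord v).1) (c.coord v).1 0 := by
      simpa using ((hasDerivAt_id (0 : ℝ)).smul_const (c.coord v).1).const_add (c.coord g).1
    have h2 : HasFDerivAt c.param (fderiv ℝ c.param (c.coord g).1)
        ((c.coord g).1 + (0 : ℝ) • (c.coord v).1) := by
      simpa using (c.hasFDerivAt_param (c.coord g).1).differentiableAt.hasFDerivAt
    have h3 := HasFDerivAt.comp_hasDerivAt (l := c.param) (0 : ℝ) h2 h1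
    rwa [c.fderiv_param_coord hv] at h3
  let t : Set ℝ := {s | γ s ∈ frontier Ω}
  have ht : t ∈ 𝓝 (0 : ℝ) := by
    have hev : ∀ᶠ s in 𝓝 (0 : ℝ), γ s ∈ c.dom := hγ.continuousAt.eventually_mem (by
      rw [hγ0]; exact c.isOpen_dom.mem_nhds hg)
    filter_upwards [hev] with s hs using c.param_mem_frontier hs
  have hFγ : HasFDerivWithinAt F (fderivWithin ℝ F (closure Ω) g) (closure Ω) (γ 0) := by
    rw [hγ0]; exact hF.hasFDerivWithinAt
  have hcomp : HasDerivAt (F ∘ γ) (fderivWithin ℝ F (closure Ω) g v) 0 :=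
    (hFγ.comp_hasDerivWithinAt (s := t) (0 : ℝ) hγ.hasDerivWithinAt
      fun s hs => frontier_subset_closure hs).hasDerivAt ht
  have hzero : F ∘ γ =ᶠ[𝓝 0] fun _ => 0 := by
    have hT : Tendsto γ (𝓝 0) (𝓝[frontier Ω] g) := by
      refine tendsto_nhdsWithin_iff.2 ⟨?_, ht⟩
      simpa only [hγ0] using hγ.continuousAt.tendsto
    exact hT.eventually hz
  rw [← hcomp.deriv, hzero.deriv_eq, deriv_const]

end Tangential

/-! ### Orthonormal frames and traces -/

section LinearAlgebra

/-- The trace of a quadratic form in an orthonormal basis which contains a given unit vector. -/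
theorem sum_orthonormal_add {m : ℕ} (a : Fin m → Fin m → ℝ)
    (e : Fin (m - 1) → EuclideanSpace ℝ (Fin m)) (he : Orthonormal ℝ e)
    (ν : EuclideanSpace ℝ (Fin m)) (hν : ‖ν‖ = 1) (heν : ∀ i, inner ℝ (e i) ν = (0 : ℝ)) :
    ∑ k, ∑ i, ∑ j, e k i * e k j * a i j + ∑ i, ∑ j, ν i * ν j * a i j = ∑ i, a i i := by
  have hm : 0 < m := by
    rcases Nat.eq_zero_or_pos m with rfl | h
    · have : ν = 0 := Subsingleton.elim _ _
      simp [this] at hν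
    · exact h
  let v : Fin (m - 1) ⊕ Unit → EuclideanSpace ℝ (Fin m) := Sum.elim e fun _ => ν
  have hv : Orthonormal ℝ v := by
    rw [orthonormal_iff_ite] at he ⊢
    rintro (i | i) (j | j)
    · simpa [v] using he i j
    · simp [v, heν]
    · simp [v, real_inner_comm (e j) ν, heν]
    · simp [v, hν]
  let β : OrthonormalBasis (Fin (m - 1) ⊕ Unit) ℝ (EuclideanSpace ℝ (Fin m)) :=
    (basisOfOrthonormalOfCardEqFinrank hv (by
      simp
      omega)).toOrthonormalBasis (by simpa using hv)
  have hβ : ⇑β = v := by simp [β]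
  let T := Matrix.toEuclideanLin (Matrix.of a)
  have hT (x : EuclideanSpace ℝ (Fin m)) : inner ℝ x (T x) = ∑ i, ∑ j, x i * x j * a i j := by
    simp only [T, PiLp.inner_apply, Matrix.toLpLin_apply, Matrix.mulVec, dotProduct,
      Matrix.of_apply, RCLike.inner_apply, conj_trivial, Finset.sum_mul]
    exact Finset.sum_congr rfl fun i _ => Finset.sum_congr rfl fun j _ => by ring
  have h1 := LinearMap.trace_eq_sum_inner T β
  have h2 := LinearMap.trace_eq_sum_inner T (EuclideanSpace.basisFun (Fin m) ℝ)
  rw [h1] at h2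
  simp only [hT, hβ, Fintype.sum_sum_type] at h2
  simpa [v, Pi.single_apply] using h2

theorem exists_orthonormal_perp {m : ℕ} {ν : EuclideanSpace ℝ (Fin m)} (hν : ν ≠ 0) :
    ∃ f : Fin (m - 1) → EuclideanSpace ℝ (Fin m),
      Orthonormal ℝ f ∧ ∀ i, inner ℝ (f i) ν = (0 : ℝ) := by
  have hfin : Module.finrank ℝ (Submodule.span ℝ {ν})ᗮ = m - 1 := by
    have h := (Submodule.span ℝ {ν}).finrank_add_finrank_orthogonal
    rw [finrank_span_singleton hν, finrank_euclideanSpace_fin] at h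
    omega
  let o := (stdOrthonormalBasis ℝ (Submodule.span ℝ {ν})ᗮ).reindex (finCongr hfin)
  refine ⟨fun i => o i, o.orthonormal.comp_linearIsometry (Submodule.subtypeₗᵢ _), fun i => ?_⟩
  rw [real_inner_comm]
  exact Submodule.mem_orthogonal_singleton_iff_inner_right.1 (o i).2

/-- An orthonormal frame orthogonal to `ν₀`, moved by the rotation which takes `ν₀` to `ν`. -/
theorem orthonormal_rotate {V ι : Type*} [NormedAddCommGroup V] [InnerProductSpace ℝ V]
    {f : ι → V} (hf : Orthonormal ℝ f) {ν₀ ν : V} (hν₀ : ‖ν₀‖ = 1) (hν : ‖ν‖ = 1)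
    (hfν : ∀ i, inner ℝ (f i) ν₀ = (0 : ℝ)) (hD : (1 : ℝ) + inner ℝ ν₀ ν ≠ 0) :
    Orthonormal ℝ (fun i => f i - (inner ℝ (f i) ν / (1 + inner ℝ ν₀ ν) : ℝ) • (ν₀ + ν)) ∧
      ∀ i, inner ℝ (f i - (inner ℝ (f i) ν / (1 + inner ℝ ν₀ ν) : ℝ) • (ν₀ + ν)) ν = (0 : ℝ) := by
  classical
  have h0 : inner ℝ ν₀ ν₀ = (1 : ℝ) := by rw [real_inner_self_eq_norm_sq, hν₀]; norm_num
  have h1 : inner ℝ ν ν = (1 : ℝ) := by rw [real_inner_self_eq_norm_sq, hν]; norm_num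
  have hfν' (i) : inner ℝ ν₀ (f i) = (0 : ℝ) := by rw [real_inner_comm, hfν]
  refine ⟨?_, fun i => ?_⟩
  · rw [orthonormal_iff_ite] at hf ⊢
    intro i j
    rw [← hf i j]
    simp only [inner_sub_left, inner_sub_right, inner_smul_left, inner_smul_right, inner_add_left,
      inner_add_right, conj_trivial, h0, h1, hfν, hfν', real_inner_comm (f _) ν,
      real_inner_comm ν₀ ν]
    field_simp
    ring
  · simp only [inner_sub_left, inner_smul_left, inner_add_left, conj_trivial, h1]
    field_simp
    ring

end LinearAlgebra

namespace StepTwoCarnot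

/-! ### The boundary flux and the horizontal mean curvature -/

section BoundaryIdentity

variable {E : Type*} [NormedAddCommGroup E] [InnerProductSpace ℝ E] [FiniteDimensional ℝ E]
  [MeasurableSpace E] [BorelSpace E] (𝔾 : StepTwoCarnot E) {Ω : Set E}

/-- The derivative of `f` along a left-invariant field, relative to a set `S`. -/
def dirDWithin (S : Set E) (v : E) (f : E → ℝ) (g : E) : ℝ :=
  fderivWithin ℝ f S g (𝔾.leftInv v g)

theorem contDiffOn_dirDWithin {S : Set E} (hS : UniqueDiffOn ℝ S) {v : E} {f : E → ℝ}
    (hf : ContDiffOn ℝ 2 f S) : ContDiffOn ℝ 1 (𝔾.dirDWithin S v f) S :=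
  (hf.fderivWithin hS (by norm_num)).clm_apply (𝔾.contDiff_leftInv v (n := 1)).contDiffOn

theorem continuousOn_dirDWithin {S : Set E} (hS : UniqueDiffOn ℝ S) {v : E} {f : E → ℝ}
    (hf : ContDiffOn ℝ 1 f S) : ContinuousOn (𝔾.dirDWithin S v f) S :=
  (hf.continuousOn_fderivWithin hS (by norm_num)).clm_apply (𝔾.continuous_leftInv v).continuousOn

theorem dirDWithin_eq {S : Set E} {v : E} {f : E → ℝ} {g : E} (hg : S ∈ 𝓝 g) :
    𝔾.dirDWithin S v f g = 𝔾.dirD v f g := by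
  rw [dirDWithin, fderivWithin_of_mem_nhds hg, dirD]

theorem dirDWithin_dirDWithin_eq {S : Set E} {v w : E} {f : E → ℝ} {g : E} (hg : S ∈ 𝓝 g) :
    𝔾.dirDWithin S v (𝔾.dirDWithin S w f) g = 𝔾.dirD v (𝔾.dirD w f) g := by
  rw [dirDWithin_eq 𝔾 hg]
  refine (𝔾.dirD_congr ?_).eq_of_nhds
  filter_upwards [eventually_mem_nhds_iff.2 hg] with p hp using 𝔾.dirDWithin_eq hp

variable {m : ℕ} (b : OrthonormalBasis (Fin m) ℝ 𝔾.V₁)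

theorem hNormal_apply (g : E) (j : Fin m) : 𝔾.hNormal b Ω g j =
    𝔾.metric g (𝔾.outerNormal Ω g) (𝔾.leftInv (b j : E) g) := rfl

theorem hNormal_eq {φ : E → ℝ} {g : E} (h : IsLocalDefining Ω φ g) :
    𝔾.hNormal b Ω g = ‖𝔾.gradAt φ g‖⁻¹ •
      WithLp.toLp 2 (fun j => fderiv ℝ φ g (𝔾.leftInv (b j : E) g)) := by
  ext j
  rw [hNormal_apply, 𝔾.metric_outerNormal h]
  simp

/-- An orthonormal frame of the complement of `ν g` is carried to `p` by the rotation taking `ν g`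
to `ν p`. The formula for this rotation is of class `C¹` as long as `1 + ⟨ν g, ν p⟩` is nonzero,
hence near `g`. Existence ensures that the curvature does not take its default value at a
noncharacteristic point. -/
theorem exists_isHMeanCurvature (hΩ : IsOpen Ω) (c : GraphChart Ω) {g : E} (hg : g ∈ c.dom)
    (h0 : c.defn g = 0) (hN : 𝔾.hNormal b Ω g ≠ 0) : ∃ x, 𝔾.IsHMeanCurvature b Ω g x := by
  -- `hNormal` is zero off the boundary, while the frame must be differentiable in a full
  -- neighbourhood. The horizontal gradient of the chart's defining function is a `C¹` field which
  -- on the boundary is a positive multiple of `hNormal`.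
  let n (p : E) : EuclideanSpace ℝ (Fin m) :=
    WithLp.toLp 2 (fun j => fderiv ℝ c.defn p (𝔾.leftInv (b j : E) p))
  have hn : ContDiff ℝ 1 n := by
    refine contDiff_euclidean.2 fun j => ?_
    exact (c.contDiff_defn.fderiv_right (m := 1) (by norm_num)).clm_apply
      (𝔾.contDiff_leftInv _ (n := 1))
  have hNn (p : E) (hp : p ∈ c.dom) (hp0 : c.defn p = 0) :
      𝔾.hNormal b Ω p = ‖𝔾.gradAt c.defn p‖⁻¹ • n p :=
    𝔾.hNormal_eq b (c.isLocalDefining hp hp0)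
  have hng : n g ≠ 0 := fun h => hN (by rw [hNn g hg h0, h, smul_zero])
  let ν (p : E) : EuclideanSpace ℝ (Fin m) := ‖n p‖⁻¹ • n p
  have hν : ContDiffAt ℝ 1 ν g :=
    ((hn.contDiffAt.norm ℝ hng).inv (norm_ne_zero_iff.2 hng)).smul hn.contDiffAt
  have hνn (p : E) (hp : n p ≠ 0) : ‖ν p‖ = 1 := by
    simp [ν, norm_smul, norm_ne_zero_iff.2 hp]
  have hν0 : ν g ≠ 0 := fun h => by
    have := hνn g hng
    simp [h] at this
  obtain ⟨f, hf, hfν⟩ := exists_orthonormal_perp hν0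
  let D (p : E) : ℝ := 1 + inner ℝ (ν g) (ν p)
  have hD : ContDiffAt ℝ 1 D g := contDiffAt_const.add (contDiffAt_const.inner ℝ hν)
  have hDg : D g ≠ 0 := by
    simp only [D, real_inner_self_eq_norm_sq, hνn g hng]
    norm_num
  let e (i : Fin (m - 1)) (p : E) : EuclideanSpace ℝ (Fin m) :=
    f i - (inner ℝ (f i) (ν p) / D p : ℝ) • (ν g + ν p)
  refine ⟨_, e, fun i => ?_, ?_, rfl⟩
  · exact contDiffAt_const.sub (((contDiffAt_const.inner ℝ hν).div hD hDg).smul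
      (contDiffAt_const.add hν))
  · have h1 : ∀ᶠ p in 𝓝 g, n p ≠ 0 := hn.continuous.continuousAt.eventually_ne hng
    have h2 : ∀ᶠ p in 𝓝 g, D p ≠ 0 := hD.continuousAt.eventually_ne hDg
    have h3 : ∀ᶠ p in 𝓝 g, p ∈ c.dom := c.isOpen_dom.mem_nhds hg
    filter_upwards [mem_nhdsWithin_of_mem_nhds h1, mem_nhdsWithin_of_mem_nhds h2,
      mem_nhdsWithin_of_mem_nhds h3, self_mem_nhdsWithin] with p hp1 hp2 hp3 hp4
    obtain ⟨ho, hp⟩ := orthonormal_rotate hf (hνn g hng) (hνn p hp1) hfν hp2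
    refine ⟨ho, fun i => ?_⟩
    rw [hNn p hp3 ((c.mem_frontier_iff hΩ hp3).1 hp4)]
    have hnp : n p = ‖n p‖ • ν p := by
      simp only [ν, smul_smul]
      rw [mul_inv_cancel₀ (norm_ne_zero_iff.2 hp1), one_smul]
    rw [hnp, inner_smul_right, inner_smul_right, hp i, mul_zero, mul_zero]

variable {u : E → ℝ}

/-- On the boundary the horizontal gradient is parallel to the horizontal normal. -/
theorem exists_dirDWithin_eq_mul_hNormal (c : GraphChart Ω) {g : E} (hg : g ∈ c.dom)
    (h0 : c.defn g = 0) (hd : DifferentiableWithinAt ℝ u (closure Ω) g)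
    (hu : ∀ p ∈ frontier Ω, u p = 0) :
    ∃ μ : ℝ, ∀ i, 𝔾.dirDWithin (closure Ω) (b i : E) u g = μ * 𝔾.hNormal b Ω g i := by
  have hdef := c.isLocalDefining hg h0
  have hpos := 𝔾.norm_gradAt_pos hdef
  have hker (v : E) (hv : fderiv ℝ c.defn g v = 0) : fderivWithin ℝ u (closure Ω) g v = 0 :=
    c.fderivWithin_eq_zero hg h0 hd (eventually_nhdsWithin_of_forall hu) hv
  let N : E := c.coord.symm (0, 1)
  have hN : fderiv ℝ c.defn g N = 1 := by simp [c.fderiv_defn, N]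
  have hu' (v : E) : fderivWithin ℝ u (closure Ω) g v =
      fderivWithin ℝ u (closure Ω) g N * fderiv ℝ c.defn g v := by
    have := hker (v - fderiv ℝ c.defn g v • N) (by simp [hN])
    simp only [map_sub, map_smul, smul_eq_mul] at this
    linarith
  refine ⟨fderivWithin ℝ u (closure Ω) g N * ‖𝔾.gradAt c.defn g‖, fun i => ?_⟩
  rw [dirDWithin, hu', hNormal_apply, 𝔾.metric_outerNormal hdef]
  field_simp

theorem angle_eq_zero_iff {g : E} : 𝔾.angle b Ω g = 0 ↔ 𝔾.hNormal b Ω g = 0 := norm_eq_zero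

/-- The horizontal gradient is parallel to the normal, so its product with the tangent field `e`
vanishes along the boundary. The derivative of this product along `e` itself is tangential, hence
zero; the product rule splits it into the Hessian term and the connection term. -/
theorem sum_hess_frame (hΩ : IsC2BoundedOpen Ω) (c : GraphChart Ω) {g : E} (hg : g ∈ c.dom)
    (h0 : c.defn g = 0) (hC : ContDiffOn ℝ 2 u (closure Ω)) (hu : ∀ p ∈ frontier Ω, u p = 0)
    {e : E → EuclideanSpace ℝ (Fin m)} (he : ContDiffAt ℝ 1 e g)
    (hperp : ∀ᶠ p in 𝓝[frontier Ω] g, inner ℝ (e p) (𝔾.hNormal b Ω p) = 0) :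
    ∑ i, ∑ j, e g i * e g j * 𝔾.dirDWithin (closure Ω) (b i : E)
        (𝔾.dirDWithin (closure Ω) (b j : E) u) g =
      -∑ j, 𝔾.hConn b (e g) e g j * 𝔾.dirDWithin (closure Ω) (b j : E) u g := by
  have hU := hΩ.uniqueDiffOn
  have hgf : g ∈ frontier Ω := (c.isLocalDefining hg h0).mem_frontier
  have hgc : g ∈ closure Ω := frontier_subset_closure hgf
  let F (j : Fin m) : E → ℝ := 𝔾.dirDWithin (closure Ω) (b j : E) u
  have hF (j : Fin m) : HasFDerivWithinAt (F j) (fderivWithin ℝ (F j) (closure Ω) g)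
      (closure Ω) g :=
    ((𝔾.contDiffOn_dirDWithin hU hC).differentiableOn (by norm_num) g hgc).hasFDerivWithinAt
  have hed : HasFDerivAt e (fderiv ℝ e g) g := (he.differentiableAt (by norm_num)).hasFDerivAt
  have hej (j : Fin m) : HasFDerivWithinAt (fun p => e p j)
      ((EuclideanSpace.proj j : EuclideanSpace ℝ (Fin m) →L[ℝ] ℝ).comp (fderiv ℝ e g))
      (closure Ω) g :=
    ((EuclideanSpace.proj j : EuclideanSpace ℝ (Fin m) →L[ℝ] ℝ).hasFDerivAt.comp g
      hed).hasFDerivWithinAt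
  have hsum : HasFDerivWithinAt (fun p => ∑ j, e p j * F j p) _ (closure Ω) g :=
    HasFDerivWithinAt.fun_sum fun j _ => (hej j).mul (hF j)
  have hz : ∀ᶠ p in 𝓝[frontier Ω] g, ∑ j, e p j * F j p = 0 := by
    filter_upwards [hperp, mem_nhdsWithin_of_mem_nhds (c.isOpen_dom.mem_nhds hg),
      self_mem_nhdsWithin] with p hp hpd hpf
    obtain ⟨μ, hμ⟩ := 𝔾.exists_dirDWithin_eq_mul_hNormal b c hpd
      ((c.mem_frontier_iff hΩ.1 hpd).1 hpf)
      (hC.differentiableOn (by norm_num) p (frontier_subset_closure hpf)) hu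
    simp only [F, hμ]
    rw [PiLp.inner_apply] at hp
    simp only [RCLike.inner_apply, conj_trivial] at hp
    calc ∑ j, e p j * (μ * 𝔾.hNormal b Ω p j)
        = μ * ∑ j, 𝔾.hNormal b Ω p j * e p j := by
          rw [Finset.mul_sum]
          exact Finset.sum_congr rfl fun j _ => by ring
      _ = 0 := by rw [hp, mul_zero]
  let w : E := ∑ k, e g k • 𝔾.leftInv (b k : E) g
  have hw : fderiv ℝ c.defn g w = 0 := by
    have hp := hperp.self_of_nhdsWithin hgf
    have hdef := c.isLocalDefining hg h0
    have hpos := 𝔾.norm_gradAt_pos hdef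
    rw [𝔾.hNormal_eq b hdef, inner_smul_right, PiLp.inner_apply] at hp
    simp only [RCLike.inner_apply, conj_trivial] at hp
    have hp' := (mul_eq_zero.1 hp).resolve_left (inv_ne_zero hpos.ne')
    simp only [w, map_sum, map_smul, smul_eq_mul]
    rw [← hp']
    exact Finset.sum_congr rfl fun j _ => by ring
  have hmain := c.fderivWithin_eq_zero hg h0 hsum.differentiableWithinAt hz hw
  rw [hsum.fderivWithin (hU g hgc)] at hmain
  simp only [sum_apply, add_apply, smul_apply, smul_eq_mul, Finset.sum_add_distrib] at hmain
  have hA (j : Fin m) : fderivWithin ℝ (F j) (closure Ω) g w =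
      ∑ i, e g i * 𝔾.dirDWithin (closure Ω) (b i : E) (F j) g := by
    simp only [w, map_sum, map_smul, smul_eq_mul]
    rfl
  simp only [hA, Finset.mul_sum] at hmain
  rw [Finset.sum_comm] at hmain
  have hB : ∑ j, F j g * ((EuclideanSpace.proj j : EuclideanSpace ℝ (Fin m) →L[ℝ] ℝ).comp
      (fderiv ℝ e g)) w = ∑ j, 𝔾.hConn b (e g) e g j * F j g :=
    Finset.sum_congr rfl fun j _ => mul_comm _ _
  rw [hB] at hmain
  rw [eq_neg_iff_add_eq_zero, ← hmain]
  congr 1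
  exact Finset.sum_congr rfl fun i _ => Finset.sum_congr rfl fun j _ => by ring

/-- The flux through the boundary in terms of the horizontal mean curvature. -/
theorem sum_fluxCoeff_mul_hNormal (hΩ : IsC2BoundedOpen Ω) (hC : ContDiffOn ℝ 2 u (closure Ω))
    (hu : ∀ p ∈ frontier Ω, u p = 0) {g : E} (hgf : g ∈ frontier Ω) :
    ∑ i, fluxCoeff (fun i => 𝔾.dirDWithin (closure Ω) (b i : E) u g)
        (fun i j => 𝔾.dirDWithin (closure Ω) (b i : E)
          (𝔾.dirDWithin (closure Ω) (b j : E) u) g) i * 𝔾.hNormal b Ω g i =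
      𝔾.hMeanCurvature b Ω g * 𝔾.hGradSq b Ω u g * 𝔾.angle b Ω g := by
  obtain ⟨φ, hφ⟩ := hΩ.2.2 g hgf
  obtain ⟨c, hg⟩ := exists_graphChart hφ
  have h0 := (c.mem_frontier_iff hΩ.1 hg).1 hgf
  -- At a characteristic point both sides vanish, whatever value the curvature has there.
  by_cases hN : 𝔾.hNormal b Ω g = 0
  · rw [(𝔾.angle_eq_zero_iff b).2 hN, mul_zero]
    simp [hN]
  have hW : 𝔾.angle b Ω g ≠ 0 := fun h => hN ((𝔾.angle_eq_zero_iff b).1 h)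
  have hex := 𝔾.exists_isHMeanCurvature b hΩ.1 c hg h0 hN
  have hH : 𝔾.hMeanCurvature b Ω g = hex.choose := by
    rw [hMeanCurvature, if_neg fun h => hW h.2, hMeanCurvatureAux, dif_pos hex]
  -- The argument works for every admissible frame, so it does not matter which value the definition
  -- has chosen.
  obtain ⟨e, he, hev, hval⟩ := hex.choose_spec
  rw [hH, hval]
  set W := 𝔾.angle b Ω g with hWdef
  set N := 𝔾.hNormal b Ω g with hNdef
  set f : Fin m → ℝ := fun i => 𝔾.dirDWithin (closure Ω) (b i : E) u g with hf
  set a : Fin m → Fin m → ℝ := fun i j => 𝔾.dirDWithin (closure Ω) (b i : E)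
          (𝔾.dirDWithin (closure Ω) (b j : E) u) g with ha
  obtain ⟨μ, hμ⟩ : ∃ μ : ℝ, ∀ i, f i = μ * N i := 𝔾.exists_dirDWithin_eq_mul_hNormal b c hg h0
    (hC.differentiableOn (by norm_num) g (frontier_subset_closure hgf)) hu
  have hN2 : ∑ i, N i ^ 2 = W ^ 2 := by
    rw [hWdef, angle, EuclideanSpace.norm_sq_eq]
    simp only [Real.norm_eq_abs, sq_abs]
    rfl
  have hgauss (i : Fin m) : 𝔾.hGauss b Ω g i = W⁻¹ * N i := rfl
  have hframe (k : Fin (m - 1)) : ∑ i, ∑ j, e k g i * e k g j * a i j =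
      -(μ * W * inner ℝ (𝔾.hConn b (e k g) (e k) g) (𝔾.hGauss b Ω g)) := by
    rw [𝔾.sum_hess_frame b hΩ c hg h0 hC hu (he k) (hev.mono fun p hp => hp.2 k), PiLp.inner_apply,
      Finset.mul_sum]
    congr 1
    refine Finset.sum_congr rfl fun j _ => ?_
    change _ * f j = _
    rw [hμ j]
    simp only [RCLike.inner_apply, conj_trivial, hgauss]
    field_simp
  have hG1 : ‖𝔾.hGauss b Ω g‖ = 1 := by
    have hWn : 0 ≤ 𝔾.angle b Ω g := norm_nonneg _
    rw [hGauss, norm_smul, norm_inv, Real.norm_of_nonneg hWn]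
    exact inv_mul_cancel₀ hW
  have hev0 := hev.self_of_nhdsWithin hgf
  -- The trace of `a` minus its value on the horizontal Gauss map is the sum over the tangent frame,
  -- which `hframe` expresses by the curvature.
  have htr := sum_orthonormal_add a (fun k => e k g) hev0.1 (𝔾.hGauss b Ω g) hG1 fun k => by
    rw [hGauss, inner_smul_right, hev0.2 k, mul_zero]
  simp only [hframe, hgauss] at htr
  have hquad : ∑ i, ∑ j, W⁻¹ * N i * (W⁻¹ * N j) * a i j =
      (W⁻¹) ^ 2 * ∑ i, ∑ j, N i * N j * a i j := by
    simp only [Finset.mul_sum]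
    exact Finset.sum_congr rfl fun i _ => Finset.sum_congr rfl fun j _ => by ring
  rw [hquad, Finset.sum_neg_distrib, ← Finset.mul_sum] at htr
  have hgrad : 𝔾.hGradSq b Ω u g = μ ^ 2 * W ^ 2 := by
    rw [← hN2, Finset.mul_sum]
    exact Finset.sum_congr rfl fun i _ => by
      change f i ^ 2 = _
      rw [hμ i]; ring
  -- With `f = μ N`, both `a i j` and `a j i` contract to `a(N, N)`, so the coefficients `1` and
  -- `-2` leave `-a(N, N)` and the antisymmetric part of `a` drops out.
  have hflux : ∑ i, fluxCoeff f a i * N i =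
      μ * (W ^ 2 * ∑ i, a i i - ∑ i, ∑ j, N i * N j * a i j) := by
    have hswap : ∑ i, ∑ j, N i * N j * a j i = ∑ i, ∑ j, N i * N j * a i j := by
      rw [Finset.sum_comm]
      exact Finset.sum_congr rfl fun i _ => Finset.sum_congr rfl fun j _ => by ring
    have h1 : ∑ i, fluxCoeff f a i * N i = ∑ i, ∑ j, (μ * (N i ^ 2 * a j j) +
        (μ * (N i * N j * a i j) - 2 * μ * (N i * N j * a j i))) := by
      refine Finset.sum_congr rfl fun i _ => ?_
      rw [fluxCoeff, Finset.sum_mul]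
      refine Finset.sum_congr rfl fun j _ => ?_
      rw [hμ i, hμ j]
      ring
    rw [h1]
    simp only [Finset.sum_add_distrib, Finset.sum_sub_distrib, ← Finset.mul_sum, hswap,
      ← Finset.sum_mul, hN2]
    ring
  rw [hflux, hgrad]
  set S := ∑ i, ∑ j, N i * N j * a i j
  set t := ∑ i, a i i
  have h2 : W ^ 2 * t - S = -(μ * W ^ 3 *
      ∑ k, inner ℝ (𝔾.hConn b (e k g) (e k) g) (𝔾.hGauss b Ω g)) := by
    rw [← htr]
    field_simp
    ring
  rw [h2]
  ring

end BoundaryIdentity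

end StepTwoCarnot

/-! ### Symmetric functions and the algebra of the Hessian -/

section Symmetric

/-- This is Newton's identity of degree two. -/
theorem two_mul_sum_powersetCard_two {ι : Type*} [Fintype ι] [DecidableEq ι] (x : ι → ℝ) :
    2 * ∑ t ∈ Finset.powersetCard 2 Finset.univ, ∏ i ∈ t, x i = (∑ i, x i) ^ 2 - ∑ i, x i ^ 2 := by
  have h := congrArg (MvPolynomial.aeval x) (MvPolynomial.mul_esymm_eq_sum ι ℝ 2)
  have hfil : (Finset.HasAntidiagonal.antidiagonal 2 : Finset (ℕ × ℕ)).filter (fun a => a.1 < 2) =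
      ({(0, 2), (1, 1)} : Finset (ℕ × ℕ)) := by
    decide
  rw [hfil, Finset.sum_pair (by decide)] at h
  simp only [MvPolynomial.esymm, MvPolynomial.psum, map_mul, map_sum, map_prod, map_add, map_pow,
    MvPolynomial.aeval_X, map_neg, map_one, Finset.powersetCard_zero, Finset.sum_singleton,
    Finset.prod_empty, Finset.powersetCard_one, Finset.sum_map, map_natCast,
    Function.Embedding.coeFn_mk, Finset.prod_singleton, pow_zero, pow_one] at h
  push_cast at h
  rw [h]
  ring

theorem Matrix.IsHermitian.sum_sq_eigenvalues {ι : Type*} [Fintype ι] [DecidableEq ι]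
    {A : Matrix ι ι ℝ} (hA : A.IsHermitian) :
    ∑ i, hA.eigenvalues i ^ 2 = ∑ i, ∑ j, A i j ^ 2 := by
  have h1 : (A * A).trace = ∑ i, hA.eigenvalues i ^ 2 := by
    conv_lhs => rw [hA.spectral_theorem]
    rw [← map_mul, Unitary.conjStarAlgAut_apply, Matrix.trace_mul_cycle, Unitary.coe_star_mul_self,
      one_mul, Matrix.diagonal_mul_diagonal, Matrix.trace_diagonal]
    exact Finset.sum_congr rfl fun i _ => by simp [pow_two]
  rw [← h1]
  simp only [Matrix.trace, Matrix.diag_apply, Matrix.mul_apply]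
  refine Finset.sum_congr rfl fun i _ => Finset.sum_congr rfl fun j _ => ?_
  have : A j i = A i j := by simpa using hA.apply i j
  rw [this, pow_two]

/-- Let `s` and `k` be the symmetric and antisymmetric parts of `a`. Then `∑ a i j ^ 2 = |s|² +
|k|²` and `∑ a i j * a j i = |s|² - |k|²`, so `hessQuad a = (tr a)² - |s|² + 3 |k|²`. As `a i j - a
j i = 2 k i j`, the coefficient of the commutators is `3 / 4`. -/
theorem hessQuad_eq {m : ℕ} (a : Fin m → Fin m → ℝ) :
    hessQuad a = ((∑ i, a i i) ^ 2 - ∑ i, ∑ j, ((a i j + a j i) / 2) ^ 2) +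
      3 / 4 * ∑ i, ∑ j, (a i j - a j i) ^ 2 := by
  have hsw : ∑ i, ∑ j, a j i ^ 2 = ∑ i, ∑ j, a i j ^ 2 := Finset.sum_comm
  have h1 : hessQuad a = (∑ i, a i i) ^ 2 + ∑ i, ∑ j, a i j ^ 2 -
      2 * ∑ i, ∑ j, a i j * a j i := by
    rw [pow_two, Finset.sum_mul_sum, hessQuad]
    simp only [Finset.mul_sum, ← Finset.sum_add_distrib, ← Finset.sum_sub_distrib]
    exact Finset.sum_congr rfl fun i _ => Finset.sum_congr rfl fun j _ => by ring
  have h2 : ∑ i, ∑ j, ((a i j + a j i) / 2) ^ 2 =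
      1 / 4 * ∑ i, ∑ j, a i j ^ 2 + 1 / 4 * ∑ i, ∑ j, a j i ^ 2 +
        1 / 2 * ∑ i, ∑ j, a i j * a j i := by
    simp only [Finset.mul_sum, ← Finset.sum_add_distrib]
    exact Finset.sum_congr rfl fun i _ => Finset.sum_congr rfl fun j _ => by ring
  have h3 : ∑ i, ∑ j, (a i j - a j i) ^ 2 =
      ∑ i, ∑ j, a i j ^ 2 + ∑ i, ∑ j, a j i ^ 2 - 2 * ∑ i, ∑ j, a i j * a j i := by
    simp only [Finset.mul_sum, ← Finset.sum_add_distrib, ← Finset.sum_sub_distrib]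
    exact Finset.sum_congr rfl fun i _ => Finset.sum_congr rfl fun j _ => by ring
  rw [h1, h2, h3, hsw]
  ring

end Symmetric

namespace StepTwoCarnot

/-! ### The integral identity and the estimate -/

section Main

variable {E : Type*} [NormedAddCommGroup E] [InnerProductSpace ℝ E] [FiniteDimensional ℝ E]
  [MeasurableSpace E] [BorelSpace E] (𝔾 : StepTwoCarnot E) {Ω : Set E}
  {m : ℕ} (b : OrthonormalBasis (Fin m) ℝ 𝔾.V₁) {u : E → ℝ}

theorem hessQuad_X (g : E) : hessQuad (fun i j => 𝔾.X b i (𝔾.X b j u) g) =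
    2 * 𝔾.symF b 2 u g + 3 / 4 * ∑ i, ∑ j, (𝔾.comm b i j u g) ^ 2 := by
  have hA := 𝔾.symHess_isHermitian b u g
  have htr : ∑ i, hA.eigenvalues i = ∑ i, 𝔾.X b i (𝔾.X b i u) g := by
    have h := hA.trace_eq_sum_eigenvalues
    simp only [RCLike.ofReal_real_eq_id, id_eq] at h
    rw [← h, Matrix.trace]
    exact Finset.sum_congr rfl fun i _ => by simp [symHess]
  rw [hessQuad_eq, symF, two_mul_sum_powersetCard_two, htr, hA.sum_sq_eigenvalues]
  rfl

theorem X_X_eq (hΩ : IsOpen Ω) (hu : ContDiffOn ℝ 2 u Ω) {g : E} (hg : g ∈ Ω) (i j : Fin m) :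
    𝔾.X b i (𝔾.X b j u) g = 𝔾.dirD (b i : E) (𝔾.dirD (b j : E) u) g := by
  have hev : 𝔾.X b j u =ᶠ[𝓝 g] 𝔾.dirD (b j : E) u := by
    filter_upwards [hΩ.mem_nhds hg] with p hp
    exact 𝔾.lieD_eq_dirD ((hu.contDiffAt (hΩ.mem_nhds hp)).differentiableAt (by norm_num))
  rw [X, 𝔾.lieD_congr hev]
  exact 𝔾.lieD_eq_dirD ((𝔾.contDiffAt_dirD (n := 1)
    (hu.contDiffAt (hΩ.mem_nhds hg))).differentiableAt (by norm_num))

theorem X_X_eq_dirDWithin (hΩ : IsOpen Ω) (hu : ContDiffOn ℝ 2 u (closure Ω)) {g : E} (hg : g ∈ Ω)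
    (i j : Fin m) : 𝔾.X b i (𝔾.X b j u) g =
      𝔾.dirDWithin (closure Ω) (b i : E) (𝔾.dirDWithin (closure Ω) (b j : E) u) g := by
  rw [𝔾.X_X_eq b hΩ (hu.mono subset_closure) hg,
    𝔾.dirDWithin_dirDWithin_eq (mem_of_superset (hΩ.mem_nhds hg) subset_closure)]

theorem measurable_angle (hΩ : IsC2BoundedOpen Ω) : Measurable (𝔾.angle b Ω) := by
  classical
  have hc : ContinuousOn (𝔾.angle b Ω) (frontier Ω) := by
    refine ContinuousOn.norm ?_
    refine (PiLp.continuous_toLp 2 _).comp_continuousOn (continuousOn_pi.2 fun j => ?_)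
    exact 𝔾.continuousOn_metric_outerNormal hΩ (𝔾.continuous_leftInv (b j : E))
  have heq : 𝔾.angle b Ω = (frontier Ω).piecewise (𝔾.angle b Ω) fun _ => 0 := by
    ext g
    by_cases hg : g ∈ frontier Ω
    · simp [hg]
    · have hN : 𝔾.hNormal b Ω g = 0 := by
        ext j
        rw [hNormal_apply, 𝔾.outerNormal_eq_zero hg]
        simp [metric]
      simp [hg, angle, hN]
  rw [heq]
  exact hc.measurable_piecewise continuousOn_const isClosed_frontier.measurableSet

theorem isWeakDiv_flux (hΩ : IsOpen Ω) (hu : ContDiffOn ℝ 2 u (closure Ω)) {V : Fin m → E → ℝ}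
    (hV : ∀ i, ∀ g ∈ closure Ω, V i g =
      fluxCoeff (fun i => 𝔾.dirDWithin (closure Ω) (b i : E) u g)
        (fun i j => 𝔾.dirDWithin (closure Ω) (b i : E)
          (𝔾.dirDWithin (closure Ω) (b j : E) u) g) i) :
    IsWeakDiv Ω (fun g => ∑ i, V i g • 𝔾.leftInv (b i : E) g)
      (fun g => hessQuad fun i j => 𝔾.X b i (𝔾.X b j u) g) := by
  intro η hη hηc hηΩ
  have huΩ : ContDiffOn ℝ 2 u Ω := hu.mono subset_closure
  have h := 𝔾.integral_hessQuad (fun i => (b i : E)) hΩ huΩ hη hηc hηΩ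
  rw [← setIntegral_eq_integral_of_forall_compl_eq_zero (s := Ω)] at h
  · rw [← h]
    refine setIntegral_congr_fun hΩ.measurableSet fun g hg => ?_
    have hn : closure Ω ∈ 𝓝 g := mem_of_superset (hΩ.mem_nhds hg) subset_closure
    simp only [𝔾.X_X_eq b hΩ huΩ hg, map_sum, map_smul, smul_eq_mul,
      fun i => hV i g (subset_closure hg), 𝔾.dirDWithin_dirDWithin_eq hn]
    simp only [𝔾.dirDWithin_eq hn]
    rfl
  · intro g hg
    have hg' : g ∉ tsupport η := fun h => hg (hηΩ h)
    simp [image_eq_zero_of_notMem_tsupport hg', fun i => 𝔾.dirD_eq_zero_of_notMem_tsupport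
      (v := (b i : E)) hg']

theorem continuousOn_hess (hΩ : IsC2BoundedOpen Ω) (hu : ContDiffOn ℝ 2 u (closure Ω))
    (i j : Fin m) : ContinuousOn (fun g => 𝔾.dirDWithin (closure Ω) (b i : E)
      (𝔾.dirDWithin (closure Ω) (b j : E) u) g) (closure Ω) :=
  𝔾.continuousOn_dirDWithin hΩ.uniqueDiffOn (𝔾.contDiffOn_dirDWithin hΩ.uniqueDiffOn hu)

theorem integrableOn_of_continuousOn_closure (hΩ : IsC2BoundedOpen Ω) {f F : E → ℝ}
    (hF : ContinuousOn F (closure Ω)) (hf : EqOn F f Ω) : IntegrableOn f Ω :=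
  ((hF.integrableOn_compact hΩ.2.1.isCompact_closure).mono_set subset_closure).congr_fun hf
    hΩ.1.measurableSet

theorem integrableOn_comm_sq (hΩ : IsC2BoundedOpen Ω) (hu : ContDiffOn ℝ 2 u (closure Ω))
    (i j : Fin m) : IntegrableOn (fun g => (𝔾.comm b i j u g) ^ 2) Ω := by
  refine integrableOn_of_continuousOn_closure hΩ
    (((𝔾.continuousOn_hess b hΩ hu i j).sub (𝔾.continuousOn_hess b hΩ hu j i)).pow 2)
    fun g hg => ?_
  simp only [comm, 𝔾.X_X_eq_dirDWithin b hΩ.1 hu hg]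
  rfl

/-- The curvature may be unbounded near the characteristic set. Its product with `|∇_H u|² W` is
nevertheless the normal component of a continuous field, hence continuous on the boundary, and this
gives the integrability with respect to the perimeter measure. -/
theorem integral_hessQuad_eq (hΩ : IsC2BoundedOpen Ω) (hu : ContDiffOn ℝ 2 u (closure Ω))
    (h0 : ∀ g ∈ frontier Ω, u g = 0) :
    IntegrableOn (fun g => hessQuad fun i j => 𝔾.X b i (𝔾.X b j u) g) Ω ∧
    Integrable (fun g => 𝔾.hMeanCurvature b Ω g * 𝔾.hGradSq b Ω u g)
      (𝔾.perimeterMeasure b Ω) ∧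
    ∫ g in Ω, hessQuad (fun i j => 𝔾.X b i (𝔾.X b j u) g) =
      ∫ g, 𝔾.hMeanCurvature b Ω g * 𝔾.hGradSq b Ω u g ∂(𝔾.perimeterMeasure b Ω) := by
  have hh := 𝔾.continuousOn_hess b hΩ hu
  have hg1 (i : Fin m) : ContinuousOn (𝔾.dirDWithin (closure Ω) (b i : E) u) (closure Ω) :=
    𝔾.continuousOn_dirDWithin hΩ.uniqueDiffOn (hu.of_le (by norm_num))
  have hflux (i : Fin m) : ContinuousOn (fun g =>
      fluxCoeff (fun i => 𝔾.dirDWithin (closure Ω) (b i : E) u g)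
        (fun i j => 𝔾.dirDWithin (closure Ω) (b i : E)
          (𝔾.dirDWithin (closure Ω) (b j : E) u) g) i) (closure Ω) :=
    continuousOn_finsetSum _ fun j _ => ((hg1 i).mul (hh j j)).add
      (((hh i j).sub (continuousOn_const.mul (hh j i))).mul (hg1 j))
  have hext (i : Fin m) : ∃ V : E → ℝ, Continuous V ∧ ∀ g ∈ closure Ω, V g =
      fluxCoeff (fun i => 𝔾.dirDWithin (closure Ω) (b i : E) u g)
        (fun i j => 𝔾.dirDWithin (closure Ω) (b i : E)
          (𝔾.dirDWithin (closure Ω) (b j : E) u) g) i := by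
    -- The divergence theorem asks for a field which is continuous on all of `E`; Tietze's theorem
    -- extends the flux from the closure. The extension does not affect the weak divergence in `Ω`
    -- or the boundary values.
    obtain ⟨V, hV⟩ := ContinuousMap.exists_restrict_eq isClosed_closure
      ⟨_, (hflux i).domRestrict⟩
    exact ⟨V, V.continuous, fun g hg => DFunLike.congr_fun hV ⟨g, hg⟩⟩
  choose V hVc hV using hext
  have hVcont : Continuous fun g => ∑ i, V i g • 𝔾.leftInv (b i : E) g :=
    continuous_finsetSum _ fun i _ => (hVc i).smul (𝔾.continuous_leftInv _)
  have hQ : IntegrableOn (fun g => hessQuad fun i j => 𝔾.X b i (𝔾.X b j u) g) Ω := by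
    refine integrableOn_of_continuousOn_closure hΩ
      (F := fun g => hessQuad fun i j => 𝔾.dirDWithin (closure Ω) (b i : E)
          (𝔾.dirDWithin (closure Ω) (b j : E) u) g) ?_ fun g hg => ?_
    · exact continuousOn_finsetSum _ fun i _ => continuousOn_finsetSum _ fun j _ =>
        (((hh i i).mul (hh j j)).sub ((hh j i).mul (hh i j))).add
          (((hh i j).sub (hh j i)).mul (hh i j))
    · simp only [𝔾.X_X_eq_dirDWithin b hΩ.1 hu hg]
  have hdiv := 𝔾.setIntegral_eq_of_isWeakDiv hΩ hVcont hQ (𝔾.isWeakDiv_flux b hΩ.1 hu hV)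
  have hbd : (fun p => 𝔾.metric p (𝔾.outerNormal Ω p) (∑ i, V i p • 𝔾.leftInv (b i : E) p))
      =ᵐ[𝔾.surfaceMeasure Ω] fun p => (ENNReal.ofReal (𝔾.angle b Ω p)).toReal •
        (𝔾.hMeanCurvature b Ω p * 𝔾.hGradSq b Ω u p) := by
    filter_upwards [𝔾.ae_mem_frontier] with p hp
    have hlin : 𝔾.metric p (𝔾.outerNormal Ω p) (∑ i, V i p • 𝔾.leftInv (b i : E) p) =
        ∑ i, V i p * 𝔾.hNormal b Ω p i := by
      simp only [hNormal_apply, metric, map_sum, map_smul, inner_sum, inner_smul_right]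
    have hW : 0 ≤ 𝔾.angle b Ω p := norm_nonneg _
    rw [hlin, ENNReal.toReal_ofReal hW, smul_eq_mul, mul_comm (𝔾.angle b Ω p),
      ← 𝔾.sum_fluxCoeff_mul_hNormal b hΩ hu h0 hp]
    exact Finset.sum_congr rfl fun i _ => by rw [hV i p (frontier_subset_closure hp)]
  have hmeas : Measurable fun p => ENNReal.ofReal (𝔾.angle b Ω p) :=
    (𝔾.measurable_angle b hΩ).ennreal_ofReal
  have hlt : ∀ᵐ p ∂(𝔾.surfaceMeasure Ω), ENNReal.ofReal (𝔾.angle b Ω p) < ⊤ :=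
    ae_of_all _ fun _ => ENNReal.ofReal_lt_top
  refine ⟨hQ, ?_, ?_⟩
  · rw [perimeterMeasure, integrable_withDensity_iff_integrable_smul' hmeas hlt]
    exact (𝔾.integrable_of_continuousOn_frontier hΩ
      (𝔾.continuousOn_metric_outerNormal hΩ hVcont)).congr hbd
  · rw [hdiv, perimeterMeasure, integral_withDensity_eq_integral_toReal_smul hmeas hlt]
    exact integral_congr_ae hbd

/-- The estimate of the commutators by the mean curvature of the boundary. -/
theorem sum_integral_comm_sq_le (hΩ : IsC2BoundedOpen Ω) (hu : ContDiffOn ℝ 2 u (closure Ω))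
    (hconv : 𝔾.HConvexOn b 2 Ω u) (h0 : ∀ g ∈ frontier Ω, u g = 0) :
    ∑ i, ∑ j, ∫ g in Ω, (𝔾.comm b i j u g) ^ 2 ≤
      4 / 3 * ∫ g, 𝔾.hMeanCurvature b Ω g * 𝔾.hGradSq b Ω u g ∂(𝔾.perimeterMeasure b Ω) := by
  obtain ⟨hQ, -, heq⟩ := 𝔾.integral_hessQuad_eq b hΩ hu h0
  have hi := 𝔾.integrableOn_comm_sq b hΩ hu
  have hsum : ∑ i, ∑ j, ∫ g in Ω, (𝔾.comm b i j u g) ^ 2 =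
      ∫ g in Ω, ∑ i, ∑ j, (𝔾.comm b i j u g) ^ 2 := by
    rw [integral_finsetSum _ fun i _ => integrable_finsetSum _ fun j _ => hi i j]
    exact Finset.sum_congr rfl fun i _ => (integral_finsetSum _ fun j _ => hi i j).symm
  -- The integrands differ by twice the second symmetric function, which is nonnegative by
  -- convexity.
  have hle : ∫ g in Ω, 3 / 4 * ∑ i, ∑ j, (𝔾.comm b i j u g) ^ 2 ≤
      ∫ g in Ω, hessQuad (fun i j => 𝔾.X b i (𝔾.X b j u) g) := by
    refine setIntegral_mono_on ?_ hQ hΩ.1.measurableSet fun g hg => ?_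
    · exact (integrable_finsetSum _ fun i _ =>
        integrable_finsetSum _ fun j _ => hi i j).const_mul _
    · rw [hessQuad_X]
      linarith [hconv 2 (by norm_num) le_rfl g hg]
  rw [integral_const_mul, heq] at hle
  rw [hsum]
  linarith

end Main

end StepTwoCarnot

/-! ### The Heisenberg group -/

section Heisenberg

variable {n : ℕ} (hn : 1 ≤ n) {m : ℕ} (b : OrthonormalBasis (Fin m) ℝ (heisenberg n hn).V₁)

/-- The rotation `(x, y, t) ↦ (-y, x, 0)`. -/
def heisRot (p : HeisSpace n) : HeisSpace n :=
  WithLp.toLp 2 (Sum.elim (fun j => -p (Sum.inr (Sum.inl j)))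
    (Sum.elim (fun j => p (Sum.inl j)) fun _ => 0))

theorem heisForm_eq_inner (p q : HeisSpace n) : heisForm n p q = inner ℝ (heisRot p) q := by
  rw [heisForm_apply, PiLp.inner_apply]
  simp only [heisRot, Fintype.sum_sum_type, Sum.elim_inl, Sum.elim_inr, RCLike.inner_apply,
    conj_trivial]
  simp [Finset.sum_sub_distrib, mul_comm]
  ring

theorem heisRot_mem (p : HeisSpace n) : heisRot p ∈ (heisenberg n hn).V₁ := by
  change heisRot p ∈ (Submodule.span ℝ {heisT n})ᗮ
  rw [Submodule.mem_orthogonal_singleton_iff_inner_right]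
  simp [heisRot, heisT, EuclideanSpace.inner_single_left]

theorem norm_sq_heisRot {p : HeisSpace n} (hp : p ∈ (heisenberg n hn).V₁) :
    ‖heisRot p‖ ^ 2 = ‖p‖ ^ 2 := by
  change p ∈ (Submodule.span ℝ {heisT n})ᗮ at hp
  rw [Submodule.mem_orthogonal_singleton_iff_inner_right] at hp
  have ht : p (Sum.inr (Sum.inr ())) = 0 := by
    simpa [heisT, EuclideanSpace.inner_single_left] using hp
  rw [EuclideanSpace.norm_sq_eq, EuclideanSpace.norm_sq_eq]
  simp [heisRot, Fintype.sum_sum_type, ht]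
  ring

/-- Each row is, by Parseval, the squared norm of the rotated unit vector `heisRot (b i)`, hence
`1`; there are `m = 2 n` rows. The sum therefore does not depend on the basis. -/
theorem sum_heisForm_sq : ∑ i, ∑ j, heisForm n (b i : HeisSpace n) (b j) ^ 2 = 2 * (n : ℝ) := by
  have hrow (i : Fin m) : ∑ j, heisForm n (b i : HeisSpace n) (b j) ^ 2 = 1 := by
    have h := b.sum_sq_norm_inner_left
      (⟨heisRot (b i : HeisSpace n), heisRot_mem hn _⟩ : (heisenberg n hn).V₁)
    have h2 : ‖(⟨heisRot (b i : HeisSpace n), heisRot_mem hn _⟩ :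
        (heisenberg n hn).V₁)‖ ^ 2 = 1 := by
      rw [Submodule.coe_norm, norm_sq_heisRot hn (b i).2, ← Submodule.coe_norm, b.norm_eq_one]
      norm_num
    rw [h2] at h
    rw [← h]
    refine Finset.sum_congr rfl fun j _ => ?_
    rw [heisForm_eq_inner, Real.norm_eq_abs, sq_abs]
    rfl
  simp only [hrow, Finset.sum_const, Finset.card_univ, Fintype.card_fin, nsmul_eq_mul, mul_one]
  have hT : heisT n ≠ 0 := by simp [heisT]
  have h1 : Module.finrank ℝ (heisenberg n hn).V₁ = m := by
    rw [Module.finrank_eq_card_basis b.toBasis, Fintype.card_fin]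
  have h2 := (Submodule.span ℝ {heisT n}).finrank_add_finrank_orthogonal
  change _ + Module.finrank ℝ (heisenberg n hn).V₁ = _ at h2
  rw [finrank_span_singleton hT, h1, finrank_euclideanSpace] at h2
  simp only [Fintype.card_sum, Fintype.card_fin, Fintype.card_unit] at h2
  have : m = 2 * n := by omega
  rw [this]
  push_cast
  ring

theorem heisenberg_leftInv_heisT (g : HeisSpace n) :
    (heisenberg n hn).leftInv (heisT n) g = heisT n := by
  rw [StepTwoCarnot.leftInv_eq]
  change heisT n + (1 / 2 : ℝ) • heisBracket n g (heisT n) = heisT n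
  rw [heisBracket_apply, heisForm_heisT]
  simp

variable {Ω : Set (HeisSpace n)} {u : HeisSpace n → ℝ}

theorem heisenberg_comm_eq (hΩ : IsOpen Ω) (hu : ContDiffOn ℝ 2 u (closure Ω)) {g : HeisSpace n}
    (hg : g ∈ Ω) (i j : Fin m) : (heisenberg n hn).comm b i j u g =
      heisForm n (b i : HeisSpace n) (b j) * (heisenberg n hn).lieD (heisT n) u g := by
  have huΩ : ContDiffOn ℝ 2 u Ω := hu.mono subset_closure
  have hat : ContDiffAt ℝ 2 u g := huΩ.contDiffAt (hΩ.mem_nhds hg)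
  rw [StepTwoCarnot.comm, StepTwoCarnot.X_X_eq _ b hΩ huΩ hg, StepTwoCarnot.X_X_eq _ b hΩ huΩ hg,
    StepTwoCarnot.dirD_comm _ hat,
    StepTwoCarnot.lieD_eq_dirD _ (hat.differentiableAt (by norm_num)), StepTwoCarnot.dirD,
    heisenberg_leftInv_heisT]
  change fderiv ℝ u g (heisBracket n _ _) = _
  rw [heisBracket_apply, map_smul, smul_eq_mul]

theorem heisenberg_integrableOn_lieD_sq (hΩ : IsC2BoundedOpen Ω)
    (hu : ContDiffOn ℝ 2 u (closure Ω)) :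
    IntegrableOn (fun g => ((heisenberg n hn).lieD (heisT n) u g) ^ 2) Ω volume := by
  refine StepTwoCarnot.integrableOn_of_continuousOn_closure hΩ
    (((heisenberg n hn).continuousOn_dirDWithin (v := heisT n) hΩ.uniqueDiffOn
      (hu.of_le (by norm_num))).pow 2) fun g hg => ?_
  have hat : ContDiffAt ℝ 2 u g := (hu.mono subset_closure).contDiffAt (hΩ.1.mem_nhds hg)
  simp only [StepTwoCarnot.lieD_eq_dirD _ (hat.differentiableAt (by norm_num)), Pi.pow_apply,
    StepTwoCarnot.dirDWithin_eq _ (mem_of_superset (hΩ.1.mem_nhds hg) subset_closure)]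

theorem heisenberg_sum_integral_comm_sq (hΩ : IsC2BoundedOpen Ω)
    (hu : ContDiffOn ℝ 2 u (closure Ω)) :
    ∑ i, ∑ j, ∫ g in Ω, ((heisenberg n hn).comm b i j u g) ^ 2 =
      2 * (n : ℝ) * ∫ g in Ω, ((heisenberg n hn).lieD (heisT n) u g) ^ 2 := by
  have h (i j : Fin m) : ∫ g in Ω, ((heisenberg n hn).comm b i j u g) ^ 2 =
      heisForm n (b i : HeisSpace n) (b j) ^ 2 *
        ∫ g in Ω, ((heisenberg n hn).lieD (heisT n) u g) ^ 2 := by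
    rw [← integral_const_mul]
    refine setIntegral_congr_fun hΩ.1.measurableSet fun g hg => ?_
    simp only [heisenberg_comm_eq hn b hΩ.1 hu hg, mul_pow]
  simp only [h, ← Finset.sum_mul]
  rw [sum_heisForm_sq hn b]

end Heisenberg

end

theorem theoremT :
    (∀ (E : Type*) [NormedAddCommGroup E] [InnerProductSpace ℝ E] [FiniteDimensional ℝ E]
        [MeasurableSpace E] [BorelSpace E] (𝔾 : StepTwoCarnot E) (m : ℕ)
        (b : OrthonormalBasis (Fin m) ℝ 𝔾.V₁) (Ω : Set E) (u : E → ℝ),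
        IsC2BoundedOpen Ω → 𝔾.GammaClosure b Ω 3 u → ContDiffOn ℝ 2 u (closure Ω) →
        𝔾.HConvexOn b 2 Ω u → (∀ g ∈ frontier Ω, u g = 0) →
        (∀ i j, IntegrableOn (fun g => (𝔾.comm b i j u g) ^ 2) Ω volume) ∧
        Integrable (fun g => 𝔾.hMeanCurvature b Ω g * 𝔾.hGradSq b Ω u g)
          (𝔾.perimeterMeasure b Ω) ∧
        ∑ i, ∑ j, ∫ g in Ω, (𝔾.comm b i j u g) ^ 2 ≤
          4 / 3 * ∫ g, 𝔾.hMeanCurvature b Ω g * 𝔾.hGradSq b Ω u g ∂(𝔾.perimeterMeasure b Ω)) ∧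
    (∀ (n : ℕ) (hn : 1 ≤ n) (m : ℕ) (b : OrthonormalBasis (Fin m) ℝ (heisenberg n hn).V₁)
        (Ω : Set (HeisSpace n)) (u : HeisSpace n → ℝ),
        IsC2BoundedOpen Ω → (heisenberg n hn).GammaClosure b Ω 3 u →
        ContDiffOn ℝ 2 u (closure Ω) →
        (heisenberg n hn).HConvexOn b 2 Ω u → (∀ g ∈ frontier Ω, u g = 0) →
        IntegrableOn (fun g => ((heisenberg n hn).lieD (heisT n) u g) ^ 2) Ω volume ∧
        Integrable (fun g => (heisenberg n hn).hMeanCurvature b Ω g *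
          (heisenberg n hn).hGradSq b Ω u g) ((heisenberg n hn).perimeterMeasure b Ω) ∧
        ∫ g in Ω, ((heisenberg n hn).lieD (heisT n) u g) ^ 2 ≤
          2 / (3 * (n : ℝ)) * ∫ g, (heisenberg n hn).hMeanCurvature b Ω g *
            (heisenberg n hn).hGradSq b Ω u g ∂((heisenberg n hn).perimeterMeasure b Ω)) := by
  refine ⟨?_, ?_⟩
  · intro E _ _ _ _ _ 𝔾 m b Ω u hΩ _ hu hconv h0
    exact ⟨𝔾.integrableOn_comm_sq b hΩ hu, (𝔾.integral_hessQuad_eq b hΩ hu h0).2.1,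
      𝔾.sum_integral_comm_sq_le b hΩ hu hconv h0⟩
  · intro n hn m b Ω u hΩ _ hu hconv h0
    refine ⟨heisenberg_integrableOn_lieD_sq hn hΩ hu,
      ((heisenberg n hn).integral_hessQuad_eq b hΩ hu h0).2.1, ?_⟩
    have h := (heisenberg n hn).sum_integral_comm_sq_le b hΩ hu hconv h0
    -- The commutators sum to `2 n` times the integral of `(T u)²`, and dividing `4 / 3` by `2 n`
    -- gives `2 / (3 n)`.
    rw [heisenberg_sum_integral_comm_sq hn b hΩ hu] at h
    have hn0 : (0 : ℝ) < n := by exact_mod_cast hn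
    rw [div_mul_eq_mul_div, le_div_iff₀ (by positivity)]
    linarith
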